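/- Let $n\ge 1$, let $\lambda$ be a partition whose Young diagram has columns of length at most $2n-1$, and let $\mu$ be a partition with columns of length at most $n$. **The set $\operatorname{domres}(\lambda,\mu)$.** Let $\mathcal C_n=\{1<\cdots<n<\bar n<\cdots<\bar 1\}$. The word $w(T)$ of a semistandard tableau $T$ is obtained by reading its columns from right to left, each from top to bottom. The weight of a word is $\sum \varepsilon_{w_k}\in\mathbb Z^n$ with $\varepsilon_{\bar i}=-\varepsilon_i$; a weight is dominant if its coordinates are weakly decreasing and nonnegative. Then $\operatorname{domres}(\lambda,\mu)$ is the set of semistandard tableaux $T$ of shape $\lambda$ with entries in $\mathcal C_n$ such that every $\bar i$ in $w(T)$ has an $i$ to its left in $w(T)$ (cancellation property), every initial subword of $w(T)$ has dominant weight (dominance property), and $w(T)$ has weight $\mu$. **The set $\operatorname{LRS}(\lambda/\mu,\eta)$.** A partition is even if all its columns have even length. For $\eta$ even, $\operatorname{LRS}(\lambda/\mu,\eta)$ is empty unless $\mu\subseteq\lambda$, and otherwise consists of the semistandard fillings of $\lambda/\mu$ with entries in $\{1,\dots,2n\}$ whose word (columns from right to left, each from top to bottom, blank boxes ignored) contains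 exactly $\eta_i$ letters $i$ for all $i$ and has in each initial subword at least as many $i$'s as $(i+1)$'s, and in which, for $0\le i\le \tfrac12\ell(\eta)$, where $\ell(\eta)$ is the length of the longest column of $\eta$, the number $2i+1$ does not appear strictly below row $n+i$. **The map $\varphi$.** Write $x\to t$ for the column insertion of $x$ into a tableau $t$ with distinct entries, strictly increasing along rows and columns (a *standard* tableau); $x_1\to\cdots\to x_k\to t$ means that $x_k$ is inserted first. Let $T\in\operatorname{domres}(\lambda,\mu)$. Read $w(T)$ from left to right, starting from the empty tableau. If the $j$-th letter is $i$, add a box with entry $j$ at the end of row $i$. If it is $\bar i$, remove the leftmost entry $r_j$ of row $i$, shift the rest of the row one place to the left, and record the column $\binom{j}{r_j}$. The final tableau is the partial $Q$-symbol $Q^p_T$, and the recorded columns form, in this order, an array $\begin{bmatrix} j_1&\cdots&j_r\\ i_1&\cdots&i_r\end{bmatrix}$. Let $s_1,\dots,s_r$ be the ordering of $\{1,\dots,r\}$ with $i_{s_1}<\cdots<i_{s_r}$, and put $$E_T=j_{s_1}\to\cdots\to j_{s_r}\to i_1\to\cdots\to i_r\to\emptyset,\qquad Q_T=j_{s_1}\to\cdots\to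 j_{s_r}\to i_1\to\cdots\to i_r\to Q^p_T .$$ The filling $\varphi(T)$ of $\lambda/\mu$ has in row $i$, in weakly increasing order, one number $k$ for each entry of $E_T$ that lies in row $k$ of $E_T$ and in row $i$ of $Q_T$. **Theorem.** 1. For every $T\in\operatorname{domres}(\lambda,\mu)$, the tableau obtained after each step of the process is standard, and its row lengths are the coordinates of the weight of the subword read so far; $Q^p_T$ has shape $\mu$; $Q_T$ is standard of shape $\lambda$; $E_T$ is standard of some even shape $\eta$, and $\varphi(T)\in\operatorname{LRS}(\lambda/\mu,\eta)$ for this $\eta$. 2. Any two elements of $\operatorname{domres}(\lambda,\mu)$ have the same partial $Q$-symbol and the same final $Q$-symbol. 3. The map $\varphi$ is a bijection $$\operatorname{domres}(\lambda,\mu)\longrightarrow\bigcup_{\eta\ \mathrm{even}}\operatorname{LRS}(\lambda/\mu,\eta).$$ -/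

import Mathlib

namespace SymplecticBranching

/-! ### Words and the set `domres`

The alphabet `1 < ⋯ < n < n̄ < ⋯ < 1̄` is encoded in its order by the numbers `1, …, 2 * n`:
a letter `v ≤ n` is unbarred, and `ī` is `2 * n + 1 - i`.  Rows, columns and coordinates of
weights are indexed from `0`, so the letter `i + 1` belongs to row `i`, and the barred letter
that belongs to row `i` is `2 * n - i`. -/

/-- The word of a semistandard tableau: the columns are read from right to left, each of them from
top to bottom. -/
def word {lam : YoungDiagram} (T : SemistandardYoungTableau lam) : List ℕ :=
  (List.range (lam.rowLen 0)).reverse.flatMap fun j =>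
    (List.range (lam.colLen j)).map fun i => T i j

/-- The weight of a word: the coordinate `i < n` is the number of letters `i + 1` minus the number
of letters `i + 1` with a bar. -/
def weight (n : ℕ) (w : List ℕ) (i : ℕ) : ℤ :=
  if i < n then (w.count (i + 1) : ℤ) - (w.count (2 * n - i) : ℤ) else 0

/-- A weight of `𝔰𝔭(2n)` in coordinates `0, …, n - 1` is dominant if its coordinates are weakly
decreasing and nonnegative. -/
def IsDominantWeight (n : ℕ) (x : ℕ → ℤ) : Prop :=
  (∀ i, i + 1 < n → x (i + 1) ≤ x i) ∧ ∀ i, i < n → 0 ≤ x i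

/-- The cancellation property: each barred letter of the word is preceded by its unbarred letter. -/
def HasCancellation (n : ℕ) (w : List ℕ) : Prop :=
  ∀ i, 1 ≤ i → i ≤ n → ∀ u v : List ℕ, w = u ++ (2 * n + 1 - i) :: v → i ∈ u

/-- The dominance property: all initial subwords have dominant weight. -/
def HasDominance (n : ℕ) (w : List ℕ) : Prop :=
  ∀ u, u <+: w → IsDominantWeight n (weight n u)

/-- The set `domres(λ, μ)`. -/
def domres (n : ℕ) (lam mu : YoungDiagram) : Set (SemistandardYoungTableau lam) :=
  {T | (∀ i j, (i, j) ∈ lam → 1 ≤ T i j ∧ T i j ≤ 2 * n) ∧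
    HasCancellation n (word T) ∧ HasDominance n (word T) ∧
    ∀ i, weight n (word T) i = mu.rowLen i}

/-! ### Standard tableaux and column bumping

A tableau with distinct entries is represented by the list of its columns, from left to right,
each column being listed from top to bottom. -/

/-- Row `i` of a tableau, from left to right. -/
def row (t : List (List ℕ)) (i : ℕ) : List ℕ :=
  t.filterMap fun col => col[i]?

/-- The number of rows of a tableau. -/
def numRows (t : List (List ℕ)) : ℕ :=
  (t.headD []).length

/-- Standardness (the entries need not be `1, …, N`): the columns are nonempty and of weakly
decreasing length, and entries increase strictly along columns and rows. -/
def IsStandard (t : List (List ℕ)) : Prop :=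
  (∀ c ∈ t, c ≠ []) ∧ t.Pairwise (fun c d => d.length ≤ c.length) ∧
    (∀ c ∈ t, c.Pairwise (· < ·)) ∧ ∀ i, (row t i).Pairwise (· < ·)

/-- The column lengths of the tableau are those of the Young diagram. -/
def HasShape (t : List (List ℕ)) (nu : YoungDiagram) : Prop :=
  ∀ j, (t.getD j []).length = nu.colLen j

/-- A partition is even if all its columns have even length. -/
def IsEvenShape (nu : YoungDiagram) : Prop :=
  ∀ j, Even (nu.colLen j)

/-- Insertion of `x` into one column: the new column, and the entry bumped out, if any.  The
smallest entry that is larger than `x` is replaced by `x`; without such an entry, `x` is put at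
the bottom. -/
def insertInColumn (x : ℕ) : List ℕ → List ℕ × Option ℕ
  | [] => ([x], none)
  | y :: c => if x < y then (x :: c, some y) else
      (y :: (insertInColumn x c).1, (insertInColumn x c).2)

/-- Column bumping `x → t`. -/
def columnInsert (x : ℕ) : List (List ℕ) → List (List ℕ)
  | [] => [[x]]
  | c :: t => (insertInColumn x c).1 ::
      match (insertInColumn x c).2 with
      | none => t
      | some y => columnInsert y t

/-- `x₁ → x₂ → ⋯ → x_k → t`; the last letter `x_k` is inserted first. -/
def bumpAll (xs : List ℕ) (t : List (List ℕ)) : List (List ℕ) :=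
  xs.foldr columnInsert t

/-! ### The up-down sequence, the `Q`-symbols and the even tableau -/

/-- Put `x` into a new box at the end of row `i`. -/
def addBox (x i : ℕ) : List (List ℕ) → List (List ℕ)
  | [] => [[x]]
  | c :: t => if c.length ≤ i then (c ++ [x]) :: t else c :: addBox x i t

/-- Remove the leftmost entry of row `i` and shift the other entries of row `i` one place to the
left.  A column that becomes empty is dropped. -/
def removeBox (i : ℕ) : List (List ℕ) → List (List ℕ)
  | [] => []
  | c :: t =>
      match (t.headD [])[i]? with
      | some y => c.set i y :: removeBox i t
      | none => if c.eraseIdx i = [] then t else c.eraseIdx i :: t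

/-- Step `j` of the up-down sequence, for the letter `v`.  The state consists of the partial
`Q`-symbol, whose shape is the current shape of the sequence, and of the list of the columns
`(j, r_j)` of the two-line array.  An unbarred letter adds a box with entry `j` to its row; a
barred letter removes a box from its row, and `r_j` is the entry that leaves the tableau. -/
def upDownStep (n : ℕ) (s : List (List ℕ) × List (ℕ × ℕ)) (p : ℕ × ℕ) :
    List (List ℕ) × List (ℕ × ℕ) :=
  let v := p.1
  let j := p.2
  if v ≤ n then (addBox j (v - 1) s.1, s.2)
  else (removeBox (2 * n - v) s.1, s.2 ++ [(j, (row s.1 (2 * n - v)).headD 0)])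

/-- The up-down process along a word, whose steps are numbered from `1`. -/
def upDown (n : ℕ) (w : List ℕ) : List (List ℕ) × List (ℕ × ℕ) :=
  (w.zipIdx 1).foldl (upDownStep n) ([], [])

/-- The partial `Q`-symbol of a word. -/
def partialQ (n : ℕ) (w : List ℕ) : List (List ℕ) := (upDown n w).1

/-- The two-line array of a word, as the list of its columns `(j, i)`. -/
def twoLineArray (n : ℕ) (w : List ℕ) : List (ℕ × ℕ) := (upDown n w).2

/-- For the array with columns `(j₁, i₁), …, (j_r, i_r)`, the sequence
`j_{s₁}, …, j_{s_r}, i₁, …, i_r`, where `i_{s₁} < ⋯ < i_{s_r}`. -/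
def bumpingSequence (L : List (ℕ × ℕ)) : List ℕ :=
  (L.insertionSort fun p q => p.2 ≤ q.2).map Prod.fst ++ L.map Prod.snd

/-- The tableau `E_T` of even shape. -/
def evenTableau (n : ℕ) (w : List ℕ) : List (List ℕ) :=
  bumpAll (bumpingSequence (twoLineArray n w)) []

/-- The final `Q`-symbol `Q_T`. -/
def finalQ (n : ℕ) (w : List ℕ) : List (List ℕ) :=
  bumpAll (bumpingSequence (twoLineArray n w)) (partialQ n w)

/-! ### Littlewood–Richardson–Sundaram tableaux -/

/-- The word of a filling of `λ / μ`: the columns are read from right to left, each of them from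
top to bottom, ignoring the blank boxes. -/
def skewWord (lam mu : YoungDiagram) (S : ℕ → ℕ → ℕ) : List ℕ :=
  (List.range (lam.rowLen 0)).reverse.flatMap fun j =>
    ((List.range (lam.colLen j)).filter fun i => mu.colLen j ≤ i).map fun i => S i j

/-- `S` is a semistandard tableau of skew shape `λ / μ` with entries in `{1, …, 2 * n}`; the value
`0` stands for "no entry". -/
def IsSemistandardSkew (n : ℕ) (lam mu : YoungDiagram) (S : ℕ → ℕ → ℕ) : Prop :=
  mu ≤ lam ∧
  (∀ i j, (i, j) ∈ lam → (i, j) ∉ mu → 1 ≤ S i j ∧ S i j ≤ 2 * n) ∧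
  (∀ i j, ¬((i, j) ∈ lam ∧ (i, j) ∉ mu) → S i j = 0) ∧
  (∀ i j k, j < k → (i, j) ∉ mu → (i, k) ∈ lam → S i j ≤ S i k) ∧
  (∀ i k j, i < k → (i, j) ∉ mu → (k, j) ∈ lam → S i j < S k j)

/-- The word is dominant: each initial subword contains at least as many `i`'s as `i + 1`'s. -/
def IsDominantWord (w : List ℕ) : Prop :=
  ∀ u, u <+: w → ∀ i, 1 ≤ i → u.count (i + 1) ≤ u.count i

/-- The set `LRS(λ / μ, η)`: the Littlewood–Richardson tableaux of skew shape `λ / μ` and weight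
`η` in which, for `0 ≤ i ≤ ℓ(η) / 2`, the number `2 * i + 1` does not appear strictly below the
`(n + i)`-th row (the row with index `r` is the `(r + 1)`-st). -/
def LRS (n : ℕ) (lam mu eta : YoungDiagram) : Set (ℕ → ℕ → ℕ) :=
  {S | IsSemistandardSkew n lam mu S ∧
    IsDominantWord (skewWord lam mu S) ∧
    (∀ i, (skewWord lam mu S).count (i + 1) = eta.rowLen i) ∧
    ∀ i, i ≤ eta.colLen 0 / 2 → ∀ r c, S r c = 2 * i + 1 → r + 1 ≤ n + i}

/-! ### The map `φ` -/

/-- The numbers to be written into row `i` of `λ / μ`, in weakly increasing order: one number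
`k + 1` for each entry of `E_T` that lies in row `k` of `E_T` and in row `i` of `Q_T`. -/
def fillingRow (n : ℕ) (w : List ℕ) (i : ℕ) : List ℕ :=
  (List.range (numRows (evenTableau n w))).flatMap fun k =>
    ((row (evenTableau n w) k).filter fun x => x ∈ row (finalQ n w) i).map fun _ => k + 1

/-- The filling `φ(T)`: in row `i`, the first `μ_i` boxes are blank and the boxes after them are
filled from left to right with the numbers of `fillingRow`. -/
def phi (n : ℕ) (mu : YoungDiagram) {lam : YoungDiagram} (T : SemistandardYoungTableau lam) :
    ℕ → ℕ → ℕ :=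
  fun i j => if j < mu.rowLen i then 0 else (fillingRow n (word T) i).getD (j - mu.rowLen i) 0

end SymplecticBranching

open SymplecticBranching

namespace SymplecticBranching

/-! ### Bumping preserves standardness -/

/-! Number the cells of λ by the step at which they are read (`lab`). Going down a column the labels
are consecutive (`lab_succ`), and they decrease from left to right along a row. A dominant tableau T
then becomes a matching: each barred cell closes an earlier unbarred cell, and the two-line array L
lists the pairs (label of the closer, label of the opener). An unbarred letter is fixed by its own
row (`IsMatching.entry_eq`) and a barred letter by the row of its opener, so L determines T
(`IsMatching.ext`).

The central notion is that of a picture: an arrangement of the cells of a diagram in which no cell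
is weakly north-west of a later one. Bumping the labels of a picture rebuilds the diagram, each
label landing in the row of its own cell (`IsPicture.isTab`). The partial Q-symbol is the label
tableau of μ, and the bumping sequence of L followed by the labels of μ is a picture of λ
(`IsMatching.isPicture`). Hence the final Q-symbol is the label tableau of λ. Neither symbol depends
on T, the entries of E_T are the labels of λ/μ, and φ(T) writes into each cell the row of its label
in E_T (`phi_eq_fill`).

Being a picture of λ is invariant under Knuth equivalence (`IsPicture.knuth`), so the bumping
sequence may be replaced by the row reading word of E_T. For that word the picture condition is
equivalent to semistandardness of the filling (`colIdx_order`, `isPicture_of_isSemistandardSkew`),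
while the lattice condition on the filling says that the rows of E_T dominate one another.

Greene's theorem (`hasDec_bumpAll`) carries the tableau theory. It shows that restricting a word to
small letters restricts its tableau, that reversing the word transposes it, and that E_T has even
columns (`IsBurge.even_len`). The map from L to E_T is a Burge-type bijection onto tableaux of even
shape. It is inverted one array column at a time, parity telling where the insertion ended
(`exists_burgeRows`, `burgeRows_injective`).

There remains the row bound of Sundaram. In the first column of λ the cells below row n have
consecutive labels and must be barred. When these labels enter E_T, each lands strictly below the
preceding one and in a row of odd index counted from 0, so the cell in row n + d gets index at least
2d + 1 (`IsMatching.le_colIdx_insert`). Conversely, the bound survives removal of the last array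
column and forces those cells to be closers (`exists_pair_of_le_colIdx`). This keeps all other cells
in the first n rows (`IsSkewArray.row_lt`), and then L defines a dominant tableau. -/

/-- For all `b`, the list `c` has at least as many entries `≤ b` as the list `d`. -/
def Dom (c d : List ℕ) : Prop :=
  ∀ b, d.countP (· ≤ b) ≤ c.countP (· ≤ b)

/-- Standardness of a tableau given by the list of its columns (or of its rows): all lists are
nonempty and increasing, each list dominates the next one, and all entries are distinct. -/
def Std (t : List (List ℕ)) : Prop :=
  (∀ c ∈ t, c ≠ [] ∧ c.Pairwise (· < ·)) ∧ t.Pairwise Dom ∧ t.flatten.Nodup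

theorem Dom.trans {a b c : List ℕ} (h : Dom a b) (h' : Dom b c) : Dom a c :=
  fun n => (h' n).trans (h n)

theorem dom_nil (c : List ℕ) : Dom c [] := fun b => by simp

theorem std_nil : Std [] := by simp [Std]

theorem std_cons {c : List ℕ} {t : List (List ℕ)} :
    Std (c :: t) ↔ c ≠ [] ∧ c.Pairwise (· < ·) ∧ Dom c (t.headD []) ∧
      (c ++ t.flatten).Nodup ∧ Std t := by
  constructor
  · rintro ⟨h1, h2, h3⟩
    rw [List.pairwise_cons] at h2
    refine ⟨(h1 c (by simp)).1, (h1 c (by simp)).2, ?_, by simpa using h3,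
      fun d hd => h1 d (by simp [hd]), h2.2, ?_⟩
    · cases t with
      | nil => exact dom_nil c
      | cons d t => exact h2.1 d (by simp)
    · rw [List.flatten_cons] at h3
      exact (List.nodup_append.1 h3).2.1
  · rintro ⟨h1, h2, h3, h4, h5⟩
    refine ⟨?_, ?_, by simpa using h4⟩
    · intro d hd
      rcases List.mem_cons.1 hd with rfl | hd
      · exact ⟨h1, h2⟩
      · exact h5.1 d hd
    · refine List.pairwise_cons.2 ⟨?_, h5.2.1⟩
      intro d hd
      cases t with
      | nil => simp at hd
      | cons e t =>
        rcases List.mem_cons.1 hd with rfl | hd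
        · exact h3
        · exact Dom.trans h3 ((List.pairwise_cons.1 h5.2.1).1 d hd)

theorem insertInColumn_cases (x : ℕ) (c : List ℕ) (hx : x ∉ c) :
    ((∀ a ∈ c, a < x) ∧ insertInColumn x c = (c ++ [x], none)) ∨
      ∃ l y r, c = l ++ y :: r ∧ (∀ a ∈ l, a < x) ∧ x < y ∧
        insertInColumn x c = (l ++ x :: r, some y) := by
  induction c with
  | nil => left; simp [insertInColumn]
  | cons y c ih =>
    by_cases h : x < y
    · right
      exact ⟨[], y, c, by simp, by simp, h, by simp [insertInColumn, h]⟩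
    · have hxy : y < x := by
        have : x ≠ y := fun e => hx (by simp [e])
        omega
      rcases ih (fun h' => hx (by simp [h'])) with ⟨h1, h2⟩ | ⟨l, z, r, h1, h2, h3, h4⟩
      · left
        refine ⟨?_, by simp [insertInColumn, h, h2]⟩
        intro a ha
        rcases List.mem_cons.1 ha with rfl | ha
        · exact hxy
        · exact h1 a ha
      · right
        refine ⟨y :: l, z, r, by simp [h1], ?_, h3, by simp [insertInColumn, h, h4]⟩
        intro a ha
        rcases List.mem_cons.1 ha with rfl | ha
        · exact hxy
        · exact h2 a ha

/-- The two ways in which `x → c :: t` begins. -/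
theorem columnInsert_cases (x : ℕ) (c : List ℕ) (t : List (List ℕ)) (hx : x ∉ c) :
    ((∀ a ∈ c, a < x) ∧ columnInsert x (c :: t) = (c ++ [x]) :: t) ∨
      ∃ l y r, c = l ++ y :: r ∧ (∀ a ∈ l, a < x) ∧ x < y ∧
        columnInsert x (c :: t) = (l ++ x :: r) :: columnInsert y t := by
  rcases insertInColumn_cases x c hx with ⟨h1, h2⟩ | ⟨l, y, r, h1, h2, h3, h4⟩
  · left; exact ⟨h1, by simp [columnInsert, h2]⟩
  · right; exact ⟨l, y, r, h1, h2, h3, by simp [columnInsert, h4]⟩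

theorem headD_columnInsert (x : ℕ) (t : List (List ℕ)) :
    (columnInsert x t).headD [] = (insertInColumn x (t.headD [])).1 := by
  cases t <;> simp [columnInsert, insertInColumn]

/-- Putting `y` into `d` raises the count only for thresholds from `y` up to the entry that `y`
displaces. There `d` itself contributes just its entries below `y`. The hypothesis at threshold `y -
1` bounds their number by the entries below `y` of the upper list, which has one further entry `≤
b`, namely `y`, now replaced by `x`. -/
theorem dom_insert {l r d : List ℕ} {x y : ℕ} (hd : d.Pairwise (· < ·)) (hxy : x < y) (hyd : y ∉ d)
    (h : Dom (l ++ y :: r) d) : Dom (l ++ x :: r) (insertInColumn y d).1 := by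
  have mono : ∀ (e : List ℕ) {b b' : ℕ}, b ≤ b' → e.countP (· ≤ b) ≤ e.countP (· ≤ b') := by
    intro e b b' hb
    apply List.countP_mono_left
    intro a _ ha
    simp only [decide_eq_true_eq] at *
    omega
  have allc : ∀ (e : List ℕ) {b : ℕ}, (∀ a ∈ e, a ≤ b) → e.countP (· ≤ b) = e.length := by
    intro e b hb
    rw [List.countP_eq_length]
    simpa using hb
  have h1 := h (y - 1)
  rcases insertInColumn_cases y d hyd with ⟨h2, h3⟩ | ⟨l2, y2, r2, h2, h3, h4, h5⟩
  · rw [h3]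
    intro b
    have hb := h b
    simp only [List.countP_append, List.countP_cons, List.countP_nil, decide_eq_true_eq] at *
    by_cases hby : y ≤ b
    · have e1 : d.countP (· ≤ b) = d.length := allc d fun a ha => (h2 a ha).le.trans hby
      have e2 : d.countP (· ≤ y - 1) = d.length := allc d fun a ha => by have := h2 a ha; omega
      have m1 := mono l (show y - 1 ≤ b by omega)
      have m2 := mono r (show y - 1 ≤ b by omega)
      rw [if_neg (by omega)] at h1
      rw [if_pos hby, if_pos (by omega)]
      omega
    · rw [if_neg hby] at *
      split_ifs <;> omega
  · rw [h5]
    intro b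
    have hb := h b
    subst h2
    simp only [List.countP_append, List.countP_cons, decide_eq_true_eq] at *
    have hr2 : ∀ a ∈ r2, y2 < a := by
      intro a ha
      have := (List.pairwise_append.1 hd).2.1
      exact (List.pairwise_cons.1 this).1 a ha
    by_cases hby : y ≤ b
    · by_cases hb2 : y2 ≤ b
      · rw [if_pos hb2, if_pos hby] at hb
        rw [if_pos hby, if_pos (by omega)]
        omega
      · have e0 : r2.countP (· ≤ b) = 0 := by
          rw [List.countP_eq_zero]
          intro a ha
          have := hr2 a ha
          simp only [decide_eq_true_eq]
          omega
        have e1 : l2.countP (· ≤ b) = l2.length := allc l2 fun a ha => (h3 a ha).le.trans hby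
        have e2 : l2.countP (· ≤ y - 1) = l2.length :=
          allc l2 fun a ha => by have := h3 a ha; omega
        have m1 := mono l (show y - 1 ≤ b by omega)
        have m2 := mono r (show y - 1 ≤ b by omega)
        rw [if_neg (show ¬ y ≤ y - 1 by omega)] at h1
        rw [if_pos hby, if_pos (by omega)]
        omega
    · rw [if_neg hby] at *
      split_ifs at * <;> omega

theorem columnInsert_perm : ∀ (t : List (List ℕ)) (x : ℕ),
    (columnInsert x t).flatten.Perm (x :: t.flatten) := by
  have key : ∀ (c : List ℕ) (x : ℕ),
      ((insertInColumn x c).1 ++ (insertInColumn x c).2.toList).Perm (x :: c) := by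
    intro c
    induction c with
    | nil => intro x; simp [insertInColumn]
    | cons y c ih =>
      intro x
      by_cases h : x < y
      · simp only [insertInColumn, h, if_true, List.cons_append, Option.toList_some]
        refine List.Perm.cons _ ?_
        simp
      · simp only [insertInColumn, h, if_false, List.cons_append]
        exact (List.Perm.cons _ (ih x)).trans (List.Perm.swap _ _ _)
  intro t
  induction t with
  | nil => intro x; simp [columnInsert]
  | cons c t ih =>
    intro x
    have hk := key c x
    rw [columnInsert]
    cases hy : (insertInColumn x c).2 with
    | none =>
      rw [hy] at hk
      simp only [List.flatten_cons]
      simpa using hk.append_right t.flatten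
    | some y =>
      rw [hy] at hk
      simp only [List.flatten_cons]
      refine ((ih y).append_left _).trans ?_
      simpa using hk.append_right t.flatten

theorem Std.columnInsert {t : List (List ℕ)} (h : Std t) {x : ℕ} (hx : x ∉ t.flatten) :
    Std (columnInsert x t) := by
  induction t generalizing x with
  | nil => simp [SymplecticBranching.columnInsert, Std]
  | cons c t ih =>
    have hnd : (SymplecticBranching.columnInsert x (c :: t)).flatten.Nodup := by
      rw [(columnInsert_perm _ _).nodup_iff]
      exact List.nodup_cons.2 ⟨hx, h.2.2⟩
    obtain ⟨h1, h2, h3, h4, h5⟩ := std_cons.1 h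
    simp only [List.flatten_cons, List.mem_append, not_or] at hx
    rcases columnInsert_cases x c t hx.1 with ⟨h6, h7⟩ | ⟨l, y, r, h6, h7, h8, h9⟩
    · rw [h7] at hnd ⊢
      refine std_cons.2 ⟨by simp, ?_, ?_, by simpa using hnd, h5⟩
      · rw [List.pairwise_append]
        refine ⟨h2, by simp, ?_⟩
        intro a ha b hb
        rw [List.mem_singleton.1 hb]
        exact h6 a ha
      · intro b
        have := h3 b
        rw [List.countP_append]
        omega
    · rw [h9] at hnd ⊢
      have hyt : y ∉ t.flatten := by
        intro hy
        exact (List.nodup_append.1 h4).2.2 y (by simp [h6]) y hy rfl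
      refine std_cons.2 ⟨by simp, ?_, ?_, by simpa using hnd, ih h5 hyt⟩
      · rw [h6, List.pairwise_append, List.pairwise_cons] at h2
        rw [List.pairwise_append, List.pairwise_cons]
        refine ⟨h2.1, ⟨fun a ha => h8.trans (h2.2.1.1 a ha), h2.2.1.2⟩, ?_⟩
        intro a ha b hb
        rcases List.mem_cons.1 hb with rfl | hb
        · exact h7 a ha
        · exact h2.2.2 a ha b (by simp [hb])
      · rw [headD_columnInsert]
        subst h6
        refine dom_insert ?_ h8 ?_ h3
        · cases t with
          | nil => simp
          | cons d t => exact (std_cons.1 h5).2.1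
        · cases t with
          | nil => simp
          | cons d t =>
            simp only [List.flatten_cons, List.mem_append, not_or] at hyt
            exact hyt.1

theorem bumpAll_perm (w : List ℕ) (t : List (List ℕ)) :
    (bumpAll w t).flatten.Perm (w ++ t.flatten) := by
  induction w with
  | nil => simp [bumpAll]
  | cons x w ih => exact (columnInsert_perm _ x).trans (List.Perm.cons x ih)

theorem bumpAll_append (u v : List ℕ) (t : List (List ℕ)) :
    bumpAll (u ++ v) t = bumpAll u (bumpAll v t) := by
  simp [bumpAll]

theorem std_bumpAll {w : List ℕ} (h : w.Nodup) : Std (bumpAll w []) := by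
  induction w with
  | nil => exact std_nil
  | cons x w ih =>
    rw [List.nodup_cons] at h
    refine Std.columnInsert (ih h.2) ?_
    rw [(bumpAll_perm w []).mem_iff]
    simpa using h.1

/-! ### Knuth equivalence -/

/-- The elementary Knuth moves `y z x ~ y x z` and `x z y ~ z x y` for `x < y < z`. -/
inductive KnuthStep : List ℕ → List ℕ → Prop
  | yzx (u v : List ℕ) (x y z : ℕ) : x < y → y < z →
      KnuthStep (u ++ y :: z :: x :: v) (u ++ y :: x :: z :: v)
  | xzy (u v : List ℕ) (x y z : ℕ) : x < y → y < z →
      KnuthStep (u ++ x :: z :: y :: v) (u ++ z :: x :: y :: v)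

/-- Knuth equivalence of words. -/
def Knuth : List ℕ → List ℕ → Prop := Relation.EqvGen KnuthStep

theorem Knuth.refl (w : List ℕ) : Knuth w w := Relation.EqvGen.refl w

theorem Knuth.symm {u v : List ℕ} (h : Knuth u v) : Knuth v u := Relation.EqvGen.symm _ _ h

theorem Knuth.trans {u v w : List ℕ} (h : Knuth u v) (h' : Knuth v w) : Knuth u w :=
  Relation.EqvGen.trans _ _ _ h h'

theorem KnuthStep.knuth {u v : List ℕ} (h : KnuthStep u v) : Knuth u v := Relation.EqvGen.rel _ _ h

theorem Knuth.map {f : List ℕ → List ℕ} (hf : ∀ u v, KnuthStep u v → Knuth (f u) (f v))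
    {u v : List ℕ} (h : Knuth u v) : Knuth (f u) (f v) := by
  induction h with
  | rel u v h => exact hf u v h
  | refl u => exact Knuth.refl _
  | symm u v _ ih => exact ih.symm
  | trans u v w _ _ ih1 ih2 => exact ih1.trans ih2

theorem Knuth.append_left (a : List ℕ) {u v : List ℕ} (h : Knuth u v) :
    Knuth (a ++ u) (a ++ v) := by
  refine h.map (f := fun w => a ++ w) ?_
  intro u v h
  cases h with
  | yzx u v x y z h1 h2 => simpa using (KnuthStep.yzx (a ++ u) v x y z h1 h2).knuth
  | xzy u v x y z h1 h2 => simpa using (KnuthStep.xzy (a ++ u) v x y z h1 h2).knuth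

theorem Knuth.append_right (a : List ℕ) {u v : List ℕ} (h : Knuth u v) :
    Knuth (u ++ a) (v ++ a) := by
  refine h.map (f := fun w => w ++ a) ?_
  intro u v h
  cases h with
  | yzx u v x y z h1 h2 => simpa using (KnuthStep.yzx u (v ++ a) x y z h1 h2).knuth
  | xzy u v x y z h1 h2 => simpa using (KnuthStep.xzy u (v ++ a) x y z h1 h2).knuth

theorem Knuth.cons (a : ℕ) {u v : List ℕ} (h : Knuth u v) : Knuth (a :: u) (a :: v) :=
  h.append_left [a]

theorem Knuth.reverse {u v : List ℕ} (h : Knuth u v) : Knuth u.reverse v.reverse := by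
  refine h.map (f := List.reverse) ?_
  intro u v h
  cases h with
  | yzx u v x y z h1 h2 => simpa using (KnuthStep.xzy v.reverse u.reverse x y z h1 h2).knuth
  | xzy u v x y z h1 h2 =>
    simpa using (KnuthStep.yzx v.reverse u.reverse x y z h1 h2).knuth

/-- On an interval of letters a Knuth move either survives or becomes trivial: if the middle letter
`y` is dropped, then so is `x` or `z`, and the exchange is no longer visible. -/
theorem Knuth.filter {p : ℕ → Bool} (hp : ∀ a b c, a < b → b < c → p a → p c → p b)
    {u v : List ℕ} (h : Knuth u v) : Knuth (u.filter p) (v.filter p) := by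
  refine h.map (f := List.filter p) ?_
  intro u v h
  cases h with
  | yzx u v x y z h1 h2 =>
    have := hp x y z h1 h2
    cases hx : p x <;> cases hy : p y <;> cases hz : p z <;>
      simp_all [Knuth.refl]
    exact (KnuthStep.yzx _ _ x y z h1 h2).knuth
  | xzy u v x y z h1 h2 =>
    have := hp x y z h1 h2
    cases hx : p x <;> cases hy : p y <;> cases hz : p z <;>
      simp_all [Knuth.refl]
    exact (KnuthStep.xzy _ _ x y z h1 h2).knuth

theorem Knuth.perm {u v : List ℕ} (h : Knuth u v) : u.Perm v := by
  induction h with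
  | rel u v h =>
    cases h with
    | yzx u v x y z h1 h2 =>
      exact List.Perm.append_left _ (List.Perm.cons _ (List.Perm.swap _ _ _))
    | xzy u v x y z h1 h2 => exact List.Perm.append_left _ (List.Perm.swap _ _ _)
  | refl u => exact List.Perm.refl _
  | symm u v _ ih => exact ih.symm
  | trans u v w _ _ ih1 ih2 => exact ih1.trans ih2

/-! ### Reading words, and column insertion as a Knuth equivalence -/

/-- The column reading word: the columns from left to right, each from bottom to top. -/
def colRead (t : List (List ℕ)) : List ℕ := t.flatMap List.reverse

theorem colRead_cons (c : List ℕ) (t : List (List ℕ)) :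
    colRead (c :: t) = c.reverse ++ colRead t := by
  simp [colRead]

theorem colRead_perm (t : List (List ℕ)) : (colRead t).Perm t.flatten := by
  induction t with
  | nil => simp [colRead]
  | cons c t ih =>
    rw [colRead_cons, List.flatten_cons]
    exact (List.reverse_perm c).append ih

/-- The letter `x` passes the entries of `d` one after another. In each move `x z y ~ z x y` the
next letter to the right, at the end `y`, serves as the middle letter. -/
theorem knuth_slide_left {x y : ℕ} : ∀ (d : List ℕ), d.Pairwise (· > ·) → (∀ a ∈ d, y < a) →
    x < y → ∀ v, Knuth (x :: (d ++ y :: v)) (d ++ x :: y :: v) := by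
  intro d
  induction d with
  | nil => intro _ _ _ v; exact Knuth.refl _
  | cons a d ih =>
    intro hd ha hxy v
    rw [List.pairwise_cons] at hd
    have hya := ha a (by simp)
    have h2 := ih hd.2 (fun b hb => ha b (by simp [hb])) hxy v
    refine Knuth.trans ?_ (h2.cons a)
    cases d with
    | nil => exact (KnuthStep.xzy [] v x y a hxy hya).knuth
    | cons b d =>
      exact (KnuthStep.xzy [] (d ++ y :: v) x b a (hxy.trans (ha b (by simp)))
        (hd.1 b (by simp))).knuth

/-- Here `y` travels to the right by moves `y z x ~ y x z`. The letter just passed is the middle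
letter of the next move, so `x` is generalized in the induction. -/
theorem knuth_slide_right {x y : ℕ} : ∀ (e : List ℕ), e.Pairwise (· > ·) → (∀ a ∈ e, a < x) →
    x < y → ∀ v, Knuth (x :: y :: (e ++ v)) (x :: (e ++ y :: v)) := by
  intro e
  induction e generalizing x with
  | nil => intro _ _ _ v; exact Knuth.refl _
  | cons a e ih =>
    intro he ha hxy v
    rw [List.pairwise_cons] at he
    have hax := ha a (by simp)
    refine Knuth.trans (KnuthStep.yzx [] (e ++ v) a x y hax hxy).knuth ?_
    exact (ih he.2 he.1 (hax.trans hxy) v).cons x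

/-- If `x` bumps `y` out of the first column, then `x` slides left-to-right through the entries
above `y` in value, and `y` slides out past the entries below `x`. The word now begins with the new
first column, and `y` stands in front of the remaining columns, where the induction takes over. -/
theorem knuth_columnInsert {t : List (List ℕ)} (h : Std t) {x : ℕ} (hx : x ∉ t.flatten) :
    Knuth (x :: colRead t) (colRead (columnInsert x t)) := by
  induction t generalizing x with
  | nil => simpa [colRead, columnInsert] using Knuth.refl [x]
  | cons c t ih =>
    obtain ⟨h1, h2, h3, h4, h5⟩ := std_cons.1 h
    simp only [List.flatten_cons, List.mem_append, not_or] at hx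
    rcases columnInsert_cases x c t hx.1 with ⟨h6, h7⟩ | ⟨l, y, r, h6, h7, h8, h9⟩
    · rw [h7, colRead_cons, colRead_cons]
      simp [Knuth.refl]
    · have hyt : y ∉ t.flatten := by
        intro hy
        exact (List.nodup_append.1 h4).2.2 y (by simp [h6]) y hy rfl
      rw [h9, colRead_cons, colRead_cons]
      refine Knuth.trans ?_ ((ih h5 hyt).append_left _)
      subst h6
      rw [List.pairwise_append, List.pairwise_cons] at h2
      have e1 := knuth_slide_left (x := x) (y := y) r.reverse
        (List.pairwise_reverse.2 h2.2.1.2) (by simpa using h2.2.1.1) h8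
        (l.reverse ++ colRead t)
      have e2 := (knuth_slide_right (x := x) (y := y) l.reverse
        (List.pairwise_reverse.2 h2.1) (by simpa using h7) h8 (colRead t)).append_left r.reverse
      simpa using e1.trans e2

theorem knuth_colRead_bumpAll {w : List ℕ} (h : w.Nodup) : Knuth w (colRead (bumpAll w [])) := by
  induction w with
  | nil => exact Knuth.refl _
  | cons x w ih =>
    rw [List.nodup_cons] at h
    refine ((ih h.2).cons x).trans (knuth_columnInsert (std_bumpAll h.2) ?_)
    rw [(bumpAll_perm w []).mem_iff]
    simpa using h.1

/-! ### Unions of decreasing subsequences -/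

/-- Some `k` disjoint decreasing subsequences of `w` cover at least `m` letters. -/
def HasDec (k : ℕ) (w : List ℕ) (m : ℕ) : Prop :=
  ∃ f : ℕ → ℕ, w.Pairwise (fun a b => f a = f b → f a < k → b < a) ∧
    m ≤ w.countP (fun a => f a < k)

/-- One half of Greene's invariance. Exchanging `z` and `x` harms a family of decreasing chains only
when both lie in one chain. The chain is then repaired with the help of `y`, without loss of
letters. -/
theorem HasDec.yzx {k m : ℕ} {u v : List ℕ} {x y z : ℕ} (hxy : x < y) (hyz : y < z)
    (hn : (u ++ y :: z :: x :: v).Nodup) :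
    HasDec k (u ++ y :: z :: x :: v) m ↔ HasDec k (u ++ y :: x :: z :: v) m := by
  constructor
  · rintro ⟨f, hf, hm⟩
    by_cases hzx : f z = f x ∧ f z < k
    · obtain ⟨hzx, hz⟩ := hzx
      have hyz' : f y ≠ f z := by
        intro h
        have := (List.pairwise_cons.1 (List.pairwise_append.1 hf).2.1).1 z (by simp) h (by omega)
        omega
      simp only [List.nodup_append, List.nodup_cons, List.mem_cons, not_or] at hn
      obtain ⟨-, ⟨⟨hn1, hn2, hn3⟩, ⟨hn4, hn5⟩, hn6, -⟩, hn7⟩ := hn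
      have hu : ∀ a ∈ u, a ≠ y ∧ a ≠ z ∧ a ≠ x ∧ a ∉ v := fun a ha =>
        ⟨hn7 a ha y (by simp), hn7 a ha z (by simp), hn7 a ha x (by simp),
          fun h => hn7 a ha a (by simp [h]) rfl⟩
      simp only [List.pairwise_append, List.pairwise_cons, List.mem_cons, forall_eq_or_imp] at hf
      obtain ⟨h1, ⟨⟨h2, h3, h4⟩, ⟨h5, h6⟩, h7, h8⟩, h9⟩ := hf
      rw [List.countP_append, List.countP_cons, List.countP_cons, List.countP_cons] at hm
      by_cases hy : f y < k
      -- The letter `y` is in another chain, so the tails of the two chains are exchanged: `x`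
      -- continues the chain of `y`, followed by the old tail of `x`, and `z` is followed by the old
      -- tail of `y`, whose entries are below `y < z`.
      · refine ⟨fun a => if a = x then f y else
          if a ∈ v then Equiv.swap (f z) (f y) (f a) else f a, ?_, ?_⟩
        · simp only [List.pairwise_append, List.pairwise_cons, List.mem_cons, forall_eq_or_imp]
          have hv : ∀ b ∈ v, b ≠ x := fun b hb e => hn6 (e ▸ hb)
          refine ⟨?_, ⟨⟨?_, ?_, ?_⟩, ⟨?_, ?_⟩, ?_, ?_⟩, ?_⟩
          · refine h1.imp_of_mem ?_
            intro a b ha hb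
            simp only [hu a ha, hu b hb, if_false]
            exact id
          · intros; exact hxy
          · simp only [hn2, hn3, hn4, hn5, if_false]
            intro h; exact absurd h hyz'
          · intro b hb
            simp only [hb, hn2, hn3, hv b hb, if_false, if_true]
            intro h hk
            have e : f b = f z := by
              apply (Equiv.swap (f z) (f y)).injective
              rw [← h, Equiv.swap_apply_left]
            have := h7 b hb (by omega) (by omega)
            omega
          · simp only [if_true, hn4, hn5, if_false]
            intro h; exact absurd h hyz'
          · intro b hb
            simp only [hb, hv b hb, if_false, if_true]
            intro h hk
            have e : f b = f z := by
              apply (Equiv.swap (f z) (f y)).injective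
              rw [← h, Equiv.swap_apply_left]
            exact h7 b hb (by omega) (by omega)
          · intro b hb
            simp only [hb, hn4, hn5, hv b hb, if_false, if_true]
            intro h hk
            have e : f b = f y := by
              apply (Equiv.swap (f z) (f y)).injective
              rw [← h, Equiv.swap_apply_right]
            have := h4 b hb (by omega) (by omega)
            omega
          · refine h8.imp_of_mem ?_
            intro a b ha hb hab
            simp only [ha, hb, hv a ha, hv b hb, if_false, if_true]
            intro h hk
            have e : f a = f b := (Equiv.swap (f z) (f y)).injective h
            refine hab e ?_
            rw [Equiv.swap_apply_def] at hk
            split_ifs at hk <;> omega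
          · intro a ha
            obtain ⟨g1, g2, g3, g4⟩ := h9 a ha
            have := hu a ha
            refine ⟨?_, ?_, ?_, ?_⟩
            · simpa only [this, hn2, hn3, if_false] using g1
            · simp only [this, if_false, if_true]
              intro h hk
              have := g1 h hk
              omega
            · simpa only [this, hn4, hn5, if_false] using g2
            · intro b hb
              simp only [this, hb, hv b hb, if_false, if_true]
              intro h hk
              rw [Equiv.swap_apply_def] at h
              split_ifs at h with c1 c2
              · have := g1 h hk
                have := h7 b hb (by omega) (by omega)
                omega
              · have := g2 h hk
                have := h4 b hb (by omega) (by omega)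
                omega
              · exact g4 b hb h hk
        · have ev : v.countP (fun a => decide ((if a = x then f y else
              if a ∈ v then Equiv.swap (f z) (f y) (f a) else f a) < k)) =
              v.countP (fun a => decide (f a < k)) := by
            apply List.countP_congr
            intro a ha
            have : a ≠ x := fun e => hn6 (e ▸ ha)
            simp only [this, ha, if_false, if_true, decide_eq_true_eq]
            rw [Equiv.swap_apply_def]
            split_ifs <;> omega
          have eu : u.countP (fun a => decide ((if a = x then f y else
              if a ∈ v then Equiv.swap (f z) (f y) (f a) else f a) < k)) =
              u.countP (fun a => decide (f a < k)) := by
            apply List.countP_congr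
            intro a ha
            simp only [hu a ha, if_false]
          rw [List.countP_append, List.countP_cons, List.countP_cons, List.countP_cons, ev, eu]
          simp only [hn2, hn3, hn4, hn5, hy, hz, if_true, if_false, decide_true] at hm ⊢
          split_ifs at hm <;> omega
      -- The letter `y` is unused, so it takes the place of `z` in the chain. The colour `k` means
      -- "in no chain"; one letter is gained and one lost.
      · refine ⟨fun a => if a = y then f z else if a = z then k else f a, ?_, ?_⟩
        · simp only [List.pairwise_append, List.pairwise_cons, List.mem_cons, forall_eq_or_imp]
          have hv : ∀ b ∈ v, b ≠ y ∧ b ≠ z :=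
            fun b hb => ⟨fun e => hn3 (e ▸ hb), fun e => hn5 (e ▸ hb)⟩
          have nxy : x ≠ y := by omega
          have nxz : x ≠ z := by omega
          have nzy : z ≠ y := by omega
          refine ⟨?_, ⟨⟨?_, ?_, ?_⟩, ⟨?_, ?_⟩, ?_, ?_⟩, ?_⟩
          · refine h1.imp_of_mem ?_
            intro a b ha hb
            simp only [hu a ha, hu b hb, if_false]
            exact id
          · intros; exact hxy
          · simp only [if_true, nzy, if_false]
            intro h; omega
          · intro b hb
            simp only [hv b hb, if_false, if_true]
            intro h hk
            have := h7 b hb (by omega) (by omega)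
            omega
          · simp only [nxy, nxz, nzy, if_false, if_true]
            intro h hk; omega
          · intro b hb
            simp only [nxy, nxz, hv b hb, if_false]
            exact h7 b hb
          · intro b hb
            simp only [nzy, if_true, if_false]
            intro h hk; omega
          · refine h8.imp_of_mem ?_
            intro a b ha hb
            simp only [hv a ha, hv b hb, if_false]
            exact id
          · intro a ha
            obtain ⟨g1, g2, g3, g4⟩ := h9 a ha
            have := hu a ha
            refine ⟨?_, ?_, ?_, ?_⟩
            · simp only [this, if_false, if_true]
              intro h hk
              have := g2 h hk
              omega
            · simpa only [this, nxy, nxz, if_false] using g3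
            · simp only [this, nzy, if_false, if_true]
              intro h hk; omega
            · intro b hb
              simpa only [this, hv b hb, if_false] using g4 b hb
        · have hv : ∀ b ∈ v, b ≠ y ∧ b ≠ z :=
            fun b hb => ⟨fun e => hn3 (e ▸ hb), fun e => hn5 (e ▸ hb)⟩
          have ev : v.countP (fun a => decide ((if a = y then f z else if a = z then k else f a)
              < k)) = v.countP (fun a => decide (f a < k)) := by
            apply List.countP_congr
            intro a ha
            simp only [hv a ha, if_false]
          have eu : u.countP (fun a => decide ((if a = y then f z else if a = z then k else f a)
              < k)) = u.countP (fun a => decide (f a < k)) := by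
            apply List.countP_congr
            intro a ha
            simp only [hu a ha, if_false]
          have nxy : x ≠ y := by omega
          have nxz : x ≠ z := by omega
          have nzy : z ≠ y := by omega
          rw [List.countP_append, List.countP_cons, List.countP_cons, List.countP_cons, ev, eu]
          have hx : f x < k := by omega
          simp only [nxy, nxz, nzy, hy, hz, hx, lt_irrefl, if_true, if_false, decide_true,
            decide_false, Bool.false_eq_true] at hm ⊢
          omega
    · refine ⟨f, ?_, ?_⟩
      · simp only [List.pairwise_append, List.pairwise_cons, List.mem_cons, forall_eq_or_imp] at hf ⊢
        obtain ⟨h1, ⟨⟨h2, h3, h4⟩, ⟨h5, h6⟩, h7, h8⟩, h9⟩ := hf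
        refine ⟨h1, ⟨⟨h3, h2, h4⟩, ⟨?_, h7⟩, h6, h8⟩, fun a ha => ?_⟩
        · intro h hk
          exact absurd ⟨h.symm, by omega⟩ hzx
        · obtain ⟨g1, g2, g3, g4⟩ := h9 a ha
          exact ⟨g1, g3, g2, g4⟩
      · refine hm.trans (le_of_eq (List.Perm.countP_eq _ ?_))
        exact List.Perm.append_left _ (List.Perm.cons _ (List.Perm.swap _ _ _))
  · rintro ⟨f, hf, hm⟩
    refine ⟨f, ?_, ?_⟩
    · simp only [List.pairwise_append, List.pairwise_cons, List.mem_cons, forall_eq_or_imp] at hf ⊢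
      obtain ⟨h1, ⟨⟨h2, h3, h4⟩, ⟨h5, h6⟩, h7, h8⟩, h9⟩ := hf
      refine ⟨h1, ⟨⟨h3, h2, h4⟩, ⟨fun _ _ => by omega, h7⟩, h6, h8⟩, fun a ha => ?_⟩
      obtain ⟨g1, g2, g3, g4⟩ := h9 a ha
      exact ⟨g1, g3, g2, g4⟩
    · refine hm.trans (le_of_eq (List.Perm.countP_eq _ ?_))
      exact List.Perm.append_left _ (List.Perm.cons _ (List.Perm.swap _ _ _))


/-- Reversing the word and reversing the order of the alphabet together preserve decreasing
subsequences. This symmetry exchanges the two kinds of Knuth moves and so reduces `HasDec.xzy` to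
`HasDec.yzx`. -/
theorem HasDec.map_sub_reverse {k m M : ℕ} {w : List ℕ} (hM : ∀ a ∈ w, a ≤ M)
    (h : HasDec k w m) : HasDec k (w.map (M - ·)).reverse m := by
  obtain ⟨f, hf, hm⟩ := h
  refine ⟨fun a => f (M - a), ?_, ?_⟩
  · rw [List.pairwise_reverse, List.pairwise_map]
    refine hf.imp_of_mem ?_
    intro a b ha hb hab h hk
    have ha' := hM a ha
    have hb' := hM b hb
    simp only [Nat.sub_sub_self ha', Nat.sub_sub_self hb'] at h hk
    have := hab h.symm (by omega)
    omega
  · rw [(List.reverse_perm _).countP_eq, List.countP_map]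
    refine hm.trans (le_of_eq (List.countP_congr ?_))
    intro a ha
    simp [Nat.sub_sub_self (hM a ha)]

theorem hasDec_map_sub_reverse {k m M : ℕ} {w : List ℕ} (hM : ∀ a ∈ w, a ≤ M) :
    HasDec k (w.map (M - ·)).reverse m ↔ HasDec k w m := by
  refine ⟨fun h => ?_, HasDec.map_sub_reverse hM⟩
  have h2 := HasDec.map_sub_reverse (M := M) (w := (w.map (M - ·)).reverse) (by simp) h
  have e : ((w.map (M - ·)).reverse.map (M - ·)).reverse = w := by
    rw [← List.map_reverse, List.reverse_reverse, List.map_map]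
    conv_rhs => rw [← List.map_id w]
    apply List.map_congr_left
    intro a ha
    simp [Nat.sub_sub_self (hM a ha)]
  rwa [e] at h2

theorem HasDec.xzy {k m : ℕ} {u v : List ℕ} {x y z : ℕ} (hxy : x < y) (hyz : y < z)
    (hn : (u ++ x :: z :: y :: v).Nodup) :
    HasDec k (u ++ x :: z :: y :: v) m ↔ HasDec k (u ++ z :: x :: y :: v) m := by
  obtain ⟨M, hM⟩ : ∃ M, ∀ a ∈ u ++ x :: z :: y :: v, a ≤ M :=
    ⟨(u ++ x :: z :: y :: v).sum, fun a ha => List.le_sum_of_mem ha⟩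
  have hM' : ∀ a ∈ u ++ z :: x :: y :: v, a ≤ M := fun a ha => hM a (by
    simp only [List.mem_append, List.mem_cons] at ha ⊢; tauto)
  rw [← hasDec_map_sub_reverse hM, ← hasDec_map_sub_reverse hM']
  have hx := hM x (by simp)
  have hy := hM y (by simp)
  have hz := hM z (by simp)
  have hn' : ((u ++ x :: z :: y :: v).map (M - ·)).reverse.Nodup := by
    rw [List.nodup_reverse]
    refine List.Nodup.map_on ?_ hn
    intro a ha b hb hab
    have := hM a ha
    have := hM b hb
    omega
  have key := HasDec.yzx (k := k) (m := m) (u := (v.map (M - ·)).reverse)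
    (v := (u.map (M - ·)).reverse) (x := M - z) (y := M - y) (z := M - x) (by omega) (by omega)
  simp only [List.map_append, List.map_cons, List.reverse_append, List.reverse_cons,
    List.append_assoc, List.cons_append, List.nil_append] at key hn' ⊢
  refine (key ?_).symm
  refine (List.Perm.nodup_iff ?_).1 hn'
  exact List.Perm.append_left _ (List.Perm.cons _ (List.Perm.swap _ _ _))

theorem Knuth.hasDec {k m : ℕ} {w w' : List ℕ} (h : Knuth w w') (hn : w.Nodup) :
    HasDec k w m ↔ HasDec k w' m := by
  induction h with
  | rel u v h =>
    cases h with
    | yzx u v x y z h1 h2 => exact HasDec.yzx h1 h2 hn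
    | xzy u v x y z h1 h2 => exact HasDec.xzy h1 h2 hn
  | refl u => exact Iff.rfl
  | symm u v h ih => exact (ih ((Knuth.perm h).nodup_iff.2 hn)).symm
  | trans u v w h _ ih1 ih2 => exact (ih1 hn).trans (ih2 ((Knuth.perm h).nodup_iff.1 hn))

theorem sublist_or_sublist {α : Type*} {w : List α} {a b : α} (ha : a ∈ w) (hb : b ∈ w)
    (hne : a ≠ b) : [a, b].Sublist w ∨ [b, a].Sublist w := by
  obtain ⟨s, t, rfl⟩ := List.append_of_mem ha
  simp only [List.mem_append, List.mem_cons] at hb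
  rcases hb with hs | hs | hs
  · right
    exact List.Sublist.append (List.singleton_sublist.2 hs) (List.singleton_sublist.2 (by simp))
  · exact absurd hs.symm hne
  · left
    refine List.Sublist.trans ?_ (List.sublist_append_right s (a :: t))
    exact List.Sublist.cons_cons a (List.singleton_sublist.2 hs)

/-- Greene's count for a tableau. A row increases along the word, so each decreasing chain meets it
at most once, and `k` chains use at most `k` of its entries. Since rows are left-justified, the
first `k` columns attain the bound in every row simultaneously. -/
theorem hasDec_iff {w : List ℕ} (hn : w.Nodup) (r c : ℕ → ℕ)
    (h1 : w.Pairwise fun a b => r a = r b → a < b) (h2 : w.Pairwise fun a b => c a = c b → b < a)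
    (h3 : ∀ a ∈ w, ∀ j < c a, ∃ b ∈ w, r b = r a ∧ c b = j) (k m : ℕ) :
    HasDec k w m ↔ m ≤ w.countP fun a => c a < k := by
  constructor
  swap
  · intro h
    exact ⟨c, h2.imp fun h e _ => h e, h⟩
  rintro ⟨f, hf, hm⟩
  refine hm.trans ?_
  have hcount : ∀ g : ℕ → ℕ, w.countP (fun a => g a < k) =
      ∑ i ∈ w.toFinset.image r, (w.toFinset.filter fun a => g a < k ∧ r a = i).card := by
    intro g
    rw [List.countP_eq_length_filter, ← List.toFinset_card_of_nodup (hn.filter _),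
      List.toFinset_filter]
    simp only [decide_eq_true_eq]
    rw [Finset.card_eq_sum_card_fiberwise (f := r) (t := w.toFinset.image r)]
    · simp only [Finset.filter_filter]
    · intro a ha
      simp only [Finset.coe_filter, Set.mem_ofPred_eq, Finset.mem_coe] at ha ⊢
      exact Finset.mem_image_of_mem _ ha.1
  rw [hcount f, hcount c]
  refine Finset.sum_le_sum fun i _ => ?_
  by_cases hall : ∀ a ∈ w, r a = i → c a < k
  · refine Finset.card_le_card ?_
    intro a ha
    simp only [Finset.mem_filter, List.mem_toFinset] at ha ⊢
    exact ⟨ha.1, hall a ha.1 ha.2.2, ha.2.2⟩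
  · push Not at hall
    obtain ⟨a, ha, hai, hak⟩ := hall
    have hle : (w.toFinset.filter fun a => f a < k ∧ r a = i).card ≤ (Finset.range k).card := by
      refine Finset.card_le_card_of_injOn f ?_ ?_
      · intro b hb
        simp only [Finset.coe_filter, Set.mem_ofPred_eq] at hb
        simpa using hb.2.1
      · intro b hb b' hb' e
        simp only [Finset.coe_filter, Set.mem_ofPred_eq, List.mem_toFinset] at hb hb'
        by_contra hne
        have hp : w.Pairwise fun a b => (f a = f b → f a < k → b < a) ∧ (r a = r b → a < b) :=
          List.pairwise_and_iff.2 ⟨hf, h1⟩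
        have hsym : ∀ b b', (b ∈ w ∧ f b < k ∧ r b = i) → (b' ∈ w ∧ f b' < k ∧ r b' = i) →
            f b = f b' → ¬ ((f b = f b' → f b < k → b' < b) ∧ (r b = r b' → b < b')) := by
          rintro b b' ⟨-, g1, g2⟩ ⟨-, g3, g4⟩ e ⟨g5, g6⟩
          have := g5 e g1
          have := g6 (g2.trans g4.symm)
          omega
        rcases sublist_or_sublist hb.1 hb'.1 hne with e' | e'
        · exact hsym b b' hb hb' e (by simpa using List.Pairwise.sublist e' hp)
        · exact hsym b' b hb' hb e.symm (by simpa using List.Pairwise.sublist e' hp)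
    refine hle.trans ?_
    refine (Finset.card_le_card (t := (w.toFinset.filter fun a => c a < k ∧ r a = i).image c)
      ?_).trans Finset.card_image_le
    intro j hj
    rw [Finset.mem_range] at hj
    simp only [Finset.mem_image, Finset.mem_filter, List.mem_toFinset]
    rcases eq_or_lt_of_le (show j ≤ c a by omega) with e | hlt
    · omega
    · obtain ⟨b, hb, e1, e2⟩ := h3 a ha j hlt
      exact ⟨b, ⟨hb, by omega, by omega⟩, e2⟩

/-! ### Positions in a standard tableau -/

/-- The index of the row of the entry `a` of a tableau. -/
def rowIdx : List (List ℕ) → ℕ → ℕ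
  | [], _ => 0
  | c :: t, a => if a ∈ c then c.idxOf a else rowIdx t a

/-- The index of the column of the entry `a` of a tableau. -/
def colIdx : List (List ℕ) → ℕ → ℕ
  | [], _ => 0
  | c :: t, a => if a ∈ c then 0 else colIdx t a + 1

theorem Std.nodup_colRead {t : List (List ℕ)} (h : Std t) : (colRead t).Nodup :=
  (colRead_perm t).nodup_iff.2 h.2.2

theorem mem_colRead {t : List (List ℕ)} {a : ℕ} : a ∈ colRead t ↔ a ∈ t.flatten :=
  (colRead_perm t).mem_iff

theorem nodup_of_lt {c : List ℕ} (h : c.Pairwise (· < ·)) : c.Nodup :=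
  h.imp fun h => h.ne

theorem position_iff {t : List (List ℕ)} (h : Std t) {a i j : ℕ} :
    (a ∈ t.flatten ∧ rowIdx t a = i ∧ colIdx t a = j) ↔
      ∃ e, t[j]? = some e ∧ e[i]? = some a := by
  induction t generalizing j with
  | nil => simp
  | cons c t ih =>
    obtain ⟨h1, h2, h3, h4, h5⟩ := std_cons.1 h
    have hn := nodup_of_lt h2
    by_cases hac : a ∈ c
    · have hat : a ∉ t.flatten := fun h' => (List.nodup_append.1 h4).2.2 a hac a h' rfl
      simp only [List.flatten_cons, List.mem_append, hac, true_or, rowIdx, colIdx, if_true,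
        true_and]
      constructor
      · rintro ⟨rfl, rfl⟩
        exact ⟨c, by simp, by simp [List.getElem?_idxOf hac]⟩
      · rintro ⟨d, hd, hda⟩
        cases j with
        | zero =>
          simp only [List.getElem?_cons_zero, Option.some.injEq] at hd
          subst hd
          obtain ⟨hi, rfl⟩ := List.getElem?_eq_some_iff.1 hda
          exact ⟨hn.idxOf_getElem i hi, rfl⟩
        | succ j =>
          exfalso
          apply hat
          rw [List.getElem?_cons_succ] at hd
          exact List.mem_flatten.2 ⟨d, List.mem_of_getElem? hd, List.mem_of_getElem? hda⟩
    · simp only [List.flatten_cons, List.mem_append, hac, false_or, rowIdx, colIdx, if_false]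
      cases j with
      | zero =>
        simp only [List.getElem?_cons_zero, Option.some.injEq, exists_eq_left']
        constructor
        · rintro ⟨-, -, h⟩; omega
        · intro h'; exact absurd (List.mem_of_getElem? h') hac
      | succ j =>
        rw [List.getElem?_cons_succ, ← ih h5]
        simp

/-- The counting form of domination yields the entrywise one: at the threshold `b` the list `d` has
at least `i + 1` entries, hence so has `e`, and its entry of index `i` is among them. -/
theorem Dom.getElem? {e d : List ℕ} (h : Dom e d) (hc : e.Pairwise (· < ·))
    (hd : d.Pairwise (· < ·)) {i b : ℕ} (hb : d[i]? = some b) :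
    ∃ a, e[i]? = some a ∧ a ≤ b := by
  obtain ⟨hi, hdb⟩ := List.getElem?_eq_some_iff.1 hb
  have h1 : i + 1 ≤ d.countP (· ≤ b) := by
    conv_rhs => rw [← List.take_append_drop (i + 1) d, List.countP_append]
    have : (d.take (i + 1)).countP (· ≤ b) = (d.take (i + 1)).length := by
      rw [List.countP_eq_length]
      intro a ha
      obtain ⟨j, hj, rfl⟩ := List.mem_take_iff_getElem.1 ha
      simp only [decide_eq_true_eq, ← hdb]
      rcases Nat.lt_or_ge j i with hji | hji
      · exact (List.pairwise_iff_getElem.1 hd _ _ _ _ hji).le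
      · have : j = i := by omega
        subst this; exact le_rfl
    rw [this, List.length_take]
    omega
  have h2 := h1.trans (h b)
  by_contra hne
  push Not at hne
  have h3 : e.countP (· ≤ b) ≤ i := by
    rw [← List.take_append_drop i e, List.countP_append]
    have : (e.drop i).countP (· ≤ b) = 0 := by
      rw [List.countP_eq_zero]
      intro a ha
      obtain ⟨j, hj, rfl⟩ := List.mem_drop_iff_getElem.1 ha
      simp only [decide_eq_true_eq, not_le]
      have hic : i < e.length := by omega
      have h4 := hne e[i] (List.getElem?_eq_getElem hic)
      rcases Nat.eq_zero_or_pos j with rfl | hj0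
      · simpa using h4
      · exact h4.trans (List.pairwise_iff_getElem.1 hc i (i + j) hic (by omega) (by omega))
    have h5 : (e.take i).countP (· ≤ b) ≤ i :=
      List.countP_le_length.trans (by simp)
    omega
  omega

theorem Std.entry_le {t : List (List ℕ)} (h : Std t) {i j j' b : ℕ} {d : List ℕ} (hj : j < j')
    (hd : t[j']? = some d) (hb : d[i]? = some b) :
    ∃ e a, t[j]? = some e ∧ e[i]? = some a ∧ a < b := by
  obtain ⟨hj', rfl⟩ := List.getElem?_eq_some_iff.1 hd
  have hdom := List.pairwise_iff_getElem.1 h.2.1 j j' (by omega) hj' hj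
  have hjt : j < t.length := by omega
  obtain ⟨a, ha, hab⟩ := hdom.getElem? (h.1 _ (List.getElem_mem _)).2
    (h.1 _ (List.getElem_mem _)).2 hb
  refine ⟨t[j], a, List.getElem?_eq_getElem hjt, ha, lt_of_le_of_ne hab ?_⟩
  rintro rfl
  have e1 := (position_iff h (a := a) (i := i) (j := j)).2 ⟨_, List.getElem?_eq_getElem hjt, ha⟩
  have e2 := (position_iff h (a := a) (i := i) (j := j')).2 ⟨_, hd, hb⟩
  omega

theorem Std.exists_left {t : List (List ℕ)} (h : Std t) {a j : ℕ} (ha : a ∈ t.flatten)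
    (hj : j < colIdx t a) :
    ∃ b ∈ t.flatten, rowIdx t b = rowIdx t a ∧ colIdx t b = j ∧ b < a := by
  obtain ⟨d, hd, hda⟩ := (position_iff h).1 ⟨ha, rfl, rfl⟩
  obtain ⟨c, b, hc, hb, hba⟩ := h.entry_le hj hd hda
  have := (position_iff h).2 ⟨c, hc, hb⟩
  exact ⟨b, this.1, this.2.1, this.2.2, hba⟩

theorem Std.exists_above {t : List (List ℕ)} (h : Std t) {a i : ℕ} (ha : a ∈ t.flatten)
    (hi : i < rowIdx t a) :
    ∃ b ∈ t.flatten, rowIdx t b = i ∧ colIdx t b = colIdx t a ∧ b < a := by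
  obtain ⟨d, hd, hda⟩ := (position_iff h).1 ⟨ha, rfl, rfl⟩
  obtain ⟨hi', e⟩ := List.getElem?_eq_some_iff.1 hda
  have hd' := (h.1 d (List.mem_of_getElem? hd)).2
  have := (position_iff h).2 ⟨d, hd, List.getElem?_eq_getElem (hi.trans hi')⟩
  refine ⟨_, this.1, this.2.1, this.2.2, ?_⟩
  have := List.pairwise_iff_getElem.1 hd' _ _ (hi.trans hi') hi' hi
  omega

theorem colRead_pairwise {t : List (List ℕ)} (h : Std t) :
    (colRead t).Pairwise fun a b =>
      colIdx t a < colIdx t b ∨ colIdx t a = colIdx t b ∧ b < a ∧ rowIdx t b < rowIdx t a := by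
  induction t with
  | nil => simp [colRead]
  | cons c t ih =>
    obtain ⟨h1, h2, h3, h4, h5⟩ := std_cons.1 h
    rw [colRead_cons, List.pairwise_append]
    have hnc : ∀ b ∈ colRead t, b ∉ c := fun b hb hbc =>
      (List.nodup_append.1 h4).2.2 b hbc b (mem_colRead.1 hb) rfl
    refine ⟨?_, ?_, ?_⟩
    · rw [List.pairwise_reverse]
      rw [List.pairwise_iff_getElem]
      intro i j hi hj hij
      right
      have hn := nodup_of_lt h2
      simp only [colIdx, rowIdx, List.getElem_mem, if_true, true_and,
        hn.idxOf_getElem i hi, hn.idxOf_getElem j hj]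
      exact ⟨List.pairwise_iff_getElem.1 h2 i j hi hj hij, hij⟩
    · refine (ih h5).imp_of_mem ?_
      intro a b ha hb hab
      simp only [colIdx, rowIdx, hnc a ha, hnc b hb, if_false]
      omega
    · intro a ha b hb
      left
      rw [List.mem_reverse] at ha
      simp only [colIdx, ha, hnc b hb, if_true, if_false]
      omega

theorem colRead_pairwise_row {t : List (List ℕ)} (h : Std t) :
    (colRead t).Pairwise fun a b => rowIdx t a = rowIdx t b → a < b := by
  refine (colRead_pairwise h).imp_of_mem ?_
  intro a b ha hb hab e
  rcases hab with h1 | h1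
  · obtain ⟨c, hc, e1, e2, h3⟩ := h.exists_left (mem_colRead.1 hb) h1
    have e3 := (position_iff h).1 ⟨hc, rfl, rfl⟩
    have e4 := (position_iff h).1 ⟨mem_colRead.1 ha, rfl, rfl⟩
    rw [e1, e2] at e3
    rw [e] at e4
    obtain ⟨d, hd, hdc⟩ := e3
    obtain ⟨d', hd', hda⟩ := e4
    rw [hd] at hd'
    obtain rfl := Option.some.inj hd'
    rw [hdc] at hda
    obtain rfl := Option.some.inj hda
    exact h3
  · omega

/-- The entries `< b` still occupy left-justified rows, because rows increase; so `hasDec_iff`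
applies to the restricted word with the indices of the whole tableau. -/
theorem hasDec_colRead_filter {t : List (List ℕ)} (h : Std t) (b k m : ℕ) :
    HasDec k ((colRead t).filter (· < b)) m ↔
      m ≤ ((colRead t).filter (· < b)).countP fun a => colIdx t a < k := by
  refine hasDec_iff (h.nodup_colRead.filter _) (rowIdx t) _ ((colRead_pairwise_row h).filter _)
    (List.Pairwise.filter _ ((colRead_pairwise h).imp fun h e => by omega)) ?_ k m
  intro a ha j hj
  simp only [List.mem_filter, mem_colRead, decide_eq_true_eq] at ha ⊢
  obtain ⟨c, h1, h2, h3, h4⟩ := h.exists_left ha.1 hj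
  exact ⟨c, ⟨h1, by omega⟩, h2, h3⟩

/-- Reversal makes rows decrease and columns increase along the word, so rows and columns exchange
their roles in `hasDec_iff`. -/
theorem hasDec_colRead_filter_reverse {t : List (List ℕ)} (h : Std t) (b k m : ℕ) :
    HasDec k ((colRead t).filter (· < b)).reverse m ↔
      m ≤ ((colRead t).filter (· < b)).countP fun a => rowIdx t a < k := by
  rw [← (List.reverse_perm ((colRead t).filter (· < b))).countP_eq]
  refine hasDec_iff (List.nodup_reverse.2 (h.nodup_colRead.filter _)) (colIdx t) _ ?_ ?_ ?_ k m
  · rw [List.pairwise_reverse]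
    exact List.Pairwise.filter _ ((colRead_pairwise h).imp fun h e => by omega)
  · rw [List.pairwise_reverse]
    exact List.Pairwise.filter _ ((colRead_pairwise_row h).imp fun h e => h e.symm)
  · intro a ha j hj
    simp only [List.mem_reverse, List.mem_filter, mem_colRead, decide_eq_true_eq] at ha ⊢
    obtain ⟨c, h1, h2, h3, h4⟩ := h.exists_above ha.1 hj
    exact ⟨c, ⟨h1, by omega⟩, h3, h2⟩

/-- The letters `< a + 1` are `a` and the letters `< a`. Comparing the two counts isolates the
contribution of `a`, for every `k`. -/
theorem eq_of_countP_filter {w : List ℕ} (hn : w.Nodup) {a : ℕ} (ha : a ∈ w) (f g : ℕ → ℕ)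
    (h : ∀ b ≤ a + 1, ∀ k, (w.filter (· < b)).countP (fun x => f x < k) =
      (w.filter (· < b)).countP fun x => g x < k) : f a = g a := by
  have hp : (w.filter (· < a + 1)).Perm (a :: w.filter (· < a)) := by
    rw [List.perm_ext_iff_of_nodup (hn.filter _)
      (List.nodup_cons.2 ⟨by simp, hn.filter _⟩)]
    intro x
    simp only [List.mem_filter, List.mem_cons, decide_eq_true_eq]
    constructor
    · rintro ⟨h1, h2⟩
      rcases eq_or_lt_of_le (Nat.lt_succ_iff.1 h2) with h3 | h3
      · exact Or.inl h3
      · exact Or.inr ⟨h1, h3⟩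
    · rintro (rfl | ⟨h1, h2⟩)
      · exact ⟨ha, by omega⟩
      · exact ⟨h1, by omega⟩
  have key : ∀ k, (f a < k ↔ g a < k) := by
    intro k
    have h1 := h (a + 1) le_rfl k
    have h2 := h a (by omega) k
    rw [hp.countP_eq, hp.countP_eq, List.countP_cons, List.countP_cons, h2] at h1
    simp only [decide_eq_true_eq] at h1
    split_ifs at h1 <;> omega
  have h1 := (key (f a + 1)).1 (by omega)
  have h2 := (key (g a + 1)).2 (by omega)
  omega

theorem filter_lt_filter_lt (w : List ℕ) {b B : ℕ} (h : b ≤ B) :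
    (w.filter (· < B)).filter (· < b) = w.filter (· < b) := by
  rw [List.filter_filter]
  apply List.filter_congr
  intro x _
  rw [Bool.eq_iff_iff]
  simp only [Bool.and_eq_true, decide_eq_true_eq]
  omega

theorem Knuth.filter_lt {u v : List ℕ} (h : Knuth u v) (b : ℕ) :
    Knuth (u.filter (· < b)) (v.filter (· < b)) := by
  refine h.filter ?_
  intro x y z _ _ _ h4
  simp only [decide_eq_true_eq] at h4 ⊢
  omega

/-- By Greene's theorem the Knuth class knows how many entries `< b` lie in the first `k` columns,
for each `b ≤ B`. These numbers determine the column of each entry below `B`. -/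
theorem colIdx_eq_colIdx {t u : List (List ℕ)} (ht : Std t) (hu : Std u) {B : ℕ}
    (hK : Knuth ((colRead t).filter (· < B)) ((colRead u).filter (· < B))) {a : ℕ}
    (ha : a ∈ t.flatten) (haB : a < B) : colIdx t a = colIdx u a := by
  refine eq_of_countP_filter ht.nodup_colRead (mem_colRead.2 ha) _ _ ?_
  intro b hb k
  have hKb := hK.filter_lt b
  rw [filter_lt_filter_lt _ (show b ≤ B by omega), filter_lt_filter_lt _ (show b ≤ B by omega)]
    at hKb
  rw [hKb.perm.countP_eq fun x => decide (colIdx u x < k)]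
  refine eq_of_forall_le_iff fun m => ?_
  rw [← hasDec_colRead_filter ht, ← hasDec_colRead_filter hu]
  exact hKb.hasDec (ht.nodup_colRead.filter _)

theorem rowIdx_eq_colIdx {t u : List (List ℕ)} (ht : Std t) (hu : Std u) {B : ℕ}
    (hK : Knuth ((colRead t).filter (· < B)).reverse ((colRead u).filter (· < B))) {a : ℕ}
    (ha : a ∈ t.flatten) (haB : a < B) : rowIdx t a = colIdx u a := by
  refine eq_of_countP_filter ht.nodup_colRead (mem_colRead.2 ha) _ _ ?_
  intro b hb k
  have hKb := hK.filter_lt b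
  rw [List.filter_reverse, filter_lt_filter_lt _ (show b ≤ B by omega),
    filter_lt_filter_lt _ (show b ≤ B by omega)] at hKb
  rw [((List.reverse_perm _).symm.trans hKb.perm).countP_eq fun x => decide (colIdx u x < k)]
  refine eq_of_forall_le_iff fun m => ?_
  rw [← hasDec_colRead_filter_reverse ht, ← hasDec_colRead_filter hu]
  exact hKb.hasDec (List.nodup_reverse.2 (ht.nodup_colRead.filter _))

/-! ### Transposition: bumping the reversed word -/

/-- The rows of the tableau `bumpAll w []`, obtained by row bumping. -/
def rowBump (w : List ℕ) : List (List ℕ) := bumpAll w.reverse []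

theorem std_rowBump {w : List ℕ} (h : w.Nodup) : Std (rowBump w) :=
  std_bumpAll (List.nodup_reverse.2 h)

theorem mem_rowBump {w : List ℕ} {a : ℕ} : a ∈ (rowBump w).flatten ↔ a ∈ w := by
  rw [rowBump, (bumpAll_perm _ _).mem_iff]
  simp

theorem mem_bumpAll {w : List ℕ} {a : ℕ} : a ∈ (bumpAll w []).flatten ↔ a ∈ w := by
  rw [(bumpAll_perm _ _).mem_iff]
  simp

theorem rowBump_concat (w : List ℕ) (x : ℕ) :
    rowBump (w ++ [x]) = columnInsert x (rowBump w) := by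
  simp [rowBump, bumpAll]

theorem knuth_rowBump {w : List ℕ} (h : w.Nodup) : Knuth w.reverse (colRead (rowBump w)) :=
  knuth_colRead_bumpAll (List.nodup_reverse.2 h)

/-- Row and column bumping lead to the same tableau. -/
theorem rowIdx_bumpAll {w : List ℕ} (h : w.Nodup) {a : ℕ} (ha : a ∈ w) :
    rowIdx (bumpAll w []) a = colIdx (rowBump w) a := by
  -- Knuth equivalence is compatible with reversal, so the reversed reading word of one tableau and
  -- the reading word of the other are both equivalent to `w.reverse`.
  refine rowIdx_eq_colIdx (std_bumpAll h) (std_rowBump h) (B := a + 1) ?_ (mem_bumpAll.2 ha)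
    (by omega)
  rw [← List.filter_reverse]
  refine Knuth.filter_lt ?_ _
  exact (knuth_colRead_bumpAll h).symm.reverse.trans (knuth_rowBump h)

/-- The positions of the entries below `B` depend only on the subword of letters below `B`. For
arrays this allows the largest label to be ignored. -/
theorem colIdx_rowBump_eq {w v : List ℕ} (hw : w.Nodup) (hv : v.Nodup) {B : ℕ}
    (h : w.filter (· < B) = v.filter (· < B)) {a : ℕ} (ha : a ∈ w) (haB : a < B) :
    colIdx (rowBump w) a = colIdx (rowBump v) a := by
  refine colIdx_eq_colIdx (std_rowBump hw) (std_rowBump hv) (B := B) ?_ (mem_rowBump.2 ha) haB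
  have h1 := (knuth_rowBump hw).filter_lt B
  have h2 := (knuth_rowBump hv).filter_lt B
  rw [List.filter_reverse] at h1 h2
  rw [h] at h1
  exact h1.symm.trans h2

/-! ### Rows of a standard tableau -/

theorem Std.ne_nil {t : List (List ℕ)} (h : Std t) {c : List ℕ} (hc : c ∈ t) : c ≠ [] :=
  (h.1 c hc).1

theorem mem_getD_iff {t : List (List ℕ)} (h : t.flatten.Nodup) {a s : ℕ} :
    a ∈ t.getD s [] ↔ a ∈ t.flatten ∧ colIdx t a = s := by
  induction t generalizing s with
  | nil => simp
  | cons d t ih =>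
    rw [List.flatten_cons] at h
    have h4 := List.nodup_append.1 h
    have ih := fun s => ih (s := s) h4.2.1
    by_cases had : a ∈ d
    · have hat : a ∉ t.flatten := fun h' => h4.2.2 a had a h' rfl
      cases s with
      | zero => simp [colIdx, had]
      | succ s =>
        simp only [List.getD_cons_succ, List.flatten_cons, List.mem_append, colIdx, had, if_true]
        rw [ih]
        simp [hat]
    · cases s with
      | zero => simp [colIdx, had]
      | succ s =>
        simp only [List.getD_cons_succ, List.flatten_cons, List.mem_append, colIdx, had, if_false]
        rw [ih]
        simp

/-- The length of the list with index `s` in a list of lists. -/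
def len (t : List (List ℕ)) (s : ℕ) : ℕ := (t.getD s []).length

theorem len_eq_countP {t : List (List ℕ)} (h : t.flatten.Nodup) (s : ℕ) :
    len t s = t.flatten.countP fun a => colIdx t a = s := by
  rw [len, List.countP_eq_length_filter]
  refine List.Perm.length_eq ((List.perm_ext_iff_of_nodup ?_ (h.filter _)).2 ?_)
  · by_cases hs : s < t.length
    · rw [List.getD_eq_getElem _ _ hs]
      exact h.sublist (List.sublist_flatten_of_mem (List.getElem_mem hs))
    · rw [List.getD_eq_default _ _ (by omega)]
      exact List.nodup_nil
  · intro a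
    rw [mem_getD_iff h]
    simp only [List.mem_filter, decide_eq_true_eq]

theorem Std.pairwise_getD {t : List (List ℕ)} (h : Std t) (s : ℕ) :
    (t.getD s []).Pairwise (· < ·) := by
  by_cases hs : s < t.length
  · rw [List.getD_eq_getElem _ _ hs]
    exact (h.1 _ (List.getElem_mem hs)).2
  · rw [List.getD_eq_default _ _ (by omega)]
    exact List.Pairwise.nil

theorem eq_of_pairwise_lt {u v : List ℕ} (hu : u.Pairwise (· < ·)) (hv : v.Pairwise (· < ·))
    (h : ∀ a, a ∈ u ↔ a ∈ v) : u = v := by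
  refine List.Perm.eq_of_pairwise (le := (· < ·)) ?_ hu hv
    ((List.perm_ext_iff_of_nodup (nodup_of_lt hu) (nodup_of_lt hv)).2 h)
  intro a b _ _ h1 h2
  omega

theorem eq_of_getD {t u : List (List ℕ)} (ht : ∀ c ∈ t, c ≠ []) (hu : ∀ c ∈ u, c ≠ [])
    (h : ∀ s, t.getD s [] = u.getD s []) : t = u := by
  have key : ∀ v : List (List ℕ), (∀ c ∈ v, c ≠ []) → ∀ s, s < v.length ↔ v.getD s [] ≠ [] := by
    intro v hv s
    by_cases hs : s < v.length
    · rw [List.getD_eq_getElem _ _ hs]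
      exact ⟨fun _ => hv _ (List.getElem_mem hs), fun _ => hs⟩
    · rw [List.getD_eq_default _ _ (by omega)]
      simp [hs]
  apply List.ext_getElem?
  intro s
  have h1 := key t ht s
  have h2 := key u hu s
  by_cases hs : s < t.length
  · have hs' : s < u.length := h2.2 (h s ▸ h1.1 hs)
    have := h s
    rw [List.getD_eq_getElem _ _ hs, List.getD_eq_getElem _ _ hs'] at this
    rw [List.getElem?_eq_getElem hs, List.getElem?_eq_getElem hs', this]
  · have hs' : ¬ s < u.length := fun h' => hs (h1.2 ((h s).symm ▸ h2.1 h'))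
    rw [List.getElem?_eq_none (by omega), List.getElem?_eq_none (by omega)]

theorem Std.ext {t u : List (List ℕ)} (ht : Std t) (hu : Std u)
    (h : ∀ a, a ∈ t.flatten ↔ a ∈ u.flatten)
    (h' : ∀ a ∈ t.flatten, colIdx t a = colIdx u a) : t = u := by
  refine eq_of_getD (fun c hc => ht.ne_nil hc) (fun c hc => hu.ne_nil hc) fun s =>
    eq_of_pairwise_lt (ht.pairwise_getD s) (hu.pairwise_getD s) fun a => ?_
  rw [mem_getD_iff ht.2.2, mem_getD_iff hu.2.2, ← h a]
  refine and_congr_right fun ha => ?_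
  rw [h' a ha]

theorem mem_row_iff {t : List (List ℕ)} (h : Std t) {a i : ℕ} :
    a ∈ row t i ↔ a ∈ t.flatten ∧ rowIdx t a = i := by
  rw [row, List.mem_filterMap]
  constructor
  · rintro ⟨d, hd, hda⟩
    obtain ⟨j, hj⟩ := List.getElem?_of_mem hd
    have := (position_iff h).2 ⟨d, hj, hda⟩
    exact ⟨this.1, this.2.1⟩
  · rintro ⟨h1, h2⟩
    obtain ⟨d, hd, hda⟩ := (position_iff h).1 ⟨h1, h2, rfl⟩
    exact ⟨d, List.mem_of_getElem? hd, hda⟩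

theorem Std.pairwise_row {t : List (List ℕ)} (h : Std t) (i : ℕ) :
    (row t i).Pairwise (· < ·) := by
  rw [row, List.pairwise_filterMap, List.pairwise_iff_getElem]
  intro j j' hj hj' hjj a ha b hb
  obtain ⟨e, a', h1, h2, h3⟩ := h.entry_le hjj (List.getElem?_eq_getElem hj') hb
  rw [List.getElem?_eq_getElem hj] at h1
  obtain rfl := Option.some.inj h1
  rw [ha] at h2
  obtain rfl := Option.some.inj h2
  exact h3

theorem Dom.length_le {c d : List ℕ} (h : Dom c d) : d.length ≤ c.length := by
  have h1 := h (d.sum)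
  have : d.countP (· ≤ d.sum) = d.length := by
    rw [List.countP_eq_length]
    intro a ha
    simpa using List.le_sum_of_mem ha
  rw [this] at h1
  exact h1.trans List.countP_le_length

theorem Std.isStandard {t : List (List ℕ)} (h : Std t) : IsStandard t :=
  ⟨fun _ hc => h.ne_nil hc, h.2.1.imp Dom.length_le, fun c hc => (h.1 c hc).2, h.pairwise_row⟩

theorem Std.len_le {t : List (List ℕ)} (h : Std t) {s s' : ℕ} (hs : s ≤ s') :
    len t s' ≤ len t s := by
  by_cases h1 : s' < t.length
  · rcases eq_or_lt_of_le hs with rfl | h2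
    · exact le_rfl
    · rw [len, len, List.getD_eq_getElem _ _ h1, List.getD_eq_getElem _ _ (h2.trans h1)]
      exact (List.pairwise_iff_getElem.1 h.2.1 s s' (h2.trans h1) h1 h2).length_le
  · rw [len, List.getD_eq_default _ _ (by omega)]
    exact Nat.zero_le _

theorem row_bumpAll {w : List ℕ} (h : w.Nodup) (i : ℕ) :
    row (bumpAll w []) i = (rowBump w).getD i [] := by
  refine eq_of_pairwise_lt ((std_bumpAll h).pairwise_row i) ((std_rowBump h).pairwise_getD i)
    fun a => ?_
  rw [mem_row_iff (std_bumpAll h), mem_getD_iff (std_rowBump h).2.2, mem_bumpAll, mem_rowBump]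
  exact and_congr_right fun ha => by rw [rowIdx_bumpAll h ha]

theorem length_row (t : List (List ℕ)) (i : ℕ) :
    (row t i).length = t.countP fun c => i < c.length := by
  rw [row, List.length_filterMap_eq_countP]
  apply List.countP_congr
  intro c _
  simp

/-! ### The shape of the tableau of a two-line array -/

/-- The entries of a two-line array. -/
def labels (L : List (ℕ × ℕ)) : List ℕ := L.map Prod.fst ++ L.map Prod.snd

/-- A two-line array with distinct entries, whose first line is increasing and such that in each
column the upper entry is larger than the lower one. -/
def IsBurge (L : List (ℕ × ℕ)) : Prop :=
  (L.map Prod.fst).Pairwise (· < ·) ∧ (labels L).Nodup ∧ ∀ e ∈ L, e.2 < e.1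

/-- The list of the rows of the tableau of a two-line array. -/
def burgeRows (L : List (ℕ × ℕ)) : List (List ℕ) := rowBump (bumpingSequence L)

/-- The upper line of the array, in the order of the lower entries. -/
def sortedTop (L : List (ℕ × ℕ)) : List ℕ :=
  (L.insertionSort fun p q => p.2 ≤ q.2).map Prod.fst

theorem bumpingSequence_eq (L : List (ℕ × ℕ)) :
    bumpingSequence L = sortedTop L ++ L.map Prod.snd := rfl

theorem bumpingSequence_perm (L : List (ℕ × ℕ)) : (bumpingSequence L).Perm (labels L) :=
  List.Perm.append_right _ ((List.perm_insertionSort _ L).map _)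

theorem IsBurge.nodup {L : List (ℕ × ℕ)} (h : IsBurge L) : (bumpingSequence L).Nodup :=
  (bumpingSequence_perm L).nodup_iff.2 h.2.1

theorem IsBurge.std {L : List (ℕ × ℕ)} (h : IsBurge L) : Std (burgeRows L) := std_rowBump h.nodup

theorem mem_burgeRows {L : List (ℕ × ℕ)} {a : ℕ} : a ∈ (burgeRows L).flatten ↔ a ∈ labels L := by
  rw [burgeRows, mem_rowBump, (bumpingSequence_perm L).mem_iff]

theorem mem_labels {L : List (ℕ × ℕ)} {a : ℕ} :
    a ∈ labels L ↔ ∃ e ∈ L, e.1 = a ∨ e.2 = a := by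
  simp only [labels, List.mem_append, List.mem_map]
  constructor
  · rintro (⟨e, h1, h2⟩ | ⟨e, h1, h2⟩)
    · exact ⟨e, h1, Or.inl h2⟩
    · exact ⟨e, h1, Or.inr h2⟩
  · rintro ⟨e, h1, h2 | h2⟩
    · exact Or.inl ⟨e, h1, h2⟩
    · exact Or.inr ⟨e, h1, h2⟩

theorem IsBurge.eq_of_label {L : List (ℕ × ℕ)} (h : IsBurge L) {e e' : ℕ × ℕ} (he : e ∈ L)
    (he' : e' ∈ L) {a : ℕ} (h1 : e.1 = a ∨ e.2 = a) (h2 : e'.1 = a ∨ e'.2 = a) : e = e' := by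
  have hn := List.nodup_append.1 h.2.1
  have hcross : ∀ e ∈ L, ∀ e' ∈ L, e.1 ≠ e'.2 := fun e he e' he' =>
    hn.2.2 _ (List.mem_map_of_mem he) _ (List.mem_map_of_mem he')
  rcases h1 with rfl | rfl <;> rcases h2 with h2 | h2
  · exact List.inj_on_of_nodup_map hn.1 he he' h2.symm
  · exact absurd h2.symm (hcross e he e' he')
  · exact absurd h2 (hcross e' he' e he)
  · exact List.inj_on_of_nodup_map hn.2.1 he he' h2.symm

/-- As all labels are distinct, a colouring of the columns of the array descends to its individual
entries, upper and lower ones alike. -/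
theorem IsBurge.exists_colour {L : List (ℕ × ℕ)} (h : IsBurge L) (F : ℕ × ℕ → ℕ) :
    ∃ f : ℕ → ℕ, ∀ e ∈ L, f e.1 = F e ∧ f e.2 = F e := by
  have key : ∀ a, ∃ m, ∀ e ∈ L, e.1 = a ∨ e.2 = a → m = F e := by
    intro a
    by_cases ha : ∃ e ∈ L, e.1 = a ∨ e.2 = a
    · obtain ⟨e, he, h1⟩ := ha
      exact ⟨F e, fun e' he' h2 => by rw [h.eq_of_label he he' h1 h2]⟩
    · exact ⟨0, fun e he h1 => absurd ⟨e, he, h1⟩ ha⟩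
  choose f hf using key
  exact ⟨f, fun e he => ⟨hf _ e he (Or.inl rfl), hf _ e he (Or.inr rfl)⟩⟩

/-- A colouring of the columns of a two-line array, such that the columns of each of the colours
`< k` form a decreasing sequence. -/
def IsColouring (k : ℕ) (L : List (ℕ × ℕ)) (F : ℕ × ℕ → ℕ) : Prop :=
  ∀ e ∈ L, ∀ e' ∈ L, e.1 < e'.1 → F e = F e' → F e < k → e'.2 < e.2

theorem IsBurge.pairwise {L : List (ℕ × ℕ)} (h : IsBurge L) :
    L.Pairwise fun e e' => e.1 < e'.1 := List.pairwise_map.1 h.1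

theorem IsBurge.pairwise_sort {L : List (ℕ × ℕ)} (h : IsBurge L) :
    (L.insertionSort fun p q => p.2 ≤ q.2).Pairwise fun e e' => e.2 < e'.2 := by
  have h1 : (L.insertionSort fun p q => p.2 ≤ q.2).Pairwise fun e e' => e.2 ≤ e'.2 := by
    have : Std.Total (fun p q : ℕ × ℕ => p.2 ≤ q.2) := ⟨fun a b => le_total _ _⟩
    have : IsTrans (ℕ × ℕ) (fun p q : ℕ × ℕ => p.2 ≤ q.2) := ⟨fun a b c => le_trans⟩
    exact List.pairwise_insertionSort _ L
  have h2 : ((L.insertionSort fun p q => p.2 ≤ q.2).map Prod.snd).Nodup :=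
    ((List.perm_insertionSort _ L).map _).nodup_iff.2 (List.nodup_append.1 h.2.1).2.1
  have h3 := List.pairwise_map.1 h2
  exact (List.pairwise_and_iff.2 ⟨h1, h3⟩).imp fun h => lt_of_le_of_ne h.1 h.2

/-- A decreasing chain in the lower line is a set of array columns whose lower entries fall as the
upper ones rise. The same sets describe the chains of the sorted upper line in
`IsBurge.hasDec_sortedTop`, so the two words have the same Greene numbers. -/
theorem IsBurge.hasDec_snd {L : List (ℕ × ℕ)} (h : IsBurge L) {k m : ℕ} :
    HasDec k (L.map Prod.snd) m ↔
      ∃ F, IsColouring k L F ∧ m ≤ L.countP fun e => F e < k := by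
  constructor
  · rintro ⟨f, hf, hm⟩
    refine ⟨fun e => f e.2, ?_, ?_⟩
    · rw [List.pairwise_map] at hf
      intro e he e' he' hlt
      have hp := List.pairwise_and_iff.2 ⟨hf, h.pairwise⟩
      rcases sublist_or_sublist he he' (fun h' => by rw [h'] at hlt; omega) with hs | hs
      · exact (List.rel_of_pairwise_cons (hp.sublist hs) (List.mem_singleton.2 rfl)).1
      · have := (List.rel_of_pairwise_cons (hp.sublist hs) (List.mem_singleton.2 rfl)).2
        omega
    · rwa [List.countP_map] at hm
  · rintro ⟨F, hF, hm⟩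
    obtain ⟨f, hf⟩ := h.exists_colour F
    refine ⟨f, ?_, ?_⟩
    · rw [List.pairwise_map]
      refine h.pairwise.imp_of_mem ?_
      intro e e' he he' hlt h1 h2
      rw [(hf e he).2] at h1 h2
      rw [(hf e' he').2] at h1
      exact hF e he e' he' hlt h1 h2
    · rw [List.countP_map]
      refine hm.trans (le_of_eq (List.countP_congr fun e he => ?_))
      simp [(hf e he).2]

theorem IsBurge.hasDec_sortedTop {L : List (ℕ × ℕ)} (h : IsBurge L) {k m : ℕ} :
    HasDec k (sortedTop L) m ↔
      ∃ F, IsColouring k L F ∧ m ≤ L.countP fun e => F e < k := by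
  have hmem : ∀ e, e ∈ (L.insertionSort fun p q => p.2 ≤ q.2) ↔ e ∈ L := fun e =>
    (List.perm_insertionSort _ L).mem_iff
  constructor
  · rintro ⟨f, hf, hm⟩
    refine ⟨fun e => f e.1, ?_, ?_⟩
    · rw [sortedTop, List.pairwise_map] at hf
      intro e he e' he' hlt h1 h2
      have hp := List.pairwise_and_iff.2 ⟨hf, h.pairwise_sort⟩
      rcases sublist_or_sublist ((hmem e).2 he) ((hmem e').2 he')
        (fun h' => by rw [h'] at hlt; omega) with hs | hs
      · have := (List.rel_of_pairwise_cons (hp.sublist hs) (List.mem_singleton.2 rfl)).1 h1 h2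
        omega
      · exact (List.rel_of_pairwise_cons (hp.sublist hs) (List.mem_singleton.2 rfl)).2
    · rw [sortedTop, List.countP_map, (List.perm_insertionSort _ L).countP_eq] at hm
      exact hm
  · rintro ⟨F, hF, hm⟩
    obtain ⟨f, hf⟩ := h.exists_colour F
    refine ⟨f, ?_, ?_⟩
    · rw [sortedTop, List.pairwise_map]
      refine h.pairwise_sort.imp_of_mem ?_
      intro e e' he he' hlt h1 h2
      rw [hmem] at he he'
      rw [(hf e he).1] at h1 h2
      rw [(hf e' he').1] at h1
      by_contra hle
      have hne : e.1 ≠ e'.1 := by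
        intro h3
        rw [h.eq_of_label he he' (Or.inl h3) (Or.inl rfl)] at hlt
        omega
      have := hF e he e' he' (by omega) h1 h2
      omega
    · rw [sortedTop, List.countP_map, (List.perm_insertionSort _ L).countP_eq]
      refine hm.trans (le_of_eq (List.countP_congr fun e he => ?_))
      simp [(hf e he).1]

/-- One colouring serves both halves of the bumping sequence: within a colour every upper entry
exceeds every lower entry, so the chain of upper entries can be continued by the chain of lower
ones. -/
theorem IsBurge.hasDec_double {L : List (ℕ × ℕ)} (h : IsBurge L) {k m : ℕ}
    (hm : HasDec k (sortedTop L) m) : HasDec k (bumpingSequence L) (2 * m) := by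
  obtain ⟨F, hF, hm⟩ := h.hasDec_sortedTop.1 hm
  obtain ⟨f, hf⟩ := h.exists_colour F
  have hmem : ∀ e, e ∈ (L.insertionSort fun p q => p.2 ≤ q.2) ↔ e ∈ L := fun e =>
    (List.perm_insertionSort _ L).mem_iff
  refine ⟨f, ?_, ?_⟩
  · rw [bumpingSequence_eq, List.pairwise_append]
    refine ⟨?_, ?_, ?_⟩
    · rw [sortedTop, List.pairwise_map]
      refine h.pairwise_sort.imp_of_mem ?_
      intro e e' he he' hlt h1 h2
      rw [hmem] at he he'
      rw [(hf e he).1] at h1 h2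
      rw [(hf e' he').1] at h1
      by_contra hle
      have hne : e.1 ≠ e'.1 := by
        intro h3
        rw [h.eq_of_label he he' (Or.inl h3) (Or.inl rfl)] at hlt
        omega
      have := hF e he e' he' (by omega) h1 h2
      omega
    · rw [List.pairwise_map]
      refine h.pairwise.imp_of_mem ?_
      intro e e' he he' hlt h1 h2
      rw [(hf e he).2] at h1 h2
      rw [(hf e' he').2] at h1
      exact hF e he e' he' hlt h1 h2
    · intro a ha b hb h1 h2
      obtain ⟨e, he, rfl⟩ := List.mem_map.1 ha
      obtain ⟨e', he', rfl⟩ := List.mem_map.1 hb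
      rw [hmem] at he
      rw [(hf e he).1] at h1 h2
      rw [(hf e' he').2] at h1
      have i1 := h.2.2 e he
      have i2 := h.2.2 e' he'
      rcases lt_trichotomy e.1 e'.1 with h3 | h3 | h3
      · have := hF e he e' he' h3 h1 h2
        omega
      · omega
      · omega
  · rw [bumpingSequence_eq, List.countP_append, sortedTop, List.countP_map,
      (List.perm_insertionSort _ L).countP_eq, List.countP_map]
    have e1 : L.countP ((fun a => decide (f a < k)) ∘ Prod.fst) = L.countP fun e => F e < k :=
      List.countP_congr fun e he => by simp [(hf e he).1]
    have e2 : L.countP ((fun a => decide (f a < k)) ∘ Prod.snd) = L.countP fun e => F e < k :=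
      List.countP_congr fun e he => by simp [(hf e he).2]
    omega

theorem HasDec.of_append {k m : ℕ} {u v : List ℕ} (h : HasDec k (u ++ v) m) :
    ∃ m1 m2, m ≤ m1 + m2 ∧ HasDec k u m1 ∧ HasDec k v m2 := by
  obtain ⟨f, hf, hm⟩ := h
  rw [List.pairwise_append] at hf
  rw [List.countP_append] at hm
  exact ⟨_, _, hm, ⟨f, hf.1, le_rfl⟩, ⟨f, hf.2.1, le_rfl⟩⟩

/-- Greene's theorem for column bumping: the word is Knuth equivalent to the reading word of its
tableau, for which the count is known. -/
theorem hasDec_bumpAll {w : List ℕ} (h : w.Nodup) (k m : ℕ) :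
    HasDec k w m ↔ m ≤ (bumpAll w []).flatten.countP fun a => colIdx (bumpAll w []) a < k := by
  rw [(knuth_colRead_bumpAll h).hasDec h, ← (colRead_perm _).countP_eq]
  have hs := std_bumpAll h
  refine hasDec_iff hs.nodup_colRead (rowIdx _) _ (colRead_pairwise_row hs)
    ((colRead_pairwise hs).imp fun h e => by omega) ?_ k m
  intro a ha j hj
  obtain ⟨b, h1, h2, h3, -⟩ := hs.exists_left (mem_colRead.1 ha) hj
  exact ⟨b, mem_colRead.2 h1, h2, h3⟩

/-- Both halves of the bumping sequence have the same Greene numbers, which bounds the number of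
letters covered by `k` chains by twice that of one half; `IsBurge.hasDec_double` attains it. So the
first `k` columns together have an even number of entries, for each `k`, and differences give the
single columns. -/
theorem IsBurge.even_len {L : List (ℕ × ℕ)} (h : IsBurge L) (k : ℕ) :
    Even (len (bumpAll (bumpingSequence L) []) k) := by
  have hJ : (sortedTop L).Nodup := (List.nodup_append.1 h.nodup).1
  have key : ∀ k, ∃ M, (bumpAll (bumpingSequence L) []).flatten.countP
      (fun a => colIdx (bumpAll (bumpingSequence L) []) a < k) = 2 * M := by
    intro k
    refine ⟨_, eq_of_forall_le_iff (b := 2 * (bumpAll (sortedTop L) []).flatten.countP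
      fun a => colIdx (bumpAll (sortedTop L) []) a < k) fun m => ?_⟩
    rw [← hasDec_bumpAll h.nodup]
    constructor
    · intro hm
      obtain ⟨m1, m2, h1, h2, h3⟩ := hm.of_append
      rw [h.hasDec_snd, ← h.hasDec_sortedTop] at h3
      have h4 := (hasDec_bumpAll hJ k m1).1 h2
      have h5 := (hasDec_bumpAll hJ k m2).1 h3
      omega
    · intro hm
      obtain ⟨f, h1, h2⟩ := h.hasDec_double ((hasDec_bumpAll hJ k _).2 le_rfl)
      exact ⟨f, h1, hm.trans h2⟩
  obtain ⟨M, hM⟩ := key k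
  obtain ⟨M', hM'⟩ := key (k + 1)
  have hsplit : ∀ (t : List (List ℕ)) (u : List ℕ), u.countP (fun a => colIdx t a < k + 1) =
      u.countP (fun a => colIdx t a < k) + u.countP (fun a => colIdx t a = k) := by
    intro t u
    induction u with
    | nil => rfl
    | cons a u ih =>
      rw [List.countP_cons, List.countP_cons, List.countP_cons, ih]
      simp only [decide_eq_true_eq]
      split_ifs <;> omega
  rw [hsplit, hM, ← len_eq_countP (std_bumpAll h.nodup).2.2] at hM'
  exact ⟨M' - M, by omega⟩

/-- The rows of a tableau come in pairs of rows of the same length. -/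
def IsPaired (t : List (List ℕ)) : Prop := ∀ s, len t (2 * s) = len t (2 * s + 1)

theorem IsBurge.isPaired {L : List (ℕ × ℕ)} (h : IsBurge L) : IsPaired (burgeRows L) := by
  intro s
  rw [len, len, burgeRows, ← row_bumpAll h.nodup, ← row_bumpAll h.nodup, length_row, length_row]
  apply List.countP_congr
  intro c hc
  obtain ⟨k, hk, rfl⟩ := List.mem_iff_getElem.1 hc
  have := h.even_len k
  rw [len, List.getD_eq_getElem _ _ hk] at this
  obtain ⟨m, hm⟩ := this
  simp only [decide_eq_true_eq]
  omega

/-! ### The bumping route -/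

/-- The index of the list that becomes longer under `x → t`. -/
def endIdx (x : ℕ) : List (List ℕ) → ℕ
  | [] => 0
  | c :: t =>
      match (insertInColumn x c).2 with
      | none => 0
      | some y => endIdx y t + 1

theorem len_columnInsert (x : ℕ) (t : List (List ℕ)) (s : ℕ) :
    len (columnInsert x t) s = len t s + if s = endIdx x t then 1 else 0 := by
  have key : ∀ (c : List ℕ) (x : ℕ), (insertInColumn x c).1.length =
      c.length + if (insertInColumn x c).2 = none then 1 else 0 := by
    intro c
    induction c with
    | nil => intro x; simp [insertInColumn]
    | cons y c ih =>
      intro x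
      by_cases h : x < y
      · simp [insertInColumn, h]
      · simp only [insertInColumn, h, if_false, List.length_cons, ih]
        omega
  induction t generalizing x s with
  | nil => cases s <;> simp [columnInsert, len, endIdx]
  | cons c t ih =>
    have hk := key c x
    rw [columnInsert, endIdx]
    cases hy : (insertInColumn x c).2 with
    | none =>
      rw [hy] at hk
      cases s <;> simp [len, hk]
    | some y =>
      rw [hy] at hk
      cases s with
      | zero => simp [len, hk]
      | succ s =>
        have := ih y s
        simpa [len] using this

theorem endIdx_of_none {x : ℕ} {c : List ℕ} {t : List (List ℕ)} (h : ∀ a ∈ c, a < x) :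
    endIdx x (c :: t) = 0 := by
  rcases insertInColumn_cases x c (fun h' => (h x h').ne rfl) with ⟨-, h2⟩ | ⟨l, y, r, h1, -, h3, -⟩
  · simp [endIdx, h2]
  · have := h y (by simp [h1])
    omega

theorem insertInColumn_of_split {x y : ℕ} {l r : List ℕ} (h : ∀ a ∈ l, a < x) (hxy : x < y) :
    insertInColumn x (l ++ y :: r) = (l ++ x :: r, some y) := by
  induction l with
  | nil => simp [insertInColumn, hxy]
  | cons a l ih =>
    have := h a (by simp)
    simp [insertInColumn, ih (fun b hb => h b (by simp [hb])), show ¬ x < a by omega]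

theorem endIdx_of_split {x y : ℕ} {l r : List ℕ} {t : List (List ℕ)} (h : ∀ a ∈ l, a < x)
    (hxy : x < y) : endIdx x ((l ++ y :: r) :: t) = endIdx y t + 1 := by
  rw [endIdx, insertInColumn_of_split h hxy]

theorem columnInsert_of_split {x y : ℕ} {l r : List ℕ} {t : List (List ℕ)} (h : ∀ a ∈ l, a < x)
    (hxy : x < y) : columnInsert x ((l ++ y :: r) :: t) = (l ++ x :: r) :: columnInsert y t := by
  rw [columnInsert, insertInColumn_of_split h hxy]

theorem columnInsert_of_none {x : ℕ} {c : List ℕ} {t : List (List ℕ)} (h : ∀ a ∈ c, a < x) :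
    columnInsert x (c :: t) = (c ++ [x]) :: t := by
  rcases columnInsert_cases x c t (fun h' => (h x h').ne rfl) with ⟨-, h2⟩ | ⟨l, y, r, h1, -, h3, -⟩
  · exact h2
  · have := h y (by simp [h1])
    omega

theorem mem_columnInsert {x a : ℕ} {t : List (List ℕ)} :
    a ∈ (columnInsert x t).flatten ↔ a = x ∨ a ∈ t.flatten := by
  rw [(columnInsert_perm t x).mem_iff, List.mem_cons]

theorem colIdx_columnInsert_self {x : ℕ} {t : List (List ℕ)} (hx : x ∉ t.flatten) :
    colIdx (columnInsert x t) x = 0 := by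
  cases t with
  | nil => simp [columnInsert, colIdx]
  | cons c t =>
    simp only [List.flatten_cons, List.mem_append, not_or] at hx
    rcases columnInsert_cases x c t hx.1 with ⟨h1, h2⟩ | ⟨l, y, r, h1, h2, h3, h4⟩
    · simp [h2, colIdx]
    · simp [h4, colIdx]

/-- An entry that moves under `x → t` goes to the next list, and the entries that move after it
are larger. -/
theorem colIdx_columnInsert {t : List (List ℕ)} (ht : t.flatten.Nodup) {x : ℕ} (hx : x ∉ t.flatten)
    {a : ℕ} (ha : a ∈ t.flatten) :
    colIdx (columnInsert x t) a = colIdx t a ∨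
      colIdx (columnInsert x t) a = colIdx t a + 1 ∧ colIdx t a + 1 ≤ endIdx x t ∧
        ∃ e ∈ t.flatten, a + endIdx x t ≤ e + (colIdx t a + 1) := by
  -- The induction also needs the bound for `x` itself. The successively bumped entries strictly
  -- increase, so a route with `endIdx x t` bumps ends with an entry at least that much larger than
  -- `x`.
  suffices H : (∃ e ∈ x :: t.flatten, x + endIdx x t ≤ e) ∧ ∀ a ∈ t.flatten,
      (colIdx (columnInsert x t) a = colIdx t a ∨
      colIdx (columnInsert x t) a = colIdx t a + 1 ∧ colIdx t a + 1 ≤ endIdx x t ∧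
        ∃ e ∈ t.flatten, a + endIdx x t ≤ e + (colIdx t a + 1)) from H.2 a ha
  clear ha
  induction t generalizing x with
  | nil => simp [endIdx]
  | cons c t ih =>
    have h4 : (c ++ t.flatten).Nodup := by simpa using ht
    have h4' := List.nodup_append.1 h4
    have hx' := hx
    simp only [List.flatten_cons, List.mem_append, not_or] at hx
    rcases columnInsert_cases x c t hx.1 with ⟨h6, h7⟩ | ⟨l, y, r, h6, h7, h8, h9⟩
    · refine ⟨⟨x, by simp, by rw [endIdx_of_none h6]; omega⟩, fun a ha => ?_⟩
      left
      have hax : a ≠ x := fun e => hx' (e ▸ ha)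
      rw [h7]
      simp [colIdx, hax]
    · have hyt : y ∉ t.flatten := fun hy => h4'.2.2 y (by simp [h6]) y hy rfl
      obtain ⟨⟨e, he, hle⟩, ih2⟩ := ih h4'.2.1 hyt
      have hend : endIdx x (c :: t) = endIdx y t + 1 := by rw [h6]; exact endIdx_of_split h7 h8
      have he' : e ∈ (c :: t).flatten := by
        simp only [List.mem_cons, List.flatten_cons, List.mem_append] at he ⊢
        rcases he with rfl | he
        · left; simp [h6]
        · exact Or.inr he
      refine ⟨⟨e, List.mem_cons_of_mem _ he', by omega⟩, fun a ha => ?_⟩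
      have hax : a ≠ x := fun e => hx' (e ▸ ha)
      rw [h9, hend]
      by_cases hac : a ∈ c
      · by_cases hay : a = y
        · subst hay
          right
          have hn : a ∉ l ++ x :: r := by
            rw [h6] at h4'
            have h5 := (List.nodup_middle.1 h4'.1)
            rw [List.nodup_cons, List.mem_append] at h5
            simp only [List.mem_append, List.mem_cons, not_or] at h5 ⊢
            exact ⟨h5.1.1, hax, h5.1.2⟩
          simp only [colIdx, hac, hn, if_true, if_false, colIdx_columnInsert_self hyt]
          exact ⟨trivial, by omega, e, he', by omega⟩
        · left
          have : a ∈ l ++ x :: r := by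
            rw [h6] at hac
            simp only [List.mem_append, List.mem_cons] at hac ⊢
            tauto
          simp [colIdx, hac, this]
      · have hat : a ∈ t.flatten := by
          simp only [List.flatten_cons, List.mem_append] at ha
          tauto
        have hn : a ∉ l ++ x :: r := by
          rw [h6] at hac
          simp only [List.mem_append, List.mem_cons, not_or] at hac ⊢
          exact ⟨hac.1, hax, hac.2.2⟩
        simp only [colIdx, hac, hn, if_false]
        rcases ih2 a hat with h | ⟨h, hh, e', he', hle'⟩
        · left; omega
        · right
          exact ⟨by omega, by omega, e', by simp [he'], by omega⟩

/-! ### Reversing an insertion -/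

theorem countP_insertInColumn_le (y : ℕ) (c : List ℕ) (hy : y ∉ c) (b : ℕ) :
    c.countP (· ≤ b) ≤ (insertInColumn y c).1.countP (· ≤ b) := by
  rcases insertInColumn_cases y c hy with ⟨-, h2⟩ | ⟨l, z, r, h1, -, h3, h4⟩
  · rw [h2, List.countP_append]
    omega
  · rw [h4, h1, List.countP_append, List.countP_append, List.countP_cons, List.countP_cons]
    simp only [decide_eq_true_eq]
    split_ifs <;> omega

/-- At the threshold `y` the new entry is counted and no entry `≤ b` has been displaced. The strict
gain is needed when a bump is undone, for thresholds between the two exchanged entries. -/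
theorem countP_insertInColumn_lt (y : ℕ) (c : List ℕ) (hy : y ∉ c) {b : ℕ} (hb : b < y) :
    c.countP (· ≤ b) + 1 ≤ (insertInColumn y c).1.countP (· ≤ y) := by
  have mono : ∀ e : List ℕ, e.countP (· ≤ b) ≤ e.countP (· ≤ y) := by
    intro e
    apply List.countP_mono_left
    intro a _ ha
    simp only [decide_eq_true_eq] at *
    omega
  rcases insertInColumn_cases y c hy with ⟨-, h2⟩ | ⟨l, z, r, h1, -, h3, h4⟩
  · rw [h2, List.countP_append]
    have := mono c
    simp
    omega
  · rw [h4, h1, List.countP_append, List.countP_append, List.countP_cons, List.countP_cons]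
    have := mono l
    have := mono r
    simp only [decide_eq_true_eq, le_refl, if_true]
    split_ifs <;> omega

/-- Reverse bumping from the corner at the end of list `h`. The later lists give up an entry `y`; in
the list before them `y` replaces the largest entry below it, which becomes the new outgoing entry.
-/
theorem exists_columnInsert {t : List (List ℕ)} (ht : Std t) {h : ℕ} (hh : len t (h + 1) < len t h) :
    ∃ x u, Std u ∧ x ∉ u.flatten ∧ columnInsert x u = t ∧ endIdx x u = h := by
  induction h generalizing t with
  | zero =>
    cases t with
    | nil => simp [len] at hh
    | cons c t =>
      obtain ⟨h1, h2, h3, h4, h5⟩ := std_cons.1 ht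
      rcases List.eq_nil_or_concat' c with rfl | ⟨c, x, rfl⟩
      · exact absurd rfl h1
      rw [List.pairwise_append] at h2
      have hlt : ∀ a ∈ c, a < x := fun a ha => h2.2.2 a ha x (by simp)
      have hlen : (t.headD []).length < (c ++ [x]).length := by
        cases t with
        | nil => simp
        | cons d t => simpa [len] using hh
      rw [List.length_append, List.length_singleton] at hlen
      have hxn : x ∉ c ∧ x ∉ t.flatten := by
        refine ⟨fun h => (hlt x h).ne rfl, fun h => ?_⟩
        exact (List.nodup_append.1 h4).2.2 x (by simp) x h rfl
      by_cases hc : c = []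
      · subst hc
        have : t = [] := by
          cases t with
          | nil => rfl
          | cons d t =>
            exact absurd (List.length_eq_zero_iff.1 (by simpa using hlen)) (h5.ne_nil (by simp))
        subst this
        exact ⟨x, [], std_nil, by simp, by simp [columnInsert], by simp [endIdx]⟩
      · refine ⟨x, c :: t, std_cons.2 ⟨hc, h2.1, ?_, ?_, h5⟩, ?_, columnInsert_of_none hlt,
          endIdx_of_none hlt⟩
        · intro b
          have := h3 b
          rw [List.countP_append, List.countP_singleton] at this
          by_cases hb : x ≤ b
          · have e : c.countP (· ≤ b) = c.length := by
              rw [List.countP_eq_length]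
              intro a ha
              have := hlt a ha
              simp only [decide_eq_true_eq]
              omega
            rw [e]
            exact List.countP_le_length.trans (by omega)
          · simpa [hb] using this
        · refine h4.sublist ?_
          exact List.Sublist.append (List.sublist_append_left _ _) (List.Sublist.refl _)
        · simpa using hxn
  | succ h ih =>
    cases t with
    | nil => simp [len] at hh
    | cons c t =>
      obtain ⟨h1, h2, h3, h4, h5⟩ := std_cons.1 ht
      obtain ⟨y, u, hu, hyu, rfl, rfl⟩ := ih h5 (by simpa [len] using hh)
      have hyc : y ∉ c := fun hy =>
        (List.nodup_append.1 h4).2.2 y hy y (mem_columnInsert.2 (Or.inl rfl)) rfl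
      rw [headD_columnInsert] at h3
      have hu1 : (u.headD []).Pairwise (· < ·) ∧ y ∉ u.headD [] := by
        cases u with
        | nil => simp
        | cons d u =>
          simp only [List.flatten_cons, List.mem_append, not_or] at hyu
          exact ⟨(std_cons.1 hu).2.1, hyu.1⟩
      have hpos : ∀ b, b < y → (u.headD []).countP (· ≤ b) + 1 ≤ c.countP (· ≤ y) := fun b hb =>
        (countP_insertInColumn_lt y _ hu1.2 hb).trans (h3 y)
      -- An entry below `y` exists because `c` dominates a list that contains `y`, while `y` itself
      -- is not in `c`. The largest such entry is chosen.
      have hex : ∃ l x r, c = l ++ x :: r ∧ x < y ∧ ∀ a ∈ r, y < a := by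
        have hc1 : 0 < c.countP (· ≤ y) := by
          have h6 := h3 y
          have h7 : y ∈ (insertInColumn y (u.headD [])).1 := by
            rcases insertInColumn_cases y _ hu1.2 with ⟨-, h2⟩ | ⟨l, z, r, -, -, -, h4⟩
            · rw [h2]; simp
            · rw [h4]; simp
          have : 0 < (insertInColumn y (u.headD [])).1.countP (· ≤ y) :=
            List.countP_pos_iff.2 ⟨y, h7, by simp⟩
          omega
        have key : ∀ c : List ℕ, c.Pairwise (· < ·) → y ∉ c → 0 < c.countP (· ≤ y) →
            ∃ l x r, c = l ++ x :: r ∧ x < y ∧ ∀ a ∈ r, y < a := by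
          intro c
          induction c with
          | nil => simp
          | cons a c ih =>
            intro g1 g2 g3
            rw [List.pairwise_cons] at g1
            simp only [List.mem_cons, not_or] at g2
            by_cases hc : 0 < c.countP (· ≤ y)
            · obtain ⟨l, x, r, rfl, k1, k2⟩ := ih g1.2 g2.2 hc
              exact ⟨a :: l, x, r, by simp, k1, k2⟩
            · have hc0 : c.countP (· ≤ y) = 0 := by omega
              rw [List.countP_cons, hc0] at g3
              simp only [decide_eq_true_eq] at g3
              refine ⟨[], a, c, by simp, ?_, ?_⟩
              · split_ifs at g3 <;> omega
              · intro b hb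
                have := List.countP_eq_zero.1 hc0 b hb
                simpa using this
        exact key c h2 hyc hc1
      obtain ⟨l, x, r, rfl, hxy, hr⟩ := hex
      have h2' := h2
      rw [List.pairwise_append, List.pairwise_cons] at h2
      have hl : ∀ a ∈ l, a < x := fun a ha => h2.2.2 a ha x (by simp)
      have hcr : ∀ b, b ≤ y → r.countP (· ≤ b) = 0 := by
        intro b hb
        rw [List.countP_eq_zero]
        intro a ha
        have := hr a ha
        simp only [decide_eq_true_eq]
        omega
      have hlc : ∀ b, x ≤ b → l.countP (· ≤ b) = l.length := by
        intro b hb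
        rw [List.countP_eq_length]
        intro a ha
        have := hl a ha
        simp only [decide_eq_true_eq]
        omega
      have hxt : x ∉ (columnInsert y u).flatten := fun hx =>
        (List.nodup_append.1 h4).2.2 x (by simp) x hx rfl
      rw [mem_columnInsert, not_or] at hxt
      have hnd : (x :: ((l ++ y :: r) ++ u.flatten)).Nodup := by
        refine (List.Perm.nodup_iff ?_).1 h4
        refine ((columnInsert_perm u y).append_left _).trans ?_
        simp only [List.append_assoc, List.cons_append]
        refine List.perm_middle.trans (List.Perm.cons _ (List.Perm.append_left _ ?_))
        exact List.perm_middle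
      rw [List.nodup_cons] at hnd
      refine ⟨x, (l ++ y :: r) :: u, std_cons.2 ⟨by simp, ?_, ?_, hnd.2, hu⟩, ?_,
        columnInsert_of_split hl hxy, endIdx_of_split hl hxy⟩
      · rw [List.pairwise_append, List.pairwise_cons]
        refine ⟨h2.1, ⟨hr, h2.2.1.2⟩, ?_⟩
        intro a ha b hb
        rcases List.mem_cons.1 hb with rfl | hb
        · exact (hl a ha).trans hxy
        · exact h2.2.2 a ha b (by simp [hb])
      · intro b
        rw [List.countP_append, List.countP_cons]
        simp only [decide_eq_true_eq]
        by_cases hby : y ≤ b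
        · have h6 := (countP_insertInColumn_le y _ hu1.2 b).trans (h3 b)
          rw [List.countP_append, List.countP_cons] at h6
          simp only [decide_eq_true_eq] at h6
          rw [if_pos (by omega)] at h6
          rw [if_pos hby]
          omega
        · rw [if_neg hby]
          -- For `x ≤ b < y` the new list has lost one counted entry, since `y` has replaced `x`.
          -- The strict inequality `hpos` makes up for it.
          by_cases hbx : x ≤ b
          · have h6 := hpos b (by omega)
            rw [List.countP_append, List.countP_cons, hcr y le_rfl, hlc y hxy.le] at h6
            simp only [decide_eq_true_eq] at h6
            rw [if_pos hxy.le] at h6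
            rw [hlc b hbx]
            omega
          · have h6 := (countP_insertInColumn_le y _ hu1.2 b).trans (h3 b)
            rw [List.countP_append, List.countP_cons] at h6
            simp only [decide_eq_true_eq] at h6
            rw [if_neg hbx] at h6
            omega
      · simpa using hnd.1

theorem split_unique {l l' r r' : List ℕ} {x x' y : ℕ} (h : l ++ x :: r = l' ++ x' :: r')
    (hp : (l ++ x :: r).Pairwise (· < ·)) (hx : x < y) (hx' : x' < y) (hr : ∀ a ∈ r, y < a)
    (hr' : ∀ a ∈ r', y < a) : l = l' ∧ x = x' ∧ r = r' := by
  induction l generalizing l' with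
  | nil =>
    cases l' with
    | nil => simpa using h
    | cons a l' =>
      simp only [List.nil_append, List.cons_append, List.cons.injEq] at h
      have := hr x' (by simp [h.2])
      omega
  | cons a l ih =>
    cases l' with
    | nil =>
      simp only [List.nil_append, List.cons_append, List.cons.injEq] at h
      have := hr' x (by simp [← h.2])
      omega
    | cons a' l' =>
      simp only [List.cons_append, List.cons.injEq] at h
      rw [List.cons_append, List.pairwise_cons] at hp
      obtain ⟨e1, e2, e3⟩ := ih h.2 hp.2
      exact ⟨by rw [h.1, e1], e2, e3⟩

/-- Once the end of the route is known, the route can be retraced: either both insertions stop in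
the first list, or both pass on an entry. By induction the passed entries agree, and then
`split_unique` locates the bumped position as that of the largest entry below the passed one. -/
theorem columnInsert_injective {t u : List (List ℕ)} (ht : Std t) (hu : Std u) {x x' : ℕ}
    (hx : x ∉ t.flatten) (hx' : x' ∉ u.flatten) (h : columnInsert x t = columnInsert x' u)
    (he : endIdx x t = endIdx x' u) : x = x' ∧ t = u := by
  induction t generalizing u x x' with
  | nil =>
    cases u with
    | nil => simpa [columnInsert] using h
    | cons d u =>
      simp only [List.flatten_cons, List.mem_append, not_or] at hx'
      rcases columnInsert_cases x' d u hx'.1 with ⟨h6, h7⟩ | ⟨l, y, r, h6, h7, h8, h9⟩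
      · have := (std_cons.1 hu).1
        have hd : 0 < d.length := List.length_pos_iff.2 this
        rw [h7, columnInsert, List.cons.injEq] at h
        have := congrArg List.length h.1
        simp at this
        simp [this] at hd
      · rw [h6, endIdx_of_split h7 h8, endIdx] at he
        omega
  | cons c t ih =>
    obtain ⟨g1, g2, g3, g4, g5⟩ := std_cons.1 ht
    cases u with
    | nil =>
      simp only [List.flatten_cons, List.mem_append, not_or] at hx
      rcases columnInsert_cases x c t hx.1 with ⟨h6, h7⟩ | ⟨l, y, r, h6, h7, h8, h9⟩
      · have hd : 0 < c.length := List.length_pos_iff.2 g1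
        rw [h7, columnInsert, List.cons.injEq] at h
        have := congrArg List.length h.1
        simp at this
        simp [this] at hd
      · rw [h6, endIdx_of_split h7 h8, endIdx] at he
        omega
    | cons d u =>
      obtain ⟨k1, k2, k3, k4, k5⟩ := std_cons.1 hu
      simp only [List.flatten_cons, List.mem_append, not_or] at hx hx'
      rcases columnInsert_cases x c t hx.1 with ⟨h6, h7⟩ | ⟨l, y, r, h6, h7, h8, h9⟩ <;>
      rcases columnInsert_cases x' d u hx'.1 with ⟨h6', h7'⟩ | ⟨l', y', r', h6', h7', h8', h9'⟩
      · rw [h7, h7', List.cons.injEq] at h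
        have := List.append_inj' h.1 rfl
        exact ⟨by simpa using this.2, by rw [this.1, h.2]⟩
      · rw [endIdx_of_none h6, h6', endIdx_of_split h7' h8'] at he
        omega
      · rw [endIdx_of_none h6', h6, endIdx_of_split h7 h8] at he
        omega
      · rw [h9, h9', List.cons.injEq] at h
        rw [h6, h6', endIdx_of_split h7 h8, endIdx_of_split h7' h8'] at he
        subst h6 h6'
        obtain ⟨rfl, rfl⟩ := ih g5 k5
          (fun hy => (List.nodup_append.1 g4).2.2 y (by simp) y hy rfl)
          (fun hy => (List.nodup_append.1 k4).2.2 y' (by simp) y' hy rfl) h.2 (by omega)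
        rw [List.pairwise_append, List.pairwise_cons] at g2 k2
        have hp : (l ++ x :: r).Pairwise (· < ·) := by
          rw [List.pairwise_append, List.pairwise_cons]
          refine ⟨g2.1, ⟨fun a ha => h8.trans (g2.2.1.1 a ha), g2.2.1.2⟩, ?_⟩
          intro a ha b hb
          rcases List.mem_cons.1 hb with rfl | hb
          · exact h7 a ha
          · exact g2.2.2 a ha b (by simp [hb])
        obtain ⟨rfl, rfl, rfl⟩ := split_unique h.1 hp h8 h8' g2.2.1.1 k2.2.1.1
        exact ⟨rfl, rfl⟩

/-! ### The correspondence between two-line arrays and even tableaux -/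

theorem labels_concat (L : List (ℕ × ℕ)) (e : ℕ × ℕ) :
    (labels (L ++ [e])).Perm (e.1 :: e.2 :: labels L) := by
  simp only [labels, List.map_append, List.map_cons, List.map_nil]
  rw [List.append_assoc, ← List.append_assoc [e.1]]
  refine List.perm_append_comm_assoc .. |>.trans ?_
  simp only [List.cons_append, List.nil_append]
  refine List.Perm.cons _ ?_
  rw [← List.append_assoc]
  exact (List.perm_append_singleton _ _).trans (List.Perm.cons _ List.perm_append_comm)

theorem mem_labels_concat {L : List (ℕ × ℕ)} {e : ℕ × ℕ} {a : ℕ} :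
    a ∈ labels (L ++ [e]) ↔ a = e.1 ∨ a = e.2 ∨ a ∈ labels L := by
  rw [(labels_concat L e).mem_iff, List.mem_cons, List.mem_cons]

theorem isBurge_concat {L : List (ℕ × ℕ)} {e : ℕ × ℕ} (h : IsBurge L) (he : e.2 < e.1)
    (h1 : ∀ a ∈ labels L, a < e.1) (h2 : e.2 ∉ labels L) : IsBurge (L ++ [e]) := by
  refine ⟨?_, ?_, ?_⟩
  · rw [List.map_append, List.pairwise_append]
    refine ⟨h.1, by simp, ?_⟩
    intro a ha b hb
    simp only [List.map_cons, List.map_nil, List.mem_singleton] at hb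
    subst hb
    exact h1 a (by simp [labels, ha])
  · rw [(labels_concat L e).nodup_iff, List.nodup_cons, List.nodup_cons, List.mem_cons, not_or]
    exact ⟨⟨by omega, fun h => (h1 _ h).ne rfl⟩, h2, h.2.1⟩
  · intro e' he'
    rcases List.mem_append.1 he' with h' | h'
    · exact h.2.2 e' h'
    · rw [List.mem_singleton.1 h']
      exact he

theorem isBurge_nil : IsBurge [] := by simp [IsBurge, labels]

theorem IsBurge.of_prefix {L L' : List (ℕ × ℕ)} (h : IsBurge (L ++ L')) : IsBurge L := by
  refine ⟨?_, ?_, fun e he => h.2.2 e (List.mem_append_left _ he)⟩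
  · have := h.1
    rw [List.map_append, List.pairwise_append] at this
    exact this.1
  · refine h.2.1.sublist ?_
    exact List.Sublist.append ((List.sublist_append_left L L').map _)
      ((List.sublist_append_left L L').map _)

/-- The new upper entry is the largest label, so cutting it off leaves the old sequence with the new
lower entry at its right end. For `rowBump` this means one more insertion. -/
theorem filter_bumpingSequence {L : List (ℕ × ℕ)} {e : ℕ × ℕ} (h : IsBurge (L ++ [e]))
    (h1 : ∀ a ∈ labels L, a < e.1) :
    (bumpingSequence (L ++ [e])).filter (· < e.1) = bumpingSequence L ++ [e.2] := by
  have he : e.2 < e.1 := h.2.2 e (by simp)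
  have hL : ∀ e' ∈ L, e'.1 < e.1 ∧ e'.2 < e.1 := fun e' he' =>
    ⟨h1 _ (mem_labels.2 ⟨e', he', Or.inl rfl⟩), h1 _ (mem_labels.2 ⟨e', he', Or.inr rfl⟩)⟩
  rw [bumpingSequence_eq, bumpingSequence_eq, List.filter_append, List.append_assoc]
  congr 1
  · rw [sortedTop, sortedTop, List.filter_map]
    congr 1
    refine List.Perm.eq_of_pairwise (le := fun e e' : ℕ × ℕ => e.2 < e'.2) ?_
      (h.pairwise_sort.filter _) h.of_prefix.pairwise_sort ?_
    · intro a b _ _ h1 h2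
      omega
    · refine (List.Perm.filter _ (List.perm_insertionSort _ _)).trans ?_
      refine List.Perm.trans ?_ (List.perm_insertionSort _ _).symm
      rw [List.filter_append]
      have e1 : L.filter ((fun x => decide (x < e.1)) ∘ Prod.fst) = L := by
        rw [List.filter_eq_self]
        intro e' he'
        simpa using (hL e' he').1
      rw [e1]
      simp
  · rw [List.map_append, List.filter_append]
    congr 1
    · rw [List.filter_eq_self]
      intro a ha
      obtain ⟨e', he', rfl⟩ := List.mem_map.1 ha
      simpa using (hL e' he').2
    · simp [he]

/-- Row lengths agree in pairs before and after two boxes are added. The first box cannot land in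
the second row of a pair, which would become longer than the first, so it opens a pair and the
second box completes the same pair. -/
theorem eq_ite_of_paired {f g : ℕ → ℕ} {h q : ℕ} (hf : ∀ s, f (2 * s) = f (2 * s + 1))
    (hg : ∀ s, g (2 * s) = g (2 * s + 1))
    (hfg : ∀ s, g s = f s + (if s = h then 1 else 0) + if s = q then 1 else 0)
    (hm : ∀ s, f (s + 1) + (if s + 1 = h then 1 else 0) ≤ f s + if s = h then 1 else 0) :
    Even h ∧ q = h + 1 := by
  rcases Nat.even_or_odd' h with ⟨m, rfl | rfl⟩
  · have h1 := hf m
    have h2 := hg m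
    rw [hfg, hfg] at h2
    refine ⟨by simp, ?_⟩
    split_ifs at h2 <;> omega
  · have h1 := hf m
    have h3 := hm (2 * m)
    split_ifs at h3 <;> omega

/-- Adding a column to a two-line array: the lower entry is inserted, and the upper entry is put
below the new box. -/
theorem IsBurge.burgeRows_concat {L : List (ℕ × ℕ)} {e : ℕ × ℕ} (h : IsBurge (L ++ [e]))
    (h1 : ∀ a ∈ labels L, a < e.1) :
    (∀ a ∈ e.2 :: labels L,
      colIdx (burgeRows (L ++ [e])) a = colIdx (columnInsert e.2 (burgeRows L)) a) ∧
    Even (endIdx e.2 (burgeRows L)) ∧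
    colIdx (burgeRows (L ++ [e])) e.1 = endIdx e.2 (burgeRows L) + 1 := by
  have hL := h.of_prefix
  have he : e.2 < e.1 := h.2.2 e (by simp)
  have hnd := (labels_concat L e).nodup_iff.1 h.2.1
  rw [List.nodup_cons, List.nodup_cons] at hnd
  have heL : e.2 ∉ (burgeRows L).flatten := by rw [mem_burgeRows]; exact hnd.2.1
  have hnd' : (bumpingSequence L ++ [e.2]).Nodup := by
    refine ((List.perm_append_singleton _ _).trans
      (List.Perm.cons _ (bumpingSequence_perm L))).nodup_iff.2 ?_
    exact List.nodup_cons.2 hnd.2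
  have hcol : ∀ a ∈ e.2 :: labels L,
      colIdx (burgeRows (L ++ [e])) a = colIdx (columnInsert e.2 (burgeRows L)) a := by
    intro a ha
    rw [burgeRows, burgeRows, ← rowBump_concat]
    refine colIdx_rowBump_eq h.nodup hnd' (B := e.1) ?_ ?_ ?_
    · rw [filter_bumpingSequence h h1, eq_comm, List.filter_eq_self]
      intro b hb
      rw [List.mem_append, (bumpingSequence_perm L).mem_iff, List.mem_singleton] at hb
      rcases hb with hb | rfl
      · simpa using h1 b hb
      · simpa using he
    · rw [(bumpingSequence_perm _).mem_iff, (labels_concat L e).mem_iff]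
      exact List.mem_cons_of_mem _ ha
    · rcases List.mem_cons.1 ha with rfl | ha
      · exact he
      · exact h1 a ha
  have hci : Std (columnInsert e.2 (burgeRows L)) := hL.std.columnInsert heL
  refine ⟨hcol, eq_ite_of_paired hL.isPaired h.isPaired ?_ ?_⟩
  · intro s
    have hp : (burgeRows (L ++ [e])).flatten.Perm
        (e.1 :: (columnInsert e.2 (burgeRows L)).flatten) := by
      refine (List.perm_ext_iff_of_nodup h.std.2.2 (List.nodup_cons.2 ⟨?_, hci.2.2⟩)).2 ?_
      · rw [mem_columnInsert, mem_burgeRows, not_or]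
        exact ⟨by omega, fun h => hnd.1 (List.mem_cons_of_mem _ h)⟩
      · intro a
        rw [mem_burgeRows, mem_labels_concat, List.mem_cons, mem_columnInsert, mem_burgeRows]
    rw [len_eq_countP h.std.2.2, hp.countP_eq, List.countP_cons, ← len_columnInsert,
      len_eq_countP hci.2.2]
    congr 1
    · apply List.countP_congr
      intro a ha
      rw [mem_columnInsert, mem_burgeRows] at ha
      rw [hcol a (List.mem_cons.2 ha)]
    · simp only [decide_eq_true_eq, eq_comm (a := s)]
  · intro s
    rw [← len_columnInsert, ← len_columnInsert]
    exact hci.len_le (by omega)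

/-! ### Inverting the correspondence by removal of the largest label -/

/-- Restriction of a tableau to its entries `< B`. -/
def restrict (B : ℕ) (t : List (List ℕ)) : List (List ℕ) :=
  rowBump ((colRead t).filter (· < B)).reverse

theorem Std.restrict_nodup {t : List (List ℕ)} (h : Std t) (B : ℕ) :
    ((colRead t).filter (· < B)).reverse.Nodup :=
  List.nodup_reverse.2 (h.nodup_colRead.filter _)

theorem Std.restrict {t : List (List ℕ)} (h : Std t) (B : ℕ) : Std (restrict B t) :=
  std_rowBump (h.restrict_nodup B)

theorem mem_restrict {t : List (List ℕ)} {B a : ℕ} :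
    a ∈ (restrict B t).flatten ↔ a ∈ t.flatten ∧ a < B := by
  rw [restrict, mem_rowBump]
  simp only [List.mem_reverse, List.mem_filter, mem_colRead, decide_eq_true_eq]

theorem Std.colIdx_restrict {t : List (List ℕ)} (h : Std t) {B a : ℕ} (ha : a ∈ t.flatten)
    (haB : a < B) : colIdx (SymplecticBranching.restrict B t) a = colIdx t a := by
  refine (colIdx_eq_colIdx h (h.restrict B) (B := B) ?_ ha haB).symm
  have := (knuth_rowBump (h.restrict_nodup B)).filter_lt B
  rw [List.reverse_reverse, filter_lt_filter_lt _ le_rfl] at this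
  exact this

theorem Std.len_restrict {t : List (List ℕ)} (h : Std t) {j : ℕ} (hj : j ∈ t.flatten)
    (hmax : ∀ a ∈ t.flatten, a ≤ j) (s : ℕ) :
    len t s = len (SymplecticBranching.restrict j t) s + if s = colIdx t j then 1 else 0 := by
  have hp : t.flatten.Perm (j :: (SymplecticBranching.restrict j t).flatten) := by
    refine (List.perm_ext_iff_of_nodup h.2.2 (List.nodup_cons.2 ⟨?_, (h.restrict j).2.2⟩)).2 ?_
    · rw [mem_restrict]
      exact fun h => (h.2).ne rfl
    · intro a
      rw [List.mem_cons, mem_restrict]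
      constructor
      · intro ha
        rcases eq_or_lt_of_le (hmax a ha) with h1 | h1
        · exact Or.inl h1
        · exact Or.inr ⟨ha, h1⟩
      · rintro (rfl | h1)
        · exact hj
        · exact h1.1
  rw [len_eq_countP h.2.2, hp.countP_eq, List.countP_cons, len_eq_countP (h.restrict j).2.2]
  congr 1
  · apply List.countP_congr
    intro a ha
    rw [mem_restrict] at ha
    rw [h.colIdx_restrict ha.1 ha.2]
  · simp only [decide_eq_true_eq, eq_comm (a := s)]

/-- Removing one box from a paired shape can only affect the second row of a pair; the first row of
the pair then ends in a corner, from which an insertion can be reversed. -/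
theorem eq_succ_of_paired {f g : ℕ → ℕ} {q : ℕ} (hf : ∀ s, f (2 * s) = f (2 * s + 1))
    (hfg : ∀ s, f s = g s + if s = q then 1 else 0) (hg : ∀ s, g (s + 1) ≤ g s) :
    ∃ m, q = 2 * m + 1 ∧ g (2 * m + 1) < g (2 * m) := by
  rcases Nat.even_or_odd' q with ⟨m, rfl | rfl⟩
  · have h1 := hf m
    rw [hfg, hfg] at h1
    have := hg (2 * m)
    split_ifs at h1 <;> omega
  · refine ⟨m, rfl, ?_⟩
    have h1 := hf m
    rw [hfg, hfg] at h1
    split_ifs at h1 <;> omega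

/-- Each even tableau comes from a two-line array. -/
theorem exists_burgeRows {t : List (List ℕ)} (ht : Std t) (hp : IsPaired t) :
    ∃ L, IsBurge L ∧ burgeRows L = t := by
  induction hN : t.flatten.length using Nat.strong_induction_on generalizing t with
  | _ N ih =>
    by_cases h0 : t.flatten = []
    · refine ⟨[], isBurge_nil, ?_⟩
      refine (isBurge_nil.std).ext ht ?_ ?_ <;> simp only [mem_burgeRows, h0] <;> simp [labels]
    · obtain ⟨j, hj, hmax⟩ : ∃ j ∈ t.flatten, ∀ a ∈ t.flatten, a ≤ j := by
        obtain ⟨j, hj⟩ := List.exists_mem_of_ne_nil _ h0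
        have hne : t.flatten.toFinset.Nonempty := ⟨j, by rwa [List.mem_toFinset]⟩
        exact ⟨t.flatten.toFinset.max' hne, List.mem_toFinset.1 (Finset.max'_mem _ hne),
          fun a ha => Finset.le_max' _ _ (List.mem_toFinset.2 ha)⟩
      have hlen := ht.len_restrict hj hmax
      obtain ⟨m, hm, hlt⟩ := eq_succ_of_paired hp hlen fun s => (ht.restrict j).len_le (by omega)
      -- The largest entry `j` becomes the last upper entry. The lower entry `i` is what reverse
      -- bumping expels, starting from the box just above that of `j`; the rest `u` has paired rows
      -- again.
      obtain ⟨i, u, hu, hiu, hci, hend⟩ := exists_columnInsert (ht.restrict j) hlt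
      have hmemu : ∀ a, a = i ∨ a ∈ u.flatten ↔ a ∈ t.flatten ∧ a < j := by
        intro a
        rw [← mem_restrict, ← hci, mem_columnInsert]
      have hpu : IsPaired u := by
        intro s
        have h1 := hp s
        rw [hlen, hlen, ← hci, len_columnInsert, len_columnInsert, hend, hm] at h1
        split_ifs at h1 <;> omega
      have hNu : u.flatten.length < N := by
        have h1 : (i :: u.flatten).Subperm t.flatten := by
          refine List.subperm_of_subset (List.nodup_cons.2 ⟨hiu, hu.2.2⟩) ?_
          intro a ha
          exact ((hmemu a).1 (List.mem_cons.1 ha)).1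
        have := h1.length_le
        rw [List.length_cons] at this
        omega
      obtain ⟨L, hL, rfl⟩ := ih _ hNu hu hpu rfl
      simp only [mem_burgeRows] at hmemu hiu
      have hlt : ∀ a ∈ labels L, a < j := fun a ha => ((hmemu a).1 (Or.inr ha)).2
      have hB : IsBurge (L ++ [(j, i)]) :=
        isBurge_concat hL ((hmemu i).1 (Or.inl rfl)).2 hlt hiu
      refine ⟨_, hB, hB.std.ext ht ?_ ?_⟩
      · intro a
        rw [mem_burgeRows, mem_labels_concat, hmemu]
        constructor
        · rintro (rfl | h)
          · exact hj
          · exact h.1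
        · intro ha
          rcases eq_or_lt_of_le (hmax a ha) with h1 | h1
          · exact Or.inl h1
          · exact Or.inr ⟨ha, h1⟩
      · intro a ha
        rw [mem_burgeRows, mem_labels_concat] at ha
        obtain ⟨h1, h2, h3⟩ := hB.burgeRows_concat hlt
        rcases ha with rfl | ha
        · rw [h3, hm, hend]
        · rw [h1 a (List.mem_cons.2 ha), hci]
          have := (hmemu a).1 ha
          exact ht.colIdx_restrict this.1 this.2

theorem IsBurge.lt_of_concat {L : List (ℕ × ℕ)} {e : ℕ × ℕ} (h : IsBurge (L ++ [e])) :
    ∀ a ∈ labels L, a < e.1 := by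
  have h1 := h.1
  rw [List.map_append, List.pairwise_append] at h1
  intro a ha
  obtain ⟨e', he', h2⟩ := mem_labels.1 ha
  have h3 := h1.2.2 e'.1 (List.mem_map_of_mem he') e.1 (by simp)
  have h4 := h.2.2 e' (List.mem_append_left _ he')
  omega

/-- A two-line array is determined by its even tableau. -/
theorem burgeRows_injective {L L' : List (ℕ × ℕ)} (h : IsBurge L) (h' : IsBurge L')
    (he : burgeRows L = burgeRows L') : L = L' := by
  have hlab : ∀ {L L' : List (ℕ × ℕ)}, burgeRows L = burgeRows L' →
      ∀ a, a ∈ labels L ↔ a ∈ labels L' := by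
    intro L L' he a
    rw [← mem_burgeRows, he, mem_burgeRows]
  induction L using List.reverseRecOn generalizing L' with
  | nil =>
    cases L' with
    | nil => rfl
    | cons e L' =>
      have := (hlab he e.1).2 (by simp [labels])
      simp [labels] at this
  | append_singleton L e ih =>
    rcases List.eq_nil_or_concat' L' with rfl | ⟨L', e', rfl⟩
    · have := (hlab he e.1).1 (by simp [labels])
      simp [labels] at this
    · have hl := hlab he
      have m1 := h.lt_of_concat
      have m2 := h'.lt_of_concat
      have l1 := h.2.2 e (by simp)
      have l2 := h'.2.2 e' (by simp)
      have hj : e.1 = e'.1 := by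
        have k1 := (hl e.1).1 (mem_labels_concat.2 (Or.inl rfl))
        have k2 := (hl e'.1).2 (mem_labels_concat.2 (Or.inl rfl))
        rw [mem_labels_concat] at k1 k2
        have k3 : e.1 ≤ e'.1 := by
          rcases k1 with k | k | k
          · omega
          · omega
          · exact (m2 _ k).le
        have k4 : e'.1 ≤ e.1 := by
          rcases k2 with k | k | k
          · omega
          · omega
          · exact (m1 _ k).le
        omega
      obtain ⟨a1, a2, a3⟩ := h.burgeRows_concat m1
      obtain ⟨b1, b2, b3⟩ := h'.burgeRows_concat m2
      have n1 := (labels_concat L e).nodup_iff.1 h.2.1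
      have n2 := (labels_concat L' e').nodup_iff.1 h'.2.1
      rw [List.nodup_cons, List.nodup_cons] at n1 n2
      have hmem : ∀ a, a ∈ e.2 :: labels L ↔ a ∈ e'.2 :: labels L' := by
        intro a
        have k := hl a
        rw [(labels_concat L e).mem_iff, (labels_concat L' e').mem_iff, List.mem_cons,
          List.mem_cons (b := e'.1), hj] at k
        have k1 : a = e'.1 → a ∉ e.2 :: labels L := by rw [← hj]; rintro rfl; exact n1.1
        have k2 : a = e'.1 → a ∉ e'.2 :: labels L' := by rintro rfl; exact n2.1
        tauto
      have hs1 : e.2 ∉ (burgeRows L).flatten := by rw [mem_burgeRows]; exact n1.2.1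
      have hs2 : e'.2 ∉ (burgeRows L').flatten := by rw [mem_burgeRows]; exact n2.2.1
      -- Without the common largest label both tableaux are results of an insertion. The row of that
      -- label reveals where the insertion ended, so the insertion can be undone in only one way.
      have hci : columnInsert e.2 (burgeRows L) = columnInsert e'.2 (burgeRows L') := by
        have mem : ∀ (L : List (ℕ × ℕ)) (x a : ℕ), a ∈ (columnInsert x (burgeRows L)).flatten ↔
            a ∈ x :: labels L := by
          intro L x a
          rw [mem_columnInsert, mem_burgeRows, List.mem_cons]
        refine (h.of_prefix.std.columnInsert hs1).ext (h'.of_prefix.std.columnInsert hs2) ?_ ?_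
        · intro a
          rw [mem, mem, hmem]
        · intro a ha
          rw [mem] at ha
          rw [← a1 a ha, he, b1 a ((hmem a).1 ha)]
      have hend : endIdx e.2 (burgeRows L) = endIdx e'.2 (burgeRows L') := by
        rw [hj, he, b3] at a3
        omega
      obtain ⟨c1, c2⟩ := columnInsert_injective h.of_prefix.std h'.of_prefix.std hs1 hs2 hci hend
      rw [ih h.of_prefix h'.of_prefix c2, Prod.ext hj c1]

/-! ### The rows of a tableau given by its columns -/

/-- The columns are nonempty and of weakly decreasing length. -/
def Reg (t : List (List ℕ)) : Prop :=
  (∀ col ∈ t, col ≠ []) ∧ t.Pairwise fun col d => d.length ≤ col.length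

theorem reg_nil : Reg [] := by simp [Reg]

theorem reg_cons {col : List ℕ} {t : List (List ℕ)} :
    Reg (col :: t) ↔ col ≠ [] ∧ (∀ d ∈ t, d.length ≤ col.length) ∧ Reg t := by
  simp only [Reg, List.mem_cons, forall_eq_or_imp, List.pairwise_cons]
  tauto

@[simp] theorem row_nil (i : ℕ) : row [] i = [] := rfl

theorem row_cons_of_lt {col : List ℕ} {t : List (List ℕ)} {i : ℕ} (h : i < col.length) :
    row (col :: t) i = col[i] :: row t i := by
  simp [row, h]

theorem row_cons_of_le {col : List ℕ} {t : List (List ℕ)} {i : ℕ} (h : col.length ≤ i) :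
    row (col :: t) i = row t i := by
  simp [row, h]

theorem row_eq_nil {t : List (List ℕ)} {i : ℕ} (h : ∀ d ∈ t, d.length ≤ i) : row t i = [] := by
  rw [row, List.filterMap_eq_nil_iff]
  intro d hd
  simpa using h d hd

theorem Reg.row_eq_nil {col : List ℕ} {t : List (List ℕ)} (h : Reg (col :: t)) {i : ℕ}
    (hi : col.length ≤ i) : row (col :: t) i = [] ∧ row t i = [] := by
  have h1 : row t i = [] :=
    SymplecticBranching.row_eq_nil fun d hd => ((reg_cons.1 h).2.1 d hd).trans hi
  exact ⟨by rw [row_cons_of_le hi, h1], h1⟩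

theorem Reg.getElem?_row {t : List (List ℕ)} (h : Reg t) (i j : ℕ) :
    (row t i)[j]? = (t.getD j [])[i]? := by
  induction t generalizing j with
  | nil => simp
  | cons d t ih =>
    have h3 := (reg_cons.1 h).2.2
    by_cases hi : i < d.length
    · rw [row_cons_of_lt hi]
      cases j with
      | zero => simp [hi]
      | succ j => simpa using ih h3 j
    · have h1 := h.row_eq_nil (i := i) (by omega)
      rw [h1.1]
      cases j with
      | zero => simp; omega
      | succ j =>
        rw [List.getD_cons_succ, ← ih h3 j, h1.2]
        simp

theorem Reg.ext {t u : List (List ℕ)} (ht : Reg t) (hu : Reg u) (h : ∀ i, row t i = row u i) :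
    t = u := by
  refine eq_of_getD ht.1 hu.1 fun j => List.ext_getElem? fun i => ?_
  rw [← ht.getElem?_row, ← hu.getElem?_row, h]

theorem mem_addBox {x i : ℕ} {t : List (List ℕ)} {d : List ℕ} (h : d ∈ addBox x i t) :
    d ∈ t ∨ (d ≠ [] ∧ d.length ≤ i + 1) := by
  induction t with
  | nil =>
    right
    rw [addBox, List.mem_singleton] at h
    simp [h]
  | cons col t ih =>
    rw [addBox] at h
    split_ifs at h with hc
    · rcases List.mem_cons.1 h with rfl | h
      · right; simp [hc]
      · left; simp [h]
    · rcases List.mem_cons.1 h with rfl | h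
      · left; simp
      · rcases ih h with h | h
        · left; simp [h]
        · exact Or.inr h

/-- The hypothesis says that row `i` can be extended. Therefore the first column of length at most
`i` has length exactly `i`, and the new entry really lies in row `i`. -/
theorem Reg.addBox {t : List (List ℕ)} (h : Reg t) {x i : ℕ}
    (hi : i = 0 ∨ (row t i).length < (row t (i - 1)).length) :
    Reg (addBox x i t) ∧
      ∀ k, row (addBox x i t) k = if k = i then row t i ++ [x] else row t k := by
  induction t with
  | nil =>
    simp only [row_nil, List.length_nil, lt_irrefl, or_false] at hi
    subst hi
    refine ⟨by simp [Reg, SymplecticBranching.addBox], fun k => ?_⟩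
    cases k <;> simp [SymplecticBranching.addBox, row]
  | cons col t ih =>
    obtain ⟨h1, h2, h3⟩ := reg_cons.1 h
    rw [SymplecticBranching.addBox]
    split_ifs with hc
    · have hci : col.length = i := by
        rcases hi with rfl | hi
        · exact absurd (List.length_eq_zero_iff.1 (by omega)) h1
        · by_contra hne
          rw [(h.row_eq_nil (show col.length ≤ i - 1 by omega)).1] at hi
          simp at hi
      refine ⟨reg_cons.2 ⟨by simp, fun d hd => by simpa using (h2 d hd).trans (by omega), h3⟩, ?_⟩
      intro k
      have hr := h.row_eq_nil hc
      rcases lt_trichotomy k i with hk | hk | hk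
      · rw [if_neg (by omega), row_cons_of_lt (col := col ++ [x]) (by simp; omega),
          row_cons_of_lt (show k < col.length by omega), List.getElem_append_left]
      · subst hk
        rw [if_pos rfl, row_cons_of_lt (col := col ++ [x]) (by simp; omega), hr.1, hr.2]
        simp [hci]
      · rw [if_neg (by omega), row_cons_of_le (col := col ++ [x]) (by simp; omega),
          row_cons_of_le (col := col) (by omega)]
    · have hi' : i = 0 ∨ (row t i).length < (row t (i - 1)).length := by
        refine hi.imp_right fun hi => ?_
        rw [row_cons_of_lt (by omega), row_cons_of_lt (by omega)] at hi
        simpa using hi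
      obtain ⟨g1, g2⟩ := ih h3 hi'
      refine ⟨reg_cons.2 ⟨h1, fun d hd => ?_, g1⟩, fun k => ?_⟩
      · rcases mem_addBox hd with hd | hd
        · exact h2 d hd
        · omega
      · by_cases hk : k < col.length
        · rw [row_cons_of_lt hk, row_cons_of_lt hk, row_cons_of_lt (show i < col.length by omega), g2]
          split_ifs with hki
          · subst hki; rfl
          · rfl
        · rw [row_cons_of_le (by omega), g2, if_neg (by omega), if_neg (by omega),
            row_cons_of_le (col := col) (by omega)]

theorem length_le_of_mem_removeBox {i : ℕ} {t : List (List ℕ)} {d : List ℕ}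
    (h : d ∈ removeBox i t) : d ≠ [] ∧ (∃ e ∈ t, d.length ≤ e.length) ∨ ∃ e ∈ t, d.length = e.length := by
  induction t with
  | nil => simp [removeBox] at h
  | cons col t ih =>
    rw [removeBox] at h
    split at h
    · rcases List.mem_cons.1 h with rfl | h
      · right; exact ⟨col, by simp, by simp⟩
      · rcases ih h with ⟨h0, e, h1, h2⟩ | ⟨e, h1, h2⟩
        · left; exact ⟨h0, e, by simp [h1], h2⟩
        · right; exact ⟨e, by simp [h1], h2⟩
    · split_ifs at h with hc
      · right; exact ⟨d, by simp [h], rfl⟩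
      · rcases List.mem_cons.1 h with rfl | h
        · left; exact ⟨hc, col, by simp, by rw [List.length_eraseIdx]; split_ifs <;> omega⟩
        · right; exact ⟨d, by simp [h], rfl⟩

/-- Shifting row `i` to the left means that each column takes over the entry of the next one. Since
the row below is shorter, the last column that meets row `i` ends there, and shortening it keeps a
valid shape. -/
theorem Reg.removeBox {t : List (List ℕ)} (h : Reg t) {i : ℕ}
    (hi : (row t (i + 1)).length < (row t i).length) :
    Reg (removeBox i t) ∧
      ∀ k, row (removeBox i t) k = if k = i then (row t i).tail else row t k := by
  induction t with
  | nil => simp at hi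
  | cons col t ih =>
    obtain ⟨h1, h2, h3⟩ := reg_cons.1 h
    have hic : i < col.length := by
      by_contra hne
      rw [(h.row_eq_nil (show col.length ≤ i by omega)).1] at hi
      simp at hi
    rw [SymplecticBranching.removeBox]
    split
    · rename_i y hy
      obtain ⟨d, t, rfl⟩ : ∃ d t', t = d :: t' := by
        cases t with
        | nil => simp at hy
        | cons d t => exact ⟨d, t, rfl⟩
      simp only [List.headD_cons] at hy
      obtain ⟨hid, hy'⟩ := List.getElem?_eq_some_iff.1 hy
      have hi' : (row (d :: t) (i + 1)).length < (row (d :: t) i).length := by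
        by_cases hc1 : i + 1 < col.length
        · rw [row_cons_of_lt hc1, row_cons_of_lt hic] at hi
          simpa using hi
        · rw [(h3.row_eq_nil ((h2 d (by simp)).trans (by omega))).1, row_cons_of_lt hid]
          simp
      obtain ⟨g1, g2⟩ := ih h3 hi'
      refine ⟨reg_cons.2 ⟨by simpa using h1, fun e he => ?_, g1⟩, fun k => ?_⟩
      · rw [List.length_set]
        rcases length_le_of_mem_removeBox he with ⟨-, e', h4, h5⟩ | ⟨e', h4, h5⟩
        · exact h5.trans (h2 e' h4)
        · exact h5.le.trans (h2 e' h4)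
      · by_cases hk : k < col.length
        · rw [row_cons_of_lt (by simpa using hk), g2]
          split_ifs with hki
          · subst hki
            rw [row_cons_of_lt hk, row_cons_of_lt hid]
            simp [hy']
          · rw [row_cons_of_lt hk, List.getElem_set_ne (Ne.symm hki)]
        · rw [row_cons_of_le (by simp; omega), g2, if_neg (by omega), if_neg (by omega),
            row_cons_of_le (col := col) (by omega)]
    · rename_i hy
      have ht : ∀ d ∈ t, d.length ≤ i := by
        cases t with
        | nil => simp
        | cons d t =>
          simp only [List.headD_cons, List.getElem?_eq_none_iff] at hy
          intro e he
          rcases List.mem_cons.1 he with rfl | he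
          · exact hy
          · exact ((reg_cons.1 h3).2.1 e he).trans hy
      have hti := SymplecticBranching.row_eq_nil ht
      have hti1 := SymplecticBranching.row_eq_nil (i := i + 1) fun d hd => (ht d hd).trans (by omega)
      have hc1 : col.length = i + 1 := by
        by_contra hne
        rw [row_cons_of_lt (show i + 1 < col.length by omega), row_cons_of_lt hic, hti, hti1] at hi
        simp at hi
      have hrow : ∀ k, row (col.eraseIdx i :: t) k =
          if k = i then (row (col :: t) i).tail else row (col :: t) k := by
        intro k
        have hel : (col.eraseIdx i).length = i := by rw [List.length_eraseIdx, if_pos hic]; omega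
        rcases lt_trichotomy k i with hk | hk | hk
        · rw [if_neg (by omega), row_cons_of_lt (by omega), row_cons_of_lt (by omega),
            List.getElem_eraseIdx_of_lt _ hk]
        · subst hk
          rw [if_pos rfl, row_cons_of_le (by omega), row_cons_of_lt hic, hti]
          rfl
        · rw [if_neg (by omega), row_cons_of_le (by omega), row_cons_of_le (by omega)]
      split_ifs with hc
      · refine ⟨h3, fun k => ?_⟩
        rw [← hrow k, hc, row_cons_of_le (by simp)]
      · refine ⟨reg_cons.2 ⟨hc, fun d hd => ?_, h3⟩, hrow⟩
        rw [List.length_eraseIdx, if_pos hic]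
        have := ht d hd
        omega

/-! ### Columns of a tableau controlled through its rows -/

/-- Each entry of `v` is larger than the entry of `u` with the same index. -/
def Below (u v : List ℕ) : Prop :=
  ∀ k b : ℕ, v[k]? = some b → ∃ a, u[k]? = some a ∧ a < b

/-- An injection that lowers every entry suffices: the first `k + 1` entries of `v` go to distinct
entries of `u`, all smaller than the entry of `v` with index `k`. -/
theorem below_of_injOn {u v : List ℕ} (hu : u.Pairwise (· < ·)) (hv : v.Pairwise (· < ·))
    (f : ℕ → ℕ) (hf : ∀ a ∈ v, f a ∈ u ∧ f a < a) (hinj : ∀ a ∈ v, ∀ b ∈ v, f a = f b → a = b) :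
    Below u v := by
  have hdom : Dom u v := by
    intro b
    rw [List.countP_eq_length_filter, List.countP_eq_length_filter, ← List.length_map f]
    refine List.Subperm.length_le (List.subperm_of_subset ?_ ?_)
    · refine List.Nodup.map_on ?_ ((nodup_of_lt hv).filter _)
      intro a ha b hb
      exact hinj a (List.mem_of_mem_filter ha) b (List.mem_of_mem_filter hb)
    · intro a ha
      obtain ⟨col, hc, rfl⟩ := List.mem_map.1 ha
      simp only [List.mem_filter, decide_eq_true_eq] at hc ⊢
      have := hf col hc.1
      exact ⟨this.1, by omega⟩
  intro k b hb
  obtain ⟨hk, hb'⟩ := List.getElem?_eq_some_iff.1 hb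
  obtain ⟨a, ha, hab⟩ := hdom.getElem? hu hv hb
  refine ⟨a, ha, lt_of_le_of_ne hab ?_⟩
  rintro rfl
  obtain ⟨hk', ha'⟩ := List.getElem?_eq_some_iff.1 ha
  have h1 : ((v.take (k + 1)).map f).Subperm (u.take k) := by
    refine List.subperm_of_subset ?_ ?_
    · refine List.Nodup.map_on ?_ ((nodup_of_lt hv).sublist (List.take_sublist _ _))
      intro a ha b hb
      exact hinj a (List.mem_of_mem_take ha) b (List.mem_of_mem_take hb)
    · intro x hx
      obtain ⟨y, hy, rfl⟩ := List.mem_map.1 hx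
      obtain ⟨j, hj, rfl⟩ := List.mem_take_iff_getElem.1 hy
      have h2 := hf _ (List.getElem_mem (l := v) (n := j) (by omega))
      obtain ⟨m, hm, hm'⟩ := List.mem_iff_getElem.1 h2.1
      have h3 : v[j] ≤ a := by
        rcases Nat.lt_or_ge j k with h | h
        · have := List.pairwise_iff_getElem.1 hv j k (by omega) hk h
          omega
        · obtain rfl : j = k := by omega
          omega
      have h4 : m < k := by
        by_contra hmk
        rcases Nat.eq_or_lt_of_le (Nat.le_of_not_lt hmk) with h | h
        · subst h; omega
        · have := List.pairwise_iff_getElem.1 hu k m hk' hm h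
          omega
      exact List.mem_take_iff_getElem.2 ⟨m, by omega, hm'⟩
  have := h1.length_le
  simp at this
  omega

theorem Reg.isStandard {t : List (List ℕ)} (h : Reg t) (h1 : ∀ i, (row t i).Pairwise (· < ·))
    (h2 : ∀ i, Below (row t i) (row t (i + 1))) : IsStandard t := by
  refine ⟨h.1, h.2, fun col hc => ?_, h1⟩
  obtain ⟨j, hj, rfl⟩ := List.mem_iff_getElem.1 hc
  rw [← List.isChain_iff_pairwise, List.isChain_iff_getElem]
  intro i hi
  have e := h.getElem?_row (i + 1) j
  have e' := h.getElem?_row i j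
  rw [List.getD_eq_getElem _ _ hj] at e e'
  rw [List.getElem?_eq_getElem hi] at e
  rw [List.getElem?_eq_getElem (l := t[j]) (i := i) (by omega)] at e'
  obtain ⟨a, ha, hab⟩ := h2 i j _ e
  rw [e'] at ha
  obtain rfl := Option.some.inj ha
  exact hab

/-- The effect of `x → t` on the rows of `t`, when each bumped entry stays in its row. -/
theorem Reg.columnInsert {t : List (List ℕ)} (h : Reg t) (hc : ∀ col ∈ t, col.Pairwise (· < ·))
    {x i : ℕ} (hx : (x :: row t i).Pairwise (· < ·))
    (hi : i = 0 ∨ Below (row t (i - 1)) (x :: row t i)) :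
    Reg (columnInsert x t) ∧
      ∀ k, row (columnInsert x t) k = if k = i then x :: row t i else row t k := by
  induction t generalizing x with
  | nil =>
    obtain rfl : i = 0 := by
      rcases hi with hi | hi
      · exact hi
      · obtain ⟨a, ha, -⟩ := hi 0 x (by simp)
        simp at ha
    refine ⟨by simp [Reg, SymplecticBranching.columnInsert], fun k => ?_⟩
    cases k <;> simp [SymplecticBranching.columnInsert, row]
  | cons col t ih =>
    obtain ⟨h1, h2, h3⟩ := reg_cons.1 h
    have hcs := hc col (by simp)
    have habove : ∀ (k : ℕ) (hk : k < col.length), k < i → col[k] < x := by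
      intro k hk hki
      rcases hi with hi | hi
      · omega
      · obtain ⟨a, ha, hax⟩ := hi 0 x (by simp)
        have hi1 : i - 1 < col.length := by
          by_contra hne
          rw [(h.row_eq_nil (show col.length ≤ i - 1 by omega)).1] at ha
          simp at ha
        rw [row_cons_of_lt hi1] at ha
        simp only [List.getElem?_cons_zero, Option.some.injEq] at ha
        rcases Nat.lt_or_ge k (i - 1) with h4 | h4
        · have := List.pairwise_iff_getElem.1 hcs k (i - 1) hk hi1 h4
          omega
        · obtain rfl : k = i - 1 := by omega
          omega
    by_cases hic : i < col.length
    · have hsplit : col = col.take i ++ col[i] :: col.drop (i + 1) := by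
        rw [← List.drop_eq_getElem_cons hic, List.take_append_drop]
      have hl : ∀ a ∈ col.take i, a < x := by
        intro a ha
        obtain ⟨k, hk, rfl⟩ := List.mem_take_iff_getElem.1 ha
        exact habove k (by omega) (by omega)
      rw [row_cons_of_lt hic, List.pairwise_cons] at hx
      have hxy : x < col[i] := hx.1 _ (by simp)
      have hcol := columnInsert_of_split (t := t) (r := col.drop (i + 1)) hl hxy
      rw [← hsplit] at hcol
      have hset : col.take i ++ x :: col.drop (i + 1) = col.set i x := by
        rw [List.set_eq_take_append_cons_drop, if_pos hic]
      rw [hset] at hcol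
      -- The bumped entry is the one of row `i` in this column. Deleting the first column shifts
      -- both rows by one, so the hypothesis for `x` passes to the bumped entry.
      have hi' : i = 0 ∨ Below (row t (i - 1)) (col[i] :: row t i) := by
        refine hi.imp_right fun hi => ?_
        intro k b hb
        obtain ⟨a, ha, hab⟩ := hi (k + 1) b (by rw [row_cons_of_lt hic]; simpa using hb)
        rw [row_cons_of_lt (by omega)] at ha
        exact ⟨a, by simpa using ha, hab⟩
      obtain ⟨g1, g2⟩ := ih h3 (fun d hd => hc d (by simp [hd])) hx.2 hi'
      rw [hcol]
      have hlen : ∀ d ∈ SymplecticBranching.columnInsert col[i] t, d.length ≤ col.length := by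
        intro d hd
        obtain ⟨j, hj, rfl⟩ := List.mem_iff_getElem.1 hd
        by_contra hlt
        have e := g1.getElem?_row (col.length) j
        rw [List.getD_eq_getElem _ _ hj, g2, if_neg (by omega), (h.row_eq_nil le_rfl).2] at e
        have := List.getElem?_eq_none_iff.1 e.symm
        omega
      refine ⟨reg_cons.2 ⟨by simpa using h1, by simpa using hlen, g1⟩, fun k => ?_⟩
      by_cases hk : k < col.length
      · rw [row_cons_of_lt (by simpa using hk), g2]
        split_ifs with hki
        · subst hki
          rw [row_cons_of_lt hk]
          simp
        · rw [row_cons_of_lt hk, List.getElem_set_ne (Ne.symm hki)]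
      · rw [row_cons_of_le (by simp; omega), g2, if_neg (by omega), if_neg (by omega),
          row_cons_of_le (col := col) (by omega)]
    · have hr := h.row_eq_nil (show col.length ≤ i by omega)
      have hci : col.length = i := by
        rcases hi with rfl | hi
        · exact absurd (List.length_eq_zero_iff.1 (by omega)) h1
        · by_contra hne
          obtain ⟨a, ha, -⟩ := hi 0 x (by simp)
          rw [(h.row_eq_nil (show col.length ≤ i - 1 by omega)).1] at ha
          simp at ha
      have hl : ∀ a ∈ col, a < x := by
        intro a ha
        obtain ⟨k, hk, rfl⟩ := List.mem_iff_getElem.1 ha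
        exact habove k hk (by omega)
      rw [columnInsert_of_none hl]
      refine ⟨reg_cons.2 ⟨by simp, fun d hd => by simpa using (h2 d hd).trans (by omega), h3⟩, ?_⟩
      intro k
      rcases lt_trichotomy k i with hk | hk | hk
      · rw [if_neg (by omega), row_cons_of_lt (col := col ++ [x]) (by simp; omega),
          row_cons_of_lt (show k < col.length by omega), List.getElem_append_left]
      · subst hk
        rw [if_pos rfl, row_cons_of_lt (col := col ++ [x]) (by simp; omega), hr.1, hr.2]
        simp [hci]
      · rw [if_neg (by omega), row_cons_of_le (col := col ++ [x]) (by simp; omega),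
          row_cons_of_le (col := col) (by omega)]

/-! ### The labels of the cells of a Young diagram -/

/-- The cells of a Young diagram in the order in which they are read. -/
def cells (lam : YoungDiagram) : List (ℕ × ℕ) :=
  (List.range (lam.rowLen 0)).reverse.flatMap fun j =>
    (List.range (lam.colLen j)).map fun i => (i, j)

theorem word_eq {lam : YoungDiagram} (T : SemistandardYoungTableau lam) :
    word T = (cells lam).map fun p => T p.1 p.2 := by
  simp [word, cells, List.map_flatMap, Function.comp_def]

theorem mem_cells {lam : YoungDiagram} {p : ℕ × ℕ} : p ∈ cells lam ↔ p ∈ lam := by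
  obtain ⟨i, j⟩ := p
  simp only [cells, List.mem_flatMap, List.mem_reverse, List.mem_range, List.mem_map,
    Prod.mk.injEq]
  constructor
  · rintro ⟨j', -, i', h, rfl, rfl⟩
    exact YoungDiagram.mem_iff_lt_colLen.2 h
  · intro h
    refine ⟨j, ?_, i, YoungDiagram.mem_iff_lt_colLen.1 h, rfl, rfl⟩
    exact YoungDiagram.mem_iff_lt_rowLen.1 (lam.up_left_mem (Nat.zero_le i) le_rfl h)

/-- The order in which the cells are read. -/
def ReadBefore (p q : ℕ × ℕ) : Prop := q.2 < p.2 ∨ p.2 = q.2 ∧ p.1 < q.1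

theorem cells_pairwise (lam : YoungDiagram) : (cells lam).Pairwise ReadBefore := by
  rw [cells, List.pairwise_flatMap]
  constructor
  · intro j _
    rw [List.pairwise_map]
    exact List.pairwise_lt_range.imp fun h => Or.inr ⟨rfl, h⟩
  · rw [List.pairwise_reverse]
    refine List.pairwise_lt_range.imp ?_
    intro j j' hj p hp q hq
    obtain ⟨i, -, rfl⟩ := List.mem_map.1 hp
    obtain ⟨i', -, rfl⟩ := List.mem_map.1 hq
    exact Or.inl hj

theorem cells_nodup (lam : YoungDiagram) : (cells lam).Nodup :=
  (cells_pairwise lam).imp fun h e => by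
    subst e
    simp [ReadBefore] at h

/-- The number of the step at which a cell is read. -/
def lab (lam : YoungDiagram) (p : ℕ × ℕ) : ℕ := (cells lam).idxOf p + 1

/-- The cell that is read at a given step. -/
def cellAt (lam : YoungDiagram) (a : ℕ) : ℕ × ℕ := (cells lam).getD (a - 1) (0, 0)

section
variable {lam : YoungDiagram} {p q : ℕ × ℕ}

theorem lab_pos : 0 < lab lam p := Nat.succ_pos _

theorem lab_le (hp : p ∈ lam) : lab lam p ≤ (cells lam).length :=
  List.idxOf_lt_length_of_mem (mem_cells.2 hp)

theorem cellAt_lab (hp : p ∈ lam) : cellAt lam (lab lam p) = p := by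
  have h := List.idxOf_lt_length_of_mem (mem_cells.2 hp)
  rw [cellAt, lab, Nat.add_sub_cancel, List.getD_eq_getElem _ _ h]
  exact List.getElem_idxOf h

theorem lab_cellAt {a : ℕ} (h : 1 ≤ a) (h' : a ≤ (cells lam).length) :
    lab lam (cellAt lam a) = a ∧ cellAt lam a ∈ lam := by
  rw [cellAt, lab, List.getD_eq_getElem _ _ (show a - 1 < _ by omega)]
  refine ⟨?_, mem_cells.1 (List.getElem_mem _)⟩
  rw [(cells_nodup lam).idxOf_getElem]
  omega

theorem lab_inj (hp : p ∈ lam) (hq : q ∈ lam) (h : lab lam p = lab lam q) : p = q := by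
  rw [← cellAt_lab hp, h, cellAt_lab hq]

theorem readBefore_of_lt (hp : p ∈ lam) (hq : q ∈ lam) (h : lab lam p < lab lam q) :
    ReadBefore p q := by
  have h1 := List.idxOf_lt_length_of_mem (mem_cells.2 hp)
  have h2 := List.idxOf_lt_length_of_mem (mem_cells.2 hq)
  have := List.pairwise_iff_getElem.1 (cells_pairwise lam) _ _ h1 h2 (Nat.lt_of_succ_lt_succ h)
  rwa [List.getElem_idxOf, List.getElem_idxOf] at this

theorem lab_lt_iff (hp : p ∈ lam) (hq : q ∈ lam) : lab lam p < lab lam q ↔ ReadBefore p q := by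
  refine ⟨readBefore_of_lt hp hq, fun h => ?_⟩
  rcases lt_trichotomy (lab lam p) (lab lam q) with h1 | h1 | h1
  · exact h1
  · have := lab_inj hp hq h1
    subst this
    simp [ReadBefore] at h
  · have := readBefore_of_lt hq hp h1
    simp only [ReadBefore] at *
    omega

/-- No cell can be read between two vertically adjacent ones. Through this fact `a ↦ a - 1` is the
step to the cell above, and Knuth moves, which never exchange `a` with `a + 1`, respect columns. -/
theorem lab_succ {r k : ℕ} (h : (r + 1, k) ∈ lam) : lab lam (r + 1, k) = lab lam (r, k) + 1 := by
  have h' : (r, k) ∈ lam := lam.up_left_mem (Nat.le_succ r) le_rfl h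
  have h1 : lab lam (r, k) < lab lam (r + 1, k) := (lab_lt_iff h' h).2 (Or.inr ⟨rfl, by simp⟩)
  by_contra hne
  have h2 := lab_le h
  obtain ⟨h3, h4⟩ := lab_cellAt (lam := lam) (a := lab lam (r, k) + 1) (by omega) (by omega)
  have h5 := readBefore_of_lt h' h4 (by omega)
  have h6 := readBefore_of_lt h4 h (by omega)
  simp only [ReadBefore] at h5 h6
  omega

/-- The rows of `t` consist of the labels of the cells of `U`. -/
def IsTab (lam : YoungDiagram) (U : Set (ℕ × ℕ)) (t : List (List ℕ)) : Prop :=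
  Reg t ∧ ∀ i, (row t i).Pairwise (· < ·) ∧ ∀ a, a ∈ row t i ↔ ∃ k, (i, k) ∈ U ∧ lab lam (i, k) = a

/-- Each cell above a cell of `U` belongs to `U`. -/
def UpClosed (U : Set (ℕ × ℕ)) : Prop := ∀ i k, (i + 1, k) ∈ U → (i, k) ∈ U

theorem IsTab.ext {U : Set (ℕ × ℕ)} {t u : List (List ℕ)} (ht : IsTab lam U t)
    (hu : IsTab lam U u) : t = u :=
  ht.1.ext hu.1 fun i => eq_of_pairwise_lt (ht.2 i).1 (hu.2 i).1 fun a => by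
    rw [(ht.2 i).2, (hu.2 i).2]

theorem below_of_labels {u v : List ℕ} {i : ℕ} (hu : u.Pairwise (· < ·))
    (hv : v.Pairwise (· < ·))
    (h : ∀ a ∈ v, ∃ k, (i + 1, k) ∈ lam ∧ lab lam (i + 1, k) = a ∧ lab lam (i, k) ∈ u) :
    Below u v := by
  refine below_of_injOn hu hv (fun a => a - 1) ?_ ?_
  · intro a ha
    obtain ⟨k, h1, rfl, h2⟩ := h a ha
    have := lab_succ h1
    rw [this, Nat.add_sub_cancel]
    exact ⟨h2, by omega⟩
  · intro a ha b hb hab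
    obtain ⟨k, h1, rfl, h2⟩ := h a ha
    obtain ⟨k', h1', rfl, h2'⟩ := h b hb
    have := lab_succ h1
    have := lab_succ h1'
    omega

theorem IsTab.below {U : Set (ℕ × ℕ)} {t : List (List ℕ)} (ht : IsTab lam U t)
    (hU : ∀ p ∈ U, p ∈ lam) (hU' : UpClosed U) (i : ℕ) : Below (row t i) (row t (i + 1)) := by
  refine below_of_labels (lam := lam) (i := i) (ht.2 i).1 (ht.2 (i + 1)).1 ?_
  intro a ha
  obtain ⟨k, h1, h2⟩ := ((ht.2 (i + 1)).2 a).1 ha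
  exact ⟨k, hU _ h1, h2, ((ht.2 i).2 _).2 ⟨k, hU' i k h1, rfl⟩⟩

theorem IsTab.isStandard {U : Set (ℕ × ℕ)} {t : List (List ℕ)} (ht : IsTab lam U t)
    (hU : ∀ p ∈ U, p ∈ lam) (hU' : UpClosed U) : IsStandard t :=
  ht.1.isStandard (fun i => (ht.2 i).1) (ht.below hU hU')

theorem isTab_nil : IsTab lam ∅ [] := by
  refine ⟨reg_nil, fun i => ?_⟩
  simp

theorem IsTab.congr {U U' : Set (ℕ × ℕ)} {t : List (List ℕ)} (ht : IsTab lam U t)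
    (h : ∀ p, p ∈ U ↔ p ∈ U') : IsTab lam U' t := by
  rwa [← Set.ext h]

/-- The new cell is to the right of the cells of `U` in its row, so it is read earlier and its label
is smaller than theirs. The label enters at the front of the row; each displaced entry stays in that
row, since the cells above are present and have labels one smaller. -/
theorem IsTab.columnInsert {U : Set (ℕ × ℕ)} {t : List (List ℕ)} (ht : IsTab lam U t)
    (hU : ∀ p ∈ U, p ∈ lam) (hU' : UpClosed U) (hp : p ∈ lam)
    (h1 : ∀ k, (p.1, k) ∈ U → k < p.2) (h2 : ∀ i, p.1 = i + 1 → (i, p.2) ∈ U) :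
    IsTab lam (insert p U) (columnInsert (lab lam p) t) := by
  have hx : (lab lam p :: row t p.1).Pairwise (· < ·) := by
    refine List.pairwise_cons.2 ⟨fun a ha => ?_, (ht.2 p.1).1⟩
    obtain ⟨k, h3, rfl⟩ := ((ht.2 p.1).2 a).1 ha
    exact (lab_lt_iff hp (hU _ h3)).2 (Or.inl (h1 k h3))
  have hi : p.1 = 0 ∨ Below (row t (p.1 - 1)) (lab lam p :: row t p.1) := by
    obtain ⟨r, c⟩ := p
    cases r with
    | zero => exact Or.inl rfl
    | succ i =>
      right
      refine below_of_labels (lam := lam) (i := i) (ht.2 i).1 hx ?_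
      intro a ha
      rcases List.mem_cons.1 ha with rfl | ha
      · exact ⟨c, hp, rfl, ((ht.2 i).2 _).2 ⟨c, h2 i rfl, rfl⟩⟩
      · obtain ⟨k, h3, h4⟩ := ((ht.2 (i + 1)).2 a).1 ha
        exact ⟨k, hU _ h3, h4, ((ht.2 i).2 _).2 ⟨k, hU' i k h3, rfl⟩⟩
  obtain ⟨g1, g2⟩ := ht.1.columnInsert (ht.isStandard hU hU').2.2.1 hx hi
  refine ⟨g1, fun i => ?_⟩
  rw [g2]
  split_ifs with hip
  · subst hip
    refine ⟨hx, fun a => ?_⟩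
    rw [List.mem_cons, (ht.2 p.1).2]
    constructor
    · rintro (rfl | ⟨k, h3, h4⟩)
      · exact ⟨p.2, Set.mem_insert _ _, rfl⟩
      · exact ⟨k, Set.mem_insert_of_mem _ h3, h4⟩
    · rintro ⟨k, h3 | h3, h4⟩
      · left; rw [← h4, h3]
      · exact Or.inr ⟨k, h3, h4⟩
  · refine ⟨(ht.2 i).1, fun a => ?_⟩
    rw [(ht.2 i).2]
    refine exists_congr fun k => and_congr_left fun _ => ?_
    rw [Set.mem_insert_iff, or_iff_right]
    rintro rfl
    exact hip rfl

/-! ### Pictures and the tableaux obtained from them by bumping -/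

/-- The cells of `nu` are arranged in such a way that no cell is weakly above and to the left of a
later one, and `V` is the list of their labels. -/
def IsPicture (lam nu : YoungDiagram) (V : List ℕ) : Prop :=
  (∀ a, a ∈ V ↔ ∃ p ∈ nu, lab lam p = a) ∧
    V.Pairwise fun a b => ¬ cellAt lam a ≤ cellAt lam b

theorem IsPicture.nodup {nu : YoungDiagram} {V : List ℕ} (h : IsPicture lam nu V) : V.Nodup :=
  h.2.imp fun h e => h (by rw [e])

/-- Bumping starts at the right end of the word. The order condition makes every final segment of
`C` closed towards the north-west, so each new cell is a corner and `IsTab.columnInsert` applies. -/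
theorem isTab_bumpAll {C : List (ℕ × ℕ)} (hC : C.Pairwise fun p q => ¬ p ≤ q)
    (hlam : ∀ p ∈ C, p ∈ lam) (hlow : ∀ p ∈ C, ∀ q, q ≤ p → q ∈ C) :
    IsTab lam {p | p ∈ C} (bumpAll (C.map (lab lam)) []) := by
  induction C with
  | nil => exact isTab_nil.congr (by simp)
  | cons p C ih =>
    rw [List.pairwise_cons] at hC
    have hlow' : ∀ q ∈ C, ∀ r, r ≤ q → r ∈ C := by
      intro q hq r hr
      rcases List.mem_cons.1 (hlow q (List.mem_cons_of_mem _ hq) r hr) with rfl | h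
      · exact absurd hr (hC.1 q hq)
      · exact h
    have ih := ih hC.2 (fun q hq => hlam q (List.mem_cons_of_mem _ hq)) hlow'
    refine (ih.columnInsert (p := p) ?_ ?_ (hlam p (by simp)) ?_ ?_).congr ?_
    · exact fun q hq => hlam q (List.mem_cons_of_mem _ hq)
    · exact fun i k h => hlow' _ h _ (Prod.mk_le_mk.2 ⟨by omega, le_rfl⟩)
    · intro k hk
      by_contra hle
      exact hC.1 _ hk (Prod.le_def.2 ⟨le_rfl, by simpa using hle⟩)
    · intro i hi
      have h1 : (i, p.2) ≤ p := Prod.le_def.2 ⟨by simp; omega, le_rfl⟩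
      rcases List.mem_cons.1 (hlow p (by simp) _ h1) with h | h
      · have := congrArg Prod.fst h
        simp at this
        omega
      · exact h
    · intro q
      simp

theorem IsPicture.isTab {nu : YoungDiagram} {V : List ℕ} (h : IsPicture lam nu V)
    (hnu : nu ≤ lam) : IsTab lam {p | p ∈ nu} (bumpAll V []) := by
  have hmem : ∀ p, p ∈ V.map (cellAt lam) ↔ p ∈ nu := by
    intro p
    rw [List.mem_map]
    constructor
    · rintro ⟨a, ha, rfl⟩
      obtain ⟨q, hq, rfl⟩ := (h.1 a).1 ha
      rwa [cellAt_lab (hnu hq)]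
    · intro hp
      exact ⟨lab lam p, (h.1 _).2 ⟨p, hp, rfl⟩, cellAt_lab (hnu hp)⟩
  have hV : V = (V.map (cellAt lam)).map (lab lam) := by
    rw [List.map_map]
    conv_lhs => rw [← List.map_id V]
    apply List.map_congr_left
    intro a ha
    obtain ⟨q, hq, rfl⟩ := (h.1 a).1 ha
    simp [cellAt_lab (hnu hq)]
  rw [hV]
  refine (isTab_bumpAll (C := V.map (cellAt lam)) ?_ ?_ ?_).congr fun p => hmem p
  · exact List.pairwise_map.2 h.2
  · exact fun p hp => hnu ((hmem p).1 hp)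
  · exact fun p hp q hq => (hmem q).2 (nu.isLowerSet hq ((hmem p).1 hp))

theorem upClosed_diagram (nu : YoungDiagram) : UpClosed {p | p ∈ nu} :=
  fun i _ h => nu.up_left_mem (Nat.le_succ i) le_rfl h

theorem IsTab.row_eq {nu : YoungDiagram} {t : List (List ℕ)} (ht : IsTab lam {p | p ∈ nu} t)
    (hnu : nu ≤ lam) (i : ℕ) :
    row t i = ((List.range (nu.rowLen i)).map fun k => lab lam (i, k)).reverse := by
  refine eq_of_pairwise_lt (ht.2 i).1 ?_ fun a => ?_
  · rw [List.pairwise_reverse, List.pairwise_map]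
    refine List.pairwise_lt_range.imp_of_mem ?_
    intro k k' hk hk' hlt
    rw [List.mem_range] at hk hk'
    exact (lab_lt_iff (hnu (YoungDiagram.mem_iff_lt_rowLen.2 hk'))
      (hnu (YoungDiagram.mem_iff_lt_rowLen.2 hk))).2 (Or.inl hlt)
  · rw [(ht.2 i).2, List.mem_reverse, List.mem_map]
    simp only [List.mem_range, ← YoungDiagram.mem_iff_lt_rowLen]
    rfl

theorem IsTab.hasShape {nu : YoungDiagram} {t : List (List ℕ)} (ht : IsTab lam {p | p ∈ nu} t)
    (hnu : nu ≤ lam) : HasShape t nu := by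
  intro j
  refine eq_of_forall_lt_iff fun i => ?_
  rw [← YoungDiagram.mem_iff_lt_colLen, YoungDiagram.mem_iff_lt_rowLen]
  have h1 : (row t i).length = nu.rowLen i := by rw [ht.row_eq hnu]; simp
  rw [← h1]
  have h2 := ht.1.getElem?_row i j
  constructor
  · intro hi
    rw [List.getElem?_eq_getElem hi] at h2
    exact (List.getElem?_eq_some_iff.1 h2).1
  · intro hj
    rw [List.getElem?_eq_getElem hj] at h2
    exact (List.getElem?_eq_some_iff.1 h2.symm).1

/-- Labels decrease from left to right in the diagram but entries increase in the tableau, so each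
row is turned around; the `+ 1` comes from counting from 0. -/
theorem IsTab.position {nu : YoungDiagram} {t : List (List ℕ)} (ht : IsTab lam {p | p ∈ nu} t)
    (hst : Std t) (hnu : nu ≤ lam) (hp : p ∈ nu) : lab lam p ∈ t.flatten ∧
      rowIdx t (lab lam p) = p.1 ∧ colIdx t (lab lam p) + p.2 + 1 = nu.rowLen p.1 := by
  have h1 := ht.row_eq hnu p.1
  have hlt : p.2 < nu.rowLen p.1 := YoungDiagram.mem_iff_lt_rowLen.1 hp
  have h2 : (row t p.1)[nu.rowLen p.1 - 1 - p.2]? = some (lab lam p) := by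
    rw [h1, List.getElem?_reverse (by simp; omega)]
    simp only [List.length_map, List.length_range]
    rw [show nu.rowLen p.1 - 1 - (nu.rowLen p.1 - 1 - p.2) = p.2 by omega]
    simp [hlt]
  rw [ht.1.getElem?_row] at h2
  have h3 : nu.rowLen p.1 - 1 - p.2 < t.length := by
    by_contra hlt'
    rw [List.getD_eq_default _ _ (by omega)] at h2
    simp at h2
  rw [List.getD_eq_getElem _ _ h3] at h2
  obtain ⟨g1, g2, g3⟩ := (position_iff hst).2 ⟨_, List.getElem?_eq_getElem h3, h2⟩
  exact ⟨g1, g2, by omega⟩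

end

/-! ### Pictures and Knuth equivalence -/

theorem pairwise_idxOf {w : List ℕ} (h : w.Nodup) :
    w.Pairwise fun a b => w.idxOf a < w.idxOf b := by
  rw [List.pairwise_iff_getElem]
  intro i j hi hj hij
  rwa [h.idxOf_getElem, h.idxOf_getElem]

theorem rel_of_idxOf_lt {α : Type*} [DecidableEq α] {w : List α} {R : α → α → Prop}
    (h : w.Pairwise R) {a b : α} (hb : b ∈ w) (hab : w.idxOf a < w.idxOf b) : R a b := by
  have h2 := List.idxOf_lt_length_of_mem hb
  have := List.pairwise_iff_getElem.1 h _ _ (hab.trans h2) h2 hab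
  rwa [List.getElem_idxOf, List.getElem_idxOf] at this

theorem idxOf_lt_of_pairwise {α : Type*} [DecidableEq α] {w : List α} {R : α → α → Prop}
    (h : w.Pairwise R) {a b : α} (ha : a ∈ w) (hb : b ∈ w) (hne : a ≠ b) (hab : ¬ R a b) : w.idxOf b < w.idxOf a := by
  by_contra hlt
  rcases eq_or_lt_of_le (Nat.le_of_not_lt hlt) with h1 | h1
  · exact hne ((List.idxOf_inj ha).1 h1)
  · exact hab (rel_of_idxOf_lt h hb h1)

/-- Knuth equivalence preserves the relative order of `a` and `a + 1`. -/
theorem Knuth.pairwise_succ {u v : List ℕ} (h : Knuth u v) (a : ℕ) :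
    (u.Pairwise fun p q => ¬ (p = a ∧ q = a + 1)) ↔
      v.Pairwise fun p q => ¬ (p = a ∧ q = a + 1) := by
  induction h with
  | rel u v h =>
    cases h with
    | yzx u v x y z h1 h2 =>
      simp only [List.pairwise_append, List.pairwise_cons, List.mem_cons, forall_eq_or_imp]
      -- The exchanged letters have `y` strictly between them, so they are never `a` and `a + 1`.
      have e1 : ¬ (z = a ∧ x = a + 1) := by omega
      have e2 : ¬ (x = a ∧ z = a + 1) := by omega
      have e3 : ∀ b, (¬ (b = a ∧ x = a + 1) ∧ ¬ (b = a ∧ z = a + 1)) ↔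
        (¬ (b = a ∧ z = a + 1) ∧ ¬ (b = a ∧ x = a + 1)) := fun b => and_comm
      simp only [e1, e2, not_false_eq_true, true_and]
      constructor
      · rintro ⟨k1, ⟨⟨k2, k3, k4⟩, k5, k6, k7⟩, k8⟩
        exact ⟨k1, ⟨⟨k3, k2, k4⟩, k6, k5, k7⟩,
          fun b hb => ⟨(k8 b hb).1, (k8 b hb).2.2.1, (k8 b hb).2.1, (k8 b hb).2.2.2⟩⟩
      · rintro ⟨k1, ⟨⟨k2, k3, k4⟩, k5, k6, k7⟩, k8⟩
        exact ⟨k1, ⟨⟨k3, k2, k4⟩, k6, k5, k7⟩,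
          fun b hb => ⟨(k8 b hb).1, (k8 b hb).2.2.1, (k8 b hb).2.1, (k8 b hb).2.2.2⟩⟩
    | xzy u v x y z h1 h2 =>
      simp only [List.pairwise_append, List.pairwise_cons, List.mem_cons, forall_eq_or_imp]
      have e1 : ¬ (z = a ∧ x = a + 1) := by omega
      have e2 : ¬ (x = a ∧ z = a + 1) := by omega
      simp only [e1, e2, not_false_eq_true, true_and]
      constructor
      · rintro ⟨k1, ⟨⟨k2, k3⟩, ⟨k4, k5⟩, k6, k7⟩, k8⟩
        exact ⟨k1, ⟨⟨k4, k5⟩, ⟨k2, k3⟩, k6, k7⟩,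
          fun b hb => ⟨(k8 b hb).2.1, (k8 b hb).1, (k8 b hb).2.2.1, (k8 b hb).2.2.2⟩⟩
      · rintro ⟨k1, ⟨⟨k2, k3⟩, ⟨k4, k5⟩, k6, k7⟩, k8⟩
        exact ⟨k1, ⟨⟨k4, k5⟩, ⟨k2, k3⟩, k6, k7⟩,
          fun b hb => ⟨(k8 b hb).2.1, (k8 b hb).1, (k8 b hb).2.2.1, (k8 b hb).2.2.2⟩⟩
  | refl u => exact Iff.rfl
  | symm u v _ ih => exact ih.symm
  | trans u v w _ _ ih1 ih2 => exact ih1.trans ih2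

/-- In a decreasing sequence of letters there is at most one entry of each row. -/
theorem HasDec.le_of_rowIdx {t : List (List ℕ)} (h : Std t) {p : ℕ → Bool} {m M : ℕ}
    (hM : ∀ a ∈ t.flatten, p a → rowIdx t a < M) (hm : HasDec 1 ((colRead t).filter p) m) :
    m ≤ M := by
  obtain ⟨f, hf, hm⟩ := hm
  have hn : ((colRead t).filter p).Nodup := h.nodup_colRead.filter _
  refine hm.trans ?_
  rw [List.countP_eq_length_filter, ← List.toFinset_card_of_nodup (hn.filter _), ← Finset.card_range M]
  refine Finset.card_le_card_of_injOn (rowIdx t) ?_ ?_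
  · intro a ha
    simp only [Finset.mem_coe, List.mem_toFinset, List.mem_filter, mem_colRead] at ha
    simpa using hM a ha.1.1 ha.1.2
  · intro a ha b hb hab
    simp only [Finset.mem_coe, List.mem_toFinset, List.mem_filter, decide_eq_true_eq] at ha hb
    have ha' : a ∈ (colRead t).filter p := List.mem_filter.2 ha.1
    have hb' : b ∈ (colRead t).filter p := List.mem_filter.2 hb.1
    have hp := List.pairwise_and_iff.2 ⟨hf, (colRead_pairwise_row h).filter p⟩
    by_contra hne
    have h1 : ∀ a b, f a < 1 → f b < 1 → rowIdx t a = rowIdx t b →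
        ¬ ((f a = f b → f a < 1 → b < a) ∧ (rowIdx t a = rowIdx t b → a < b)) := by
      rintro a b h1 h2 h3 ⟨h4, h5⟩
      have := h4 (by omega) h1
      have := h5 h3
      omega
    have h2 := idxOf_lt_of_pairwise hp ha' hb' hne (h1 a b ha.2 hb.2 hab)
    have h3 := idxOf_lt_of_pairwise hp hb' ha' (Ne.symm hne) (h1 b a hb.2 ha.2 hab.symm)
    omega

section
variable {lam : YoungDiagram}

/-- Vertically adjacent cells have consecutive labels, whose order is a Knuth invariant. In the
reading word of the tableau the lower cell comes first, because row `r` is at least as long as row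
`r + 1` and rows are turned around. -/
theorem IsTab.column_order {t : List (List ℕ)} (ht : IsTab lam {p | p ∈ lam} t) (hst : Std t)
    {V : List ℕ} (hV : Knuth V (colRead t)) {r k : ℕ} (h : (r + 1, k) ∈ lam) :
    V.idxOf (lab lam (r + 1, k)) < V.idxOf (lab lam (r, k)) := by
  have h' : (r, k) ∈ lam := lam.up_left_mem (Nat.le_succ r) le_rfl h
  obtain ⟨a1, a2, a3⟩ := ht.position hst le_rfl h'
  obtain ⟨b1, b2, b3⟩ := ht.position hst le_rfl h
  have hm : lam.rowLen (r + 1) ≤ lam.rowLen r := lam.rowLen_anti _ _ (Nat.le_succ r)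
  have e := lab_succ h
  have h1 : (colRead t).Pairwise fun p q => ¬ (p = lab lam (r, k) ∧ q = lab lam (r, k) + 1) := by
    refine (colRead_pairwise hst).imp ?_
    rintro p q hpq ⟨rfl, rfl⟩
    rw [← e] at hpq
    simp only at a3 b3
    omega
  have hmem : ∀ a, a ∈ V ↔ a ∈ t.flatten := fun a => (hV.perm.mem_iff).trans mem_colRead
  have h2 := (hV.pairwise_succ _).2 h1
  rw [e] at b1 ⊢
  exact idxOf_lt_of_pairwise h2 ((hmem _).2 a1) ((hmem _).2 b1) (by omega) (by simp)

theorem idxOf_lt_of_column {V : List ℕ}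
    (hcol : ∀ r k, (r + 1, k) ∈ lam → V.idxOf (lab lam (r + 1, k)) < V.idxOf (lab lam (r, k)))
    {r r' k : ℕ} (hr : r ≤ r') (h : (r', k) ∈ lam) :
    V.idxOf (lab lam (r', k)) ≤ V.idxOf (lab lam (r, k)) := by
  induction r', hr using Nat.le_induction with
  | base => exact le_rfl
  | succ r' _ ih =>
    have := hcol r' k h
    have := ih (lam.up_left_mem (Nat.le_succ r') le_rfl h)
    omega

/-- If `(r, k)` came before `(r, k + 1)`, then going up column `k` to row `r` and on up column `k +
1` from row `r` would give a decreasing subsequence of length `c + 1`, where `c` is the length of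
column `k`. But the labels of these two columns occupy only `c` rows of the tableau, which by
Greene's theorem limits decreasing subsequences to length `c`. -/
theorem IsTab.row_order {t : List (List ℕ)} (ht : IsTab lam {p | p ∈ lam} t) (hst : Std t)
    {V : List ℕ} (hV : Knuth V (colRead t)) (hn : V.Nodup)
    (hcol : ∀ r k, (r + 1, k) ∈ lam → V.idxOf (lab lam (r + 1, k)) < V.idxOf (lab lam (r, k)))
    {r k : ℕ} (h : (r, k + 1) ∈ lam) :
    V.idxOf (lab lam (r, k + 1)) < V.idxOf (lab lam (r, k)) := by
  have h' : (r, k) ∈ lam := lam.up_left_mem le_rfl (Nat.le_succ k) h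
  have hmemV : ∀ p ∈ lam, lab lam p ∈ V := fun p hp =>
    hV.perm.mem_iff.2 (mem_colRead.2 (ht.position hst le_rfl hp).1)
  by_contra hlt
  have hlt : V.idxOf (lab lam (r, k)) < V.idxOf (lab lam (r, k + 1)) := by
    refine lt_of_le_of_ne (Nat.le_of_not_lt hlt) fun e => ?_
    have := lab_inj h' h ((List.idxOf_inj (hmemV _ h')).1 e)
    simp at this
  set c := lam.colLen k with hc
  have hrc : r < c := YoungDiagram.mem_iff_lt_colLen.1 h'
  have hck : lam.colLen (k + 1) ≤ c := lam.colLen_anti _ _ (Nat.le_succ k)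
  have hlast : (c - 1, k) ∈ lam := YoungDiagram.mem_iff_lt_colLen.2 (by omega)
  have hfirst : (0, k + 1) ∈ lam := lam.up_left_mem (Nat.zero_le r) le_rfl h
  -- The two columns are read one directly after the other, so their labels form an interval and
  -- Knuth equivalence survives the restriction to them.
  set P : ℕ → Bool := fun a =>
    decide (lab lam (0, k + 1) ≤ a ∧ a ≤ lab lam (c - 1, k)) with hP
  have hPcell : ∀ p ∈ lam, P (lab lam p) = true ↔ p.2 = k ∨ p.2 = k + 1 := by
    intro p hp
    have e1 := lab_lt_iff hp hfirst
    have e2 := lab_lt_iff hlast hp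
    have e3 : p.1 < lam.colLen p.2 := YoungDiagram.mem_iff_lt_colLen.1 hp
    have e4 : p.2 = k → lam.colLen p.2 = c := by rintro rfl; rfl
    simp only [hP, decide_eq_true_eq]
    rw [← not_lt, ← not_lt, e1, e2]
    simp only [ReadBefore]
    omega
  have hKP : Knuth (V.filter P) ((colRead t).filter P) := by
    refine hV.filter ?_
    intro x y z _ _ h1 h2
    simp only [hP, decide_eq_true_eq] at h1 h2 ⊢
    omega
  let X : Finset (ℕ × ℕ) := (Finset.Ico r c).image (fun i => (i, k)) ∪
    (Finset.range (r + 1)).image fun i => (i, k + 1)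
  have hX : ∀ p, p ∈ X ↔ (r ≤ p.1 ∧ p.1 < c ∧ p.2 = k) ∨ (p.1 ≤ r ∧ p.2 = k + 1) := by
    rintro ⟨i, j⟩
    simp only [X, Finset.mem_union, Finset.mem_image, Finset.mem_Ico, Finset.mem_range,
      Prod.mk.injEq]
    constructor
    · rintro (⟨i', h1, rfl, rfl⟩ | ⟨i', h1, rfl, rfl⟩)
      · exact Or.inl ⟨h1.1, h1.2, rfl⟩
      · exact Or.inr ⟨by omega, rfl⟩
    · rintro (⟨h1, h2, rfl⟩ | ⟨h1, rfl⟩)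
      · exact Or.inl ⟨i, ⟨h1, h2⟩, rfl, rfl⟩
      · exact Or.inr ⟨i, by omega, rfl, rfl⟩
  have hXlam : ∀ p ∈ X, p ∈ lam := by
    intro p hp
    rcases (hX p).1 hp with ⟨h1, h2, h3⟩ | ⟨h1, h2⟩
    · refine YoungDiagram.mem_iff_lt_colLen.2 ?_
      rw [h3]; exact h2
    · exact lam.isLowerSet (show p ≤ (r, k + 1) from Prod.le_def.2 ⟨h1, h2.le⟩) h
  have hXcard : X.card = c - r + (r + 1) := by
    rw [Finset.card_union_of_disjoint, Finset.card_image_of_injective,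
      Finset.card_image_of_injective, Nat.card_Ico, Finset.card_range]
    · exact fun a b e => (Prod.mk.inj e).1
    · exact fun a b e => (Prod.mk.inj e).1
    · rw [Finset.disjoint_left]
      intro p h1 h2
      obtain ⟨_, -, rfl⟩ := Finset.mem_image.1 h1
      obtain ⟨_, -, h3⟩ := Finset.mem_image.1 h2
      have := (Prod.mk.inj h3).2
      omega
  have hdec : HasDec 1 (V.filter P) (c + 1) := by
    refine ⟨fun a => if a ∈ X.image (lab lam) then 0 else 1, ?_, ?_⟩
    · refine ((pairwise_idxOf hn).filter P).imp ?_
      intro a b hab h1 h2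
      beta_reduce at h1 h2
      have ha : a ∈ X.image (lab lam) := by
        by_contra hne
        rw [if_neg hne] at h2
        omega
      rw [if_pos ha] at h1
      have hb : b ∈ X.image (lab lam) := by
        by_contra hne
        rw [if_neg hne] at h1
        omega
      obtain ⟨p, hp, rfl⟩ := Finset.mem_image.1 ha
      obtain ⟨q, hq, rfl⟩ := Finset.mem_image.1 hb
      by_contra hle
      have hpq : lab lam p < lab lam q := by
        refine lt_of_le_of_ne (Nat.le_of_not_lt hle) fun e => ?_
        rw [e] at hab
        omega
      have hpq := readBefore_of_lt (hXlam p hp) (hXlam q hq) hpq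
      have hp' := (hX p).1 hp
      have hq' := (hX q).1 hq
      have hpl := hXlam p hp
      have hql := hXlam q hq
      obtain ⟨p1, p2⟩ := p
      obtain ⟨q1, q2⟩ := q
      simp only [ReadBefore] at *
      rcases hpq with e1 | ⟨rfl, e1⟩
      · obtain rfl : p2 = k + 1 := by omega
        obtain rfl : q2 = k := by omega
        have h3 := idxOf_lt_of_column hcol (r := p1) (r' := r) (k := q2 + 1) (by omega) h
        have h4 := idxOf_lt_of_column hcol (r := r) (r' := q1) (k := q2) (by omega) hql
        omega
      · have h3 := idxOf_lt_of_column hcol (r := p1) (r' := q1) (k := p2) (by omega) hql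
        omega
    · rw [List.countP_eq_length_filter]
      have h1 : (X.image (lab lam)).card = c + 1 := by
        rw [Finset.card_image_of_injOn fun p hp q hq e => lab_inj (hXlam p hp) (hXlam q hq) e,
          hXcard]
        omega
      rw [← h1, ← List.toFinset_card_of_nodup ((hn.filter _).filter _)]
      refine Finset.card_le_card fun a ha => ?_
      rw [List.mem_toFinset, List.mem_filter, List.mem_filter]
      refine ⟨?_, by simp only [if_pos ha]; simp⟩
      obtain ⟨p, hp, rfl⟩ := Finset.mem_image.1 ha
      refine ⟨hmemV p (hXlam p hp), (hPcell p (hXlam p hp)).2 ?_⟩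
      have := (hX p).1 hp
      omega
  have hdec' := (hKP.hasDec (hn.filter _)).1 hdec
  have := hdec'.le_of_rowIdx hst (M := c) ?_
  · omega
  intro a ha haP
  obtain ⟨p, hp, rfl⟩ : ∃ p ∈ lam, lab lam p = a := by
    have := (mem_row_iff hst).2 ⟨ha, rfl⟩
    obtain ⟨k, h1, h2⟩ := ((ht.2 _).2 a).1 this
    exact ⟨_, h1, h2⟩
  rw [(ht.position hst le_rfl hp).2.1]
  have e3 : p.1 < lam.colLen p.2 := YoungDiagram.mem_iff_lt_colLen.1 hp
  rcases (hPcell p hp).1 haP with h4 | h4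
  · rwa [h4, ← hc] at e3
  · rw [h4] at e3; omega

/-- The property of being a picture is invariant under Knuth equivalence. -/
theorem IsPicture.knuth {V V' : List ℕ} (h : IsPicture lam lam V) (hK : Knuth V V') :
    IsPicture lam lam V' := by
  have hn := h.nodup
  have hn' : V'.Nodup := hK.perm.nodup_iff.1 hn
  have ht := h.isTab le_rfl
  have hst := std_bumpAll hn
  have hV' := hK.symm.trans (knuth_colRead_bumpAll hn)
  have hmem : ∀ a, a ∈ V' ↔ ∃ p ∈ lam, lab lam p = a := fun a => hK.perm.mem_iff.symm.trans (h.1 a)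
  have hcol : ∀ r k, (r + 1, k) ∈ lam →
      V'.idxOf (lab lam (r + 1, k)) < V'.idxOf (lab lam (r, k)) :=
    fun r k hrk => ht.column_order hst hV' hrk
  have hrow : ∀ r k, (r, k + 1) ∈ lam →
      V'.idxOf (lab lam (r, k + 1)) < V'.idxOf (lab lam (r, k)) :=
    fun r k hrk => ht.row_order hst hV' hn' hcol hrk
  refine ⟨hmem, (pairwise_idxOf hn').imp_of_mem ?_⟩
  intro a b ha hb hab hle
  obtain ⟨⟨i, j⟩, hp, rfl⟩ := (hmem a).1 ha
  obtain ⟨⟨i', j'⟩, hq, rfl⟩ := (hmem b).1 hb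
  rw [cellAt_lab hp, cellAt_lab hq, Prod.mk_le_mk] at hle
  have h1 := idxOf_lt_of_column hcol hle.1 hq
  have h2 : V'.idxOf (lab lam (i, j')) ≤ V'.idxOf (lab lam (i, j)) := by
    have hq' : (i, j') ∈ lam := lam.up_left_mem hle.1 le_rfl hq
    clear h1 hq hb hab
    induction j', hle.2 using Nat.le_induction with
    | base => exact le_rfl
    | succ j' hjj ih =>
      have h4 := hrow i j' hq'
      have h5 := lam.up_left_mem le_rfl (Nat.le_succ j') hq'
      have := ih ⟨hle.1, hjj⟩ h5
      omega
  omega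

end

section

/-! ### The up-down process of a dominant tableau -/

theorem upDown_concat (n : ℕ) (w : List ℕ) (v : ℕ) :
    upDown n (w ++ [v]) = upDownStep n (upDown n w) (v, w.length + 1) := by
  simp [upDown, List.zipIdx_append, add_comm]

theorem weight_concat {n : ℕ} (w : List ℕ) (v : ℕ) {i : ℕ} (hi : i < n) :
    weight n (w ++ [v]) i =
      weight n w i + (if v = i + 1 then 1 else 0) - if v = 2 * n - i then 1 else 0 := by
  simp only [weight, hi, if_true, List.count_append, List.count_singleton, Nat.cast_add, beq_iff_eq]
  split_ifs <;> simp <;> omega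

theorem weight_of_le {n : ℕ} (w : List ℕ) {i : ℕ} (hi : n ≤ i) : weight n w i = 0 := by
  simp [weight, show ¬ i < n by omega]

variable {lam : YoungDiagram} {n : ℕ} {T : SemistandardYoungTableau lam}

theorem length_word (T : SemistandardYoungTableau lam) :
    (word T).length = (cells lam).length := by
  simp [word_eq]

theorem take_word_succ (T : SemistandardYoungTableau lam) {p : ℕ × ℕ} (hp : p ∈ lam) {x : ℕ}
    (hx : lab lam p = x + 1) : (word T).take (x + 1) = (word T).take x ++ [T p.1 p.2] := by
  have h1 := lab_le hp
  rw [hx, ← length_word T] at h1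
  rw [List.take_succ_eq_append_getElem h1]
  congr 2
  simp only [word_eq, List.getElem_map]
  have h2 : (cells lam).idxOf p = x := Nat.succ_injective hx
  have h3 := List.getElem_idxOf (List.idxOf_lt_length_of_mem (mem_cells.2 hp))
  simp only [h2] at h3
  rw [h3]

theorem entry_le_of_le (T : SemistandardYoungTableau lam) {p q : ℕ × ℕ} (h : p ≤ q) (hq : q ∈ lam) :
    T p.1 p.2 ≤ T q.1 q.2 := by
  obtain ⟨i, j⟩ := p
  obtain ⟨i', j'⟩ := q
  rw [Prod.mk_le_mk] at h
  exact (T.row_weak_of_le h.2 (lam.up_left_mem h.1 le_rfl hq)).trans (T.col_weak h.1 hq)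

theorem le_entry_of_col (T : SemistandardYoungTableau lam)
    (hT : ∀ i j, (i, j) ∈ lam → 1 ≤ T i j) {i j : ℕ} (h : (i, j) ∈ lam) : i + 1 ≤ T i j := by
  induction i with
  | zero => exact hT _ _ h
  | succ i ih =>
    have := ih (lam.up_left_mem (Nat.le_succ i) le_rfl h)
    have := T.col_strict (Nat.lt_add_one i) h
    omega

/-- The cells with an unbarred entry that have been read up to step `x` and are not matched. -/
def unmatched (n : ℕ) (T : SemistandardYoungTableau lam) (x : ℕ) (L : List (ℕ × ℕ)) :
    Set (ℕ × ℕ) :=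
  {p | p ∈ lam ∧ lab lam p ≤ x ∧ T p.1 p.2 ≤ n ∧ ∀ j, (j, lab lam p) ∉ L}

/-- The two-line array `L` matches each barred cell that has been read up to step `x` with an
unbarred cell. -/
structure IsMatching (n : ℕ) (T : SemistandardYoungTableau lam) (x : ℕ) (L : List (ℕ × ℕ)) :
    Prop where
  sorted : (L.map Prod.fst).Pairwise (· < ·)
  pair : ∀ e ∈ L, ∃ y ∈ lam, ∃ z ∈ lam, e = (lab lam z, lab lam y) ∧ lab lam y < lab lam z ∧
    lab lam z ≤ x ∧ y.1 < n ∧ T y.1 y.2 = y.1 + 1 ∧ T z.1 z.2 = 2 * n - y.1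
  nodup : (L.map Prod.snd).Nodup
  barred : ∀ z ∈ lam, lab lam z ≤ x → n < T z.1 z.2 → ∃ y ∈ lam, (lab lam z, lab lam y) ∈ L
  unbarred : ∀ p ∈ lam, lab lam p ≤ x → T p.1 p.2 ≤ n → T p.1 p.2 = p.1 + 1
  order : ∀ p ∈ lam, ∀ q ∈ lam, p ≤ q → p ≠ q → T q.1 q.2 ≤ n → lab lam q ≤ x →
    ∀ j, (j, lab lam p) ∈ L → ∃ j' < j, (j', lab lam q) ∈ L

/-- If the north-western cell were matched, then `order` would make the other unbarred cell matched
even earlier. -/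
theorem IsMatching.mem_unmatched {x : ℕ} {L : List (ℕ × ℕ)} (h : IsMatching n T x L)
    {p q : ℕ × ℕ} (hp : lab lam p ≤ x) (hpq : p ≤ q) (hq : q ∈ unmatched n T x L) :
    p ∈ unmatched n T x L := by
  obtain ⟨h1, h2, h3, h4⟩ := hq
  have hpl := lam.isLowerSet hpq h1
  refine ⟨hpl, hp, (entry_le_of_le T hpq h1).trans h3, fun j hj => ?_⟩
  by_cases hne : p = q
  · subst hne
    exact h4 j hj
  · obtain ⟨j', -, hj'⟩ := h.order p hpl q h1 hpq hne h3 h2 j hj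
    exact h4 j' hj'

theorem IsMatching.upClosed {x : ℕ} {L : List (ℕ × ℕ)} (h : IsMatching n T x L) :
    UpClosed (unmatched n T x L) := by
  intro i k hik
  refine h.mem_unmatched ?_ (Prod.mk_le_mk.2 ⟨Nat.le_succ i, le_rfl⟩) hik
  have := lab_succ hik.1
  have := hik.2.1
  omega

theorem IsMatching.isBurge {x : ℕ} {L : List (ℕ × ℕ)} (h : IsMatching n T x L) : IsBurge L := by
  refine ⟨h.sorted, ?_, ?_⟩
  · rw [labels, List.nodup_append]
    refine ⟨nodup_of_lt h.sorted, h.nodup, ?_⟩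
    intro a ha b hb hab
    obtain ⟨e, he, rfl⟩ := List.mem_map.1 ha
    obtain ⟨e', he', rfl⟩ := List.mem_map.1 hb
    obtain ⟨y, hy, z, hz, rfl, h1, h2, h3, h4, h5⟩ := h.pair e he
    obtain ⟨y', hy', z', hz', rfl, h1', h2', h3', h4', h5'⟩ := h.pair e' he'
    have := lab_inj hz hy' hab
    subst this
    omega
  · intro e he
    obtain ⟨y, hy, z, hz, rfl, h1, -⟩ := h.pair e he
    exact h1

theorem IsMatching.nil (n : ℕ) (T : SemistandardYoungTableau lam) : IsMatching n T 0 [] := by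
  have h0 : ∀ p, ¬ lab lam p ≤ 0 := fun p => by have := lab_pos (lam := lam) (p := p); omega
  constructor <;> simp [h0]

/-- The letter of an unbarred cell is determined by the row of the cell. -/
theorem IsMatching.entry_eq {x : ℕ} {L : List (ℕ × ℕ)} (h : IsMatching n T x L)
    (hT : ∀ i j, (i, j) ∈ lam → 1 ≤ T i j) {t : List (List ℕ)} (ht : IsTab lam (unmatched n T x L) t)
    {z : ℕ × ℕ} (hz : z ∈ lam) (hzx : lab lam z = x + 1) (hzn : T z.1 z.2 ≤ n)
    (hdom : ∀ i, T z.1 z.2 = i + 2 → (row t (i + 1)).length < (row t i).length) :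
    T z.1 z.2 = z.1 + 1 := by
  obtain ⟨r, k⟩ := z
  have h1 := le_entry_of_col T hT hz
  by_contra hne
  obtain ⟨i, hi⟩ : ∃ i, T r k = i + 2 := ⟨T r k - 2, by simp only at hne; omega⟩
  have h2 := hdom i hi
  -- If the letter is too large, dominance provides an unmatched cell in row `i ≥ r`. Having been
  -- read already, it lies strictly to the right of `z`. So the right neighbour of `z` has an
  -- unbarred letter, known to be `r + 1`, and the row condition bounds the letter of `z`.
  obtain ⟨a, ha⟩ := List.exists_mem_of_length_pos (Nat.zero_lt_of_lt h2)
  obtain ⟨k', hk', rfl⟩ := ((ht.2 i).2 a).1 ha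
  obtain ⟨g1, g2, g3, g4⟩ := hk'
  have g5 := readBefore_of_lt g1 hz (by omega)
  have hri : r ≤ i := by simp only at hne; omega
  have hkk : k + 1 ≤ k' := by
    simp only [ReadBefore] at g5
    omega
  have hle : (r, k + 1) ≤ (i, k') := Prod.mk_le_mk.2 ⟨hri, hkk⟩
  have hmem := lam.isLowerSet hle g1
  have g6 := entry_le_of_le T hle g1
  have g7 := (lab_lt_iff hmem hz).2 (Or.inl (Nat.lt_succ_self k))
  have g8 := h.unbarred _ hmem (by omega) (g6.trans g3)
  have g9 := T.row_weak (Nat.lt_add_one k) hmem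
  simp only at g8 g9 hne
  omega

/-- The step of an unbarred cell. -/
theorem IsMatching.open {x : ℕ} {L : List (ℕ × ℕ)} (h : IsMatching n T x L) {z : ℕ × ℕ}
    (hz : z ∈ lam) (hzx : lab lam z = x + 1) (hzn : T z.1 z.2 ≤ n) (hzr : T z.1 z.2 = z.1 + 1) :
    IsMatching n T (x + 1) L := by
  have hcase : ∀ p ∈ lam, lab lam p ≤ x + 1 → lab lam p ≤ x ∨ p = z := by
    intro p hp hpx
    rcases Nat.lt_or_eq_of_le hpx with h1 | h1
    · exact Or.inl (by omega)
    · exact Or.inr (lab_inj hp hz (h1.trans hzx.symm))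
  refine ⟨h.sorted, ?_, h.nodup, ?_, ?_, ?_⟩
  · intro e he
    obtain ⟨y, hy, z', hz', h1, h2, h3, h4⟩ := h.pair e he
    exact ⟨y, hy, z', hz', h1, h2, by omega, h4⟩
  · intro p hp hpx hpn
    rcases hcase p hp hpx with h1 | rfl
    · exact h.barred p hp h1 hpn
    · omega
  · intro p hp hpx hpn
    rcases hcase p hp hpx with h1 | rfl
    · exact h.unbarred p hp h1 hpn
    · exact hzr
  · intro p hp q hq hpq hne hqn hqx j hj
    rcases hcase q hq hqx with h1 | rfl
    · exact h.order p hp q hq hpq hne hqn h1 j hj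
    · exfalso
      -- The closer of `p` is read between `p` and the new cell `q`. As `p ≤ q`, all three lie in
      -- one column, and a barred letter would stand above an unbarred one.
      obtain ⟨y, hy, z, hz', h1, h2, h3, h4, h5, h6⟩ := h.pair _ hj
      obtain ⟨rfl, h7⟩ := Prod.mk.inj h1
      have := lab_inj hp hy h7
      subst this
      have g1 := readBefore_of_lt hy hz' h2
      have g2 := readBefore_of_lt hz' hq (by omega)
      obtain ⟨p1, p2⟩ := p
      obtain ⟨q1, q2⟩ := q
      obtain ⟨z1, z2⟩ := z
      rw [Prod.mk_le_mk] at hpq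
      simp only [ReadBefore] at g1 g2
      have g3 : z2 = q2 := by omega
      subst g3
      have := T.col_strict (show z1 < q1 by omega) hq
      simp only at *
      omega

/-- The step of a barred cell. -/
theorem IsMatching.close {x : ℕ} {L : List (ℕ × ℕ)} (h : IsMatching n T x L) {z y : ℕ × ℕ}
    (hz : z ∈ lam) (hzx : lab lam z = x + 1) (hy : y ∈ unmatched n T x L) (hyn : y.1 < n)
    (hzy : T z.1 z.2 = 2 * n - y.1)
    (hmax : ∀ q ∈ unmatched n T x L, y ≤ q → y = q) :
    IsMatching n T (x + 1) (L ++ [(x + 1, lab lam y)]) := by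
  have hcase : ∀ p ∈ lam, lab lam p ≤ x + 1 → lab lam p ≤ x ∨ p = z := by
    intro p hp hpx
    rcases Nat.lt_or_eq_of_le hpx with h1 | h1
    · exact Or.inl (by omega)
    · exact Or.inr (lab_inj hp hz (h1.trans hzx.symm))
  refine ⟨?_, ?_, ?_, ?_, ?_, ?_⟩
  · rw [List.map_append, List.pairwise_append]
    refine ⟨h.sorted, by simp, ?_⟩
    intro a ha b hb
    obtain ⟨e, he, rfl⟩ := List.mem_map.1 ha
    obtain ⟨y', hy', z', hz', rfl, h2, h3, h4⟩ := h.pair e he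
    simp only [List.map_cons, List.map_nil, List.mem_singleton] at hb
    simp only
    omega
  · intro e he
    rcases List.mem_append.1 he with he | he
    · obtain ⟨y, hy, z', hz', h1, h2, h3, h4⟩ := h.pair e he
      exact ⟨y, hy, z', hz', h1, h2, by omega, h4⟩
    · rw [List.mem_singleton.1 he]
      refine ⟨y, hy.1, z, hz, by rw [hzx], ?_, by omega, hyn, ?_, hzy⟩
      · have := hy.2.1
        omega
      · exact h.unbarred y hy.1 hy.2.1 hy.2.2.1
  · rw [List.map_append, List.nodup_append]
    refine ⟨h.nodup, by simp, ?_⟩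
    intro a ha b hb hab
    obtain ⟨e, he, rfl⟩ := List.mem_map.1 ha
    simp only [List.map_cons, List.map_nil, List.mem_singleton] at hb
    apply hy.2.2.2 e.1
    rw [← hb, ← hab]
    exact he
  · intro p hp hpx hpn
    rcases hcase p hp hpx with h1 | rfl
    · obtain ⟨y', hy', h2⟩ := h.barred p hp h1 hpn
      exact ⟨y', hy', List.mem_append_left _ h2⟩
    · exact ⟨y, hy.1, by simp [hzx]⟩
  · intro p hp hpx hpn
    rcases hcase p hp hpx with h1 | rfl
    · exact h.unbarred p hp h1 hpn
    · omega
  · intro p hp q hq hpq hne hqn hqx j hj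
    rcases hcase q hq hqx with h1 | rfl
    · rcases List.mem_append.1 hj with hj | hj
      · obtain ⟨j', h2, h3⟩ := h.order p hp q hq hpq hne hqn h1 j hj
        exact ⟨j', h2, List.mem_append_left _ h3⟩
      · obtain ⟨rfl, h2⟩ := Prod.mk.inj (List.mem_singleton.1 hj)
        have := lab_inj hp hy.1 h2
        subst this
        -- A cell south-east of the cell being closed must be matched already, because the closed
        -- cell is maximal among the unmatched ones.
        by_contra hno
        push Not at hno
        refine hne (hmax q ⟨hq, h1, hqn, fun j' hj' => ?_⟩ hpq)
        obtain ⟨y', hy', z', hz', h4, h5, h6, -⟩ := h.pair _ hj'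
        have := (Prod.mk.inj h4).1
        exact hno j' (by omega) (List.mem_append_left _ hj')
    · omega

end

section

variable {lam mu : YoungDiagram} {n : ℕ} {T : SemistandardYoungTableau lam}

theorem lab_le_of_le {p q : ℕ × ℕ} (hp : p ∈ lam) (hq : q ∈ lam) (h1 : p.1 ≤ q.1)
    (h2 : p.2 = q.2) : lab lam p ≤ lab lam q := by
  rw [← not_lt, lab_lt_iff hq hp, ReadBefore]
  omega

/-- The state of the up-down process after `x` steps. -/
structure IsState (n : ℕ) (T : SemistandardYoungTableau lam) (x : ℕ)
    (s : List (List ℕ) × List (ℕ × ℕ)) : Prop where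
  matching : IsMatching n T x s.2
  tab : IsTab lam (unmatched n T x s.2) s.1
  weight_eq : ∀ i, ((row s.1 i).length : ℤ) = weight n ((word T).take x) i

theorem IsState.open {x : ℕ} {s : List (List ℕ) × List (ℕ × ℕ)} (h : IsState n T x s)
    (hT : ∀ i j, (i, j) ∈ lam → 1 ≤ T i j)
    (hdom : IsDominantWeight n (weight n ((word T).take (x + 1)))) {z : ℕ × ℕ} (hz : z ∈ lam)
    (hzx : lab lam z = x + 1) (hzn : T z.1 z.2 ≤ n) :
    IsState n T (x + 1) (upDownStep n s (T z.1 z.2, x + 1)) := by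
  have hw := take_word_succ T hz hzx
  have hrow : ∀ i, i < n → weight n ((word T).take (x + 1)) i =
      (row s.1 i).length + if T z.1 z.2 = i + 1 then 1 else 0 := by
    intro i hi
    rw [hw, weight_concat _ _ hi, ← h.weight_eq, if_neg (c := T z.1 z.2 = 2 * n - i) (by omega),
      sub_zero]
  have hzr : T z.1 z.2 = z.1 + 1 := by
    refine h.matching.entry_eq hT h.tab hz hzx hzn fun i hi => ?_
    have h1 := hdom.1 i (by omega)
    rw [hrow _ (by omega), hrow _ (by omega)] at h1
    split_ifs at h1 <;> omega
  have hstep : upDownStep n s (T z.1 z.2, x + 1) = (addBox (x + 1) z.1 s.1, s.2) := by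
    simp only [upDownStep, hzr, Nat.add_sub_cancel]
    rw [if_pos (by omega)]
  rw [hstep]
  have hbox : z.1 = 0 ∨ (row s.1 z.1).length < (row s.1 (z.1 - 1)).length := by
    rcases Nat.eq_zero_or_pos z.1 with h0 | h0
    · exact Or.inl h0
    · right
      have h1 := hdom.1 (z.1 - 1) (by omega)
      rw [hrow _ (by omega), hrow _ (by omega)] at h1
      rw [show z.1 - 1 + 1 = z.1 by omega] at h1
      split_ifs at h1 <;> omega
  obtain ⟨g1, g2⟩ := h.tab.1.addBox (x := x + 1) hbox
  refine ⟨h.matching.open hz hzx hzn hzr, ⟨g1, fun i => ?_⟩, fun i => ?_⟩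
  · have hmem : ∀ p, p ∈ unmatched n T (x + 1) s.2 ↔ p = z ∨ p ∈ unmatched n T x s.2 := by
      intro p
      simp only [unmatched, Set.mem_ofPred_eq]
      constructor
      · rintro ⟨h1, h2, h3, h4⟩
        rcases Nat.lt_or_eq_of_le h2 with h5 | h5
        · exact Or.inr ⟨h1, by omega, h3, h4⟩
        · exact Or.inl (lab_inj h1 hz (h5.trans hzx.symm))
      · rintro (rfl | ⟨h1, h2, h3, h4⟩)
        · refine ⟨hz, by omega, hzn, fun j hj => ?_⟩
          obtain ⟨y, hy, z, hz, h1, h2, h3, -⟩ := h.matching.pair _ hj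
          have := (Prod.mk.inj h1).2
          omega
        · exact ⟨h1, by omega, h3, h4⟩
    have h1 := h.tab.2 i
    rw [g2]
    split_ifs with hi
    · subst hi
      constructor
      · rw [List.pairwise_append]
        refine ⟨h1.1, by simp, fun a ha b hb => ?_⟩
        obtain ⟨k, h2, rfl⟩ := (h1.2 a).1 ha
        have := h2.2.1
        rw [List.mem_singleton.1 hb]
        omega
      · intro a
        rw [List.mem_append, h1.2, List.mem_singleton]
        constructor
        · rintro (⟨k, h2, h3⟩ | rfl)
          · exact ⟨k, (hmem _).2 (Or.inr h2), h3⟩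
          · exact ⟨z.2, (hmem _).2 (Or.inl rfl), hzx⟩
        · rintro ⟨k, h2, h3⟩
          rcases (hmem _).1 h2 with h4 | h4
          · right; rw [← h3, h4, hzx]
          · exact Or.inl ⟨k, h4, h3⟩
    · refine ⟨h1.1, fun a => ?_⟩
      rw [h1.2]
      refine exists_congr fun k => and_congr_left fun _ => ?_
      rw [hmem, or_iff_right]
      rintro rfl
      exact hi rfl
  · by_cases hi : i < n
    · rw [hrow i hi, g2, hzr]
      by_cases h1 : i = z.1
      · subst h1; simp
      · rw [if_neg h1, if_neg (by omega)]; simp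
    · rw [weight_of_le _ (by omega), g2, if_neg (by omega), h.weight_eq, weight_of_le _ (by omega)]

/-- The leftmost entry of row `b` is the smallest label, hence the rightmost unmatched cell of that
row. A larger unmatched cell would lie below it in the same column. Then every unmatched cell of row
`b` would have an unmatched cell directly below, contradicting that row `b + 1` is shorter. -/
theorem IsState.maximal {x : ℕ} {s : List (List ℕ) × List (ℕ × ℕ)} (h : IsState n T x s)
    {z : ℕ × ℕ} (hz : z ∈ lam) (hzx : lab lam z = x + 1) (hzn : n < T z.1 z.2) {b c : ℕ}
    (hlen : (row s.1 (b + 1)).length < (row s.1 b).length)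
    (hmin : ∀ k, (b, k) ∈ unmatched n T x s.2 → lab lam (b, c) ≤ lab lam (b, k))
    (hy : (b, c) ∈ unmatched n T x s.2) (q : ℕ × ℕ) (hq : q ∈ unmatched n T x s.2)
    (hle : (b, c) ≤ q) : (b, c) = q := by
  obtain ⟨b', c'⟩ := q
  rw [Prod.mk_le_mk] at hle
  have hminc : ∀ k, (b, k) ∈ unmatched n T x s.2 → k ≤ c := by
    intro k hk
    by_contra hlt
    have := (lab_lt_iff hk.1 hy.1).2 (Or.inl (by simp only; omega))
    have := hmin k hk
    omega
  have hup : ∀ i, i ≤ b' → (i, c') ∈ unmatched n T x s.2 := by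
    intro i hi
    have h1 : (i, c') ≤ (b', c') := Prod.mk_le_mk.2 ⟨hi, le_rfl⟩
    exact h.matching.mem_unmatched
      ((lab_le_of_le (lam.isLowerSet h1 hq.1) hq.1 hi rfl).trans hq.2.1) h1 hq
  obtain rfl : c' = c := le_antisymm (hminc _ (hup b hle.1)) hle.2
  by_contra hne
  have hb1 := hup (b + 1) (by
    rcases Nat.lt_or_eq_of_le hle.1 with h1 | h1
    · exact h1
    · exact absurd (by rw [h1]) hne)
  have hall : ∀ k, (b, k) ∈ unmatched n T x s.2 → (b + 1, k) ∈ unmatched n T x s.2 := by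
    intro k hk
    have h1 : (b + 1, k) ≤ (b + 1, c') := Prod.mk_le_mk.2 ⟨le_rfl, hminc k hk⟩
    have h2 := lam.isLowerSet h1 hb1.1
    refine h.matching.mem_unmatched ?_ h1 hb1
    have h3 := lab_succ h2
    have h4 := hk.2.1
    by_contra hlt
    -- The cell below has the next label, so it can be unread only if it is the current cell `z`;
    -- but `z` is barred, while this cell is to the left of an unbarred one.
    have h5 : (b + 1, k) = z := lab_inj h2 hz (by omega)
    have h6 := entry_le_of_le T h1 hb1.1
    have h7 := hb1.2.2.1
    rw [h5] at h6
    omega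
  have : ((row s.1 b).map (· + 1)).Subperm (row s.1 (b + 1)) := by
    refine List.subperm_of_subset ?_ ?_
    · exact (nodup_of_lt (h.tab.2 b).1).map (add_left_injective 1)
    · intro a ha
      obtain ⟨a', ha', rfl⟩ := List.mem_map.1 ha
      obtain ⟨k, hk, rfl⟩ := ((h.tab.2 b).2 a').1 ha'
      have h1 := hall k hk
      exact ((h.tab.2 (b + 1)).2 _).2 ⟨k, h1, lab_succ h1.1⟩
  have := this.length_le
  rw [List.length_map] at this
  omega

theorem IsState.close {x : ℕ} {s : List (List ℕ) × List (ℕ × ℕ)} (h : IsState n T x s)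
    (hdom : IsDominantWeight n (weight n ((word T).take (x + 1)))) {z : ℕ × ℕ} (hz : z ∈ lam)
    (hzx : lab lam z = x + 1) (hzn : n < T z.1 z.2) (hz2 : T z.1 z.2 ≤ 2 * n) :
    IsState n T (x + 1) (upDownStep n s (T z.1 z.2, x + 1)) := by
  obtain ⟨b, hb, hbz⟩ : ∃ b < n, T z.1 z.2 = 2 * n - b := ⟨2 * n - T z.1 z.2, by omega, by omega⟩
  have hw := take_word_succ T hz hzx
  have hrow : ∀ i, i < n → weight n ((word T).take (x + 1)) i =
      (row s.1 i).length - if i = b then 1 else 0 := by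
    intro i hi
    rw [hw, weight_concat _ _ hi, ← h.weight_eq, if_neg (c := T z.1 z.2 = i + 1) (by omega),
      add_zero]
    congr 1
    by_cases hib : i = b
    · rw [if_pos hib, if_pos (by omega)]
    · rw [if_neg hib, if_neg (by omega)]
  -- Dominance after the step says that row `b` can lose a box. In the last case, `b + 1 = n`, the
  -- row below is empty and nonnegativity is what is needed.
  have hlen : (row s.1 (b + 1)).length < (row s.1 b).length := by
    have h0 := hdom.2 b hb
    rw [hrow b hb, if_pos rfl] at h0
    by_cases hbn : b + 1 < n
    · have h1 := hdom.1 b hbn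
      rw [hrow _ hbn, hrow _ hb, if_pos rfl, if_neg (by omega)] at h1
      omega
    · have h1 := h.weight_eq (b + 1)
      rw [weight_of_le _ (by omega)] at h1
      omega
  have hstep : upDownStep n s (T z.1 z.2, x + 1) =
      (removeBox b s.1, s.2 ++ [(x + 1, (row s.1 b).headD 0)]) := by
    simp only [upDownStep]
    rw [if_neg (by omega), show 2 * n - T z.1 z.2 = b by omega]
  rw [hstep]
  obtain ⟨a, l, hal⟩ := List.exists_cons_of_length_pos (Nat.zero_lt_of_lt hlen)
  have hb1 := h.tab.2 b
  rw [hal, List.pairwise_cons] at hb1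
  obtain ⟨c, hc, rfl⟩ := (hb1.2 a).1 (by simp)
  have hmin : ∀ k, (b, k) ∈ unmatched n T x s.2 → lab lam (b, c) ≤ lab lam (b, k) := by
    intro k hk
    rcases List.mem_cons.1 ((hb1.2 _).2 ⟨k, hk, rfl⟩) with h1 | h1
    · exact h1.ge
    · exact (hb1.1.1 _ h1).le
  rw [hal, List.headD_cons]
  have hM := h.matching.close hz hzx hc hb hbz
    fun q hq hle => h.maximal hz hzx hzn hlen hmin hc q hq hle
  obtain ⟨g1, g2⟩ := h.tab.1.removeBox hlen
  refine ⟨hM, ⟨g1, fun i => ?_⟩, fun i => ?_⟩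
  · have hmem : ∀ p, p ∈ unmatched n T (x + 1) (s.2 ++ [(x + 1, lab lam (b, c))]) ↔
        p ≠ (b, c) ∧ p ∈ unmatched n T x s.2 := by
      intro p
      simp only [unmatched, Set.mem_ofPred_eq, List.mem_append, List.mem_singleton, Prod.mk.injEq,
        not_or, not_and]
      constructor
      · rintro ⟨h1, h2, h3, h4⟩
        refine ⟨?_, h1, ?_, h3, fun j => (h4 j).1⟩
        · rintro rfl
          exact (h4 (x + 1)).2 rfl rfl
        · by_contra hlt
          have : p = z := lab_inj h1 hz (by omega)
          subst this
          omega
      · rintro ⟨h0, h1, h2, h3, h4⟩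
        exact ⟨h1, by omega, h3, fun j => ⟨h4 j, fun _ e => h0 (lab_inj h1 hc.1 e)⟩⟩
    have h1 := h.tab.2 i
    simp only
    rw [g2]
    split_ifs with hi
    · subst hi
      rw [hal, List.tail_cons]
      refine ⟨hb1.1.2, fun a => ?_⟩
      constructor
      · intro ha
        obtain ⟨k, h2, h3⟩ := (hb1.2 a).1 (List.mem_cons_of_mem _ ha)
        refine ⟨k, (hmem _).2 ⟨?_, h2⟩, h3⟩
        rintro h4
        have := hb1.1.1 a ha
        rw [← h3, h4] at this
        omega
      · rintro ⟨k, h2, h3⟩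
        obtain ⟨h4, h5⟩ := (hmem _).1 h2
        rcases List.mem_cons.1 ((hb1.2 a).2 ⟨k, h5, h3⟩) with h6 | h6
        · exact absurd (lab_inj h5.1 hc.1 (h3.trans h6)) h4
        · exact h6
    · refine ⟨h1.1, fun a => ?_⟩
      rw [h1.2]
      refine exists_congr fun k => and_congr_left fun _ => ?_
      rw [hmem, and_iff_right]
      rintro h2
      exact hi (Prod.mk.inj h2).1
  · simp only
    by_cases hi : i < n
    · rw [hrow i hi, g2]
      split_ifs with h1
      · subst h1
        rw [List.length_tail]
        omega
      · simp
    · rw [weight_of_le _ (by omega), g2, if_neg (by omega), h.weight_eq, weight_of_le _ (by omega)]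

theorem isState_upDown (hT : T ∈ domres n lam mu) (x : ℕ) (hx : x ≤ (cells lam).length) :
    IsState n T x (upDown n ((word T).take x)) := by
  obtain ⟨h1, -, h2, -⟩ := hT
  induction x with
  | zero =>
    have h0 : ∀ p, ¬ lab lam p ≤ 0 := fun p => by have := lab_pos (lam := lam) (p := p); omega
    refine ⟨IsMatching.nil n T, isTab_nil.congr ?_, ?_⟩
    · intro p
      simp [unmatched, h0]
    · intro i
      simp [upDown, weight]
  | succ x ih =>
    obtain ⟨h3, h4⟩ := lab_cellAt (lam := lam) (a := x + 1) (by omega) hx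
    have hd := h2 _ (List.take_prefix (x + 1) (word T))
    have h5 := h1 _ _ h4
    rw [take_word_succ T h4 h3, upDown_concat, List.length_take, length_word, min_eq_left (by omega)]
    by_cases hn : T (cellAt lam (x + 1)).1 (cellAt lam (x + 1)).2 ≤ n
    · exact (ih (by omega)).open (fun i j hij => (h1 i j hij).1) hd h4 h3 hn
    · exact (ih (by omega)).close hd h4 h3 (by omega) h5.2

end

section

/-! ### The picture of a dominant tableau -/

variable {lam mu : YoungDiagram} {n : ℕ} {T : SemistandardYoungTableau lam} {L : List (ℕ × ℕ)}

theorem IsMatching.fst_inj {x : ℕ} (h : IsMatching n T x L) {j i i' : ℕ} (h1 : (j, i) ∈ L)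
    (h2 : (j, i') ∈ L) : i = i' :=
  (Prod.mk.inj (List.inj_on_of_nodup_map (nodup_of_lt h.sorted) h1 h2 rfl)).2

theorem IsMatching.snd_inj {x : ℕ} (h : IsMatching n T x L) {j j' i : ℕ} (h1 : (j, i) ∈ L)
    (h2 : (j', i) ∈ L) : j = j' :=
  (Prod.mk.inj (List.inj_on_of_nodup_map h.nodup h1 h2 rfl)).1

theorem IsMatching.pair' {x : ℕ} (h : IsMatching n T x L) {y z : ℕ × ℕ} (hy : y ∈ lam)
    (hz : z ∈ lam) (h1 : (lab lam z, lab lam y) ∈ L) : lab lam y < lab lam z ∧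
    lab lam z ≤ x ∧ y.1 < n ∧ T y.1 y.2 = y.1 + 1 ∧ T z.1 z.2 = 2 * n - y.1 := by
  obtain ⟨y', hy', z', hz', e, h2⟩ := h.pair _ h1
  obtain ⟨e1, e2⟩ := Prod.mk.inj e
  rwa [lab_inj hy hy' e2, lab_inj hz hz' e1]

/-- The partners of comparable barred cells. -/
theorem IsMatching.closer_order (h : IsMatching n T (cells lam).length L) {z z' y y' : ℕ × ℕ}
    (hz : z ∈ lam) (hz' : z' ∈ lam) (hy : y ∈ lam) (hy' : y' ∈ lam)
    (h1 : (lab lam z, lab lam y) ∈ L) (h2 : (lab lam z', lab lam y') ∈ L) (hle : z ≤ z')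
    (hne : z ≠ z') : lab lam y' < lab lam y := by
  obtain ⟨-, -, a3, a4, a5⟩ := h.pair' hy hz h1
  obtain ⟨-, -, b3, b4, b5⟩ := h.pair' hy' hz' h2
  have hT := entry_le_of_le T hle hz'
  by_contra hlt
  have hyy : y ≠ y' := by
    rintro rfl
    exact hne (lab_inj hz hz' (h.snd_inj h1 h2))
  have hrb := readBefore_of_lt hy hy' (lt_of_le_of_ne (Nat.le_of_not_lt hlt)
    fun e => hyy (lab_inj hy hy' e))
  obtain ⟨b, c⟩ := y
  obtain ⟨b', c'⟩ := y'
  simp only [ReadBefore] at *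
  have hc : c' < c := by omega
  have hb : b' ≤ b := by omega
  -- Suppose `y` is read before `y'`. The cell `(b', c)`, to the right of `y'` and weakly above `y`,
  -- is unbarred, so its closer comes before `z'` and not before `z`. As `z ≤ z'`, that closer lies
  -- above `z'` in the same column and has the same letter, against strictness.
  have hm : (b', c) ∈ lam := lam.up_left_mem hb le_rfl hy
  have hmn : T b' c ≤ n := (T.col_weak hb hy).trans (by omega)
  obtain ⟨j, hj1, hj2⟩ := h.order (b', c') hy' (b', c) hm
    (Prod.mk_le_mk.2 ⟨le_rfl, hc.le⟩) (by simp; omega) hmn (lab_le hm) _ h2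
  obtain ⟨y'', hy'', z'', hz'', e, -⟩ := h.pair _ hj2
  obtain ⟨rfl, e2⟩ := Prod.mk.inj e
  have e3 := (h.pair' hm hz'' hj2).2.2.2.2
  simp only at e3
  rcases Nat.lt_or_eq_of_le hb with hb | rfl
  · obtain ⟨j', hj1', hj2'⟩ := h.order (b', c) hm (b, c) hy
      (Prod.mk_le_mk.2 ⟨hb.le, le_rfl⟩) (by simp; omega) (by simp only; omega) (lab_le hy) _ hj2
    obtain rfl := h.snd_inj h1 hj2'
    have k1 := readBefore_of_lt hz hz'' hj1'
    have k2 := readBefore_of_lt hz'' hz' hj1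
    obtain ⟨z1, z2⟩ := z
    obtain ⟨z1', z2'⟩ := z'
    obtain ⟨z1'', z2''⟩ := z''
    rw [Prod.mk_le_mk] at hle
    simp only [ReadBefore] at *
    obtain rfl : z2'' = z2' := by omega
    have := T.col_strict (show z1'' < z1' by omega) hz'
    omega
  · obtain e4 := lab_inj hz hz'' (h.snd_inj h1 hj2)
    subst e4
    have k2 := readBefore_of_lt hz hz' hj1
    obtain ⟨z1, z2⟩ := z
    obtain ⟨z1', z2'⟩ := z'
    rw [Prod.mk_le_mk] at hle
    simp only [ReadBefore] at *
    obtain rfl : z2 = z2' := by omega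
    have := T.col_strict (show z1 < z1' by omega) hz'
    omega

/-- The labels of the cells of `nu`, arranged in such a way that bumping them gives a tableau of
shape `nu`. -/
def pictureWord (lam nu : YoungDiagram) : List ℕ :=
  (List.range (nu.rowLen 0)).reverse.flatMap fun j =>
    (List.range (nu.colLen j)).reverse.map fun i => lab lam (i, j)

theorem isPicture_pictureWord {nu : YoungDiagram} (h : nu ≤ lam) :
    IsPicture lam nu (pictureWord lam nu) := by
  constructor
  · intro a
    simp only [pictureWord, List.mem_flatMap, List.mem_reverse, List.mem_range, List.mem_map]
    constructor
    · rintro ⟨j, -, i, hi, rfl⟩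
      exact ⟨(i, j), YoungDiagram.mem_iff_lt_colLen.2 hi, rfl⟩
    · rintro ⟨⟨i, j⟩, hp, rfl⟩
      exact ⟨j, YoungDiagram.mem_iff_lt_rowLen.1 (nu.up_left_mem (Nat.zero_le i) le_rfl hp), i,
        YoungDiagram.mem_iff_lt_colLen.1 hp, rfl⟩
  · rw [pictureWord, List.pairwise_flatMap]
    constructor
    · intro j _
      rw [List.pairwise_map, List.pairwise_reverse]
      refine List.pairwise_lt_range.imp_of_mem ?_
      intro i i' hi hi' hlt
      rw [List.mem_range] at hi hi'
      rw [cellAt_lab (h (YoungDiagram.mem_iff_lt_colLen.2 hi)),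
        cellAt_lab (h (YoungDiagram.mem_iff_lt_colLen.2 hi')), Prod.mk_le_mk]
      omega
    · rw [List.pairwise_reverse]
      refine List.pairwise_lt_range.imp ?_
      intro j j' hj a ha b hb
      simp only [List.mem_map, List.mem_reverse, List.mem_range] at ha hb
      obtain ⟨i, hi, rfl⟩ := ha
      obtain ⟨i', hi', rfl⟩ := hb
      rw [cellAt_lab (h (YoungDiagram.mem_iff_lt_colLen.2 hi)),
        cellAt_lab (h (YoungDiagram.mem_iff_lt_colLen.2 hi')), Prod.mk_le_mk]
      omega

/-- The shape of the unmatched cells is determined by the lengths of the rows. -/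
theorem mem_iff_mem_unmatched (h : IsMatching n T (cells lam).length L) {t : List (List ℕ)}
    (ht : IsTab lam (unmatched n T (cells lam).length L) t)
    (hrow : ∀ i, (row t i).length = mu.rowLen i) (p : ℕ × ℕ) :
    p ∈ mu ↔ p ∈ unmatched n T (cells lam).length L := by
  obtain ⟨i, k⟩ := p
  have hlow : ∀ k k', k' ≤ k → (i, k) ∈ unmatched n T (cells lam).length L →
      (i, k') ∈ unmatched n T (cells lam).length L := by
    intro k k' hk hik
    have h1 : (i, k') ≤ (i, k) := Prod.mk_le_mk.2 ⟨le_rfl, hk⟩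
    exact h.mem_unmatched (lab_le (lam.isLowerSet h1 hik.1)) h1 hik
  rw [YoungDiagram.mem_iff_lt_rowLen, ← hrow]
  constructor
  · intro hk
    by_contra hne
    have : (row t i).Subperm ((List.range k).map fun k => lab lam (i, k)) := by
      refine List.subperm_of_subset (nodup_of_lt (ht.2 i).1) ?_
      intro a ha
      obtain ⟨k', h1, rfl⟩ := ((ht.2 i).2 a).1 ha
      refine List.mem_map.2 ⟨k', List.mem_range.2 ?_, rfl⟩
      by_contra hlt
      exact hne (hlow k' k (by omega) h1)
    have := this.length_le
    rw [List.length_map, List.length_range] at this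
    omega
  · intro hik
    have : ((List.range (k + 1)).map fun k => lab lam (i, k)).Subperm (row t i) := by
      refine List.subperm_of_subset ?_ ?_
      · refine List.Nodup.map_on ?_ List.nodup_range
        intro a ha b hb hab
        rw [List.mem_range] at ha hb
        exact (Prod.mk.inj (lab_inj (hlow k a (by omega) hik).1 (hlow k b (by omega) hik).1 hab)).2
      · intro a ha
        obtain ⟨k', h1, rfl⟩ := List.mem_map.1 ha
        rw [List.mem_range] at h1
        exact ((ht.2 i).2 _).2 ⟨k', hlow k k' (by omega) hik, rfl⟩
    have := this.length_le
    rw [List.length_map, List.length_range] at this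
    omega

theorem mem_sortedTop {a : ℕ} : a ∈ sortedTop L ↔ ∃ e ∈ L, e.1 = a := by
  rw [sortedTop, List.mem_map]
  simp only [(List.perm_insertionSort (fun p q : ℕ × ℕ => p.2 ≤ q.2) L).mem_iff]

/-- The cells of `λ`, in the order of the bumping sequence, form a picture. -/
theorem IsMatching.isPicture (h : IsMatching n T (cells lam).length L)
    (hmu : ∀ p, p ∈ mu ↔ p ∈ unmatched n T (cells lam).length L) {V : List ℕ}
    (hV : IsPicture lam mu V) : IsPicture lam lam (bumpingSequence L ++ V) := by
  have hmul : mu ≤ lam := fun p hp => ((hmu p).1 hp).1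
  constructor
  · intro a
    rw [List.mem_append, (bumpingSequence_perm L).mem_iff, mem_labels, hV.1]
    constructor
    · rintro (⟨e, he, h1⟩ | ⟨p, hp, h1⟩)
      · obtain ⟨y, hy, z, hz, rfl, -⟩ := h.pair e he
        rcases h1 with h1 | h1
        · exact ⟨z, hz, h1⟩
        · exact ⟨y, hy, h1⟩
      · exact ⟨p, hmul hp, h1⟩
    · rintro ⟨p, hp, rfl⟩
      by_cases hpn : T p.1 p.2 ≤ n
      · by_cases hpm : ∀ j, (j, lab lam p) ∉ L
        · exact Or.inr ⟨p, (hmu p).2 ⟨hp, lab_le hp, hpn, hpm⟩, rfl⟩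
        · push Not at hpm
          obtain ⟨j, hj⟩ := hpm
          exact Or.inl ⟨_, hj, Or.inr rfl⟩
      · obtain ⟨y, hy, h1⟩ := h.barred p hp (lab_le hp) (by omega)
        exact Or.inl ⟨_, h1, Or.inl rfl⟩
  · have hop : ∀ a ∈ L.map Prod.snd, ∃ y ∈ lam, ∃ z ∈ lam, (lab lam z, lab lam y) ∈ L ∧
        lab lam y = a := by
      intro a ha
      obtain ⟨e, he, rfl⟩ := List.mem_map.1 ha
      obtain ⟨y, hy, z, hz, rfl, -⟩ := h.pair e he
      exact ⟨y, hy, z, hz, he, rfl⟩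
    have hcl : ∀ a ∈ sortedTop L, ∃ y ∈ lam, ∃ z ∈ lam, (lab lam z, lab lam y) ∈ L ∧
        lab lam z = a := by
      intro a ha
      obtain ⟨e, he, rfl⟩ := mem_sortedTop.1 ha
      obtain ⟨y, hy, z, hz, rfl, -⟩ := h.pair e he
      exact ⟨y, hy, z, hz, he, rfl⟩
    rw [bumpingSequence_eq, List.append_assoc, List.pairwise_append, List.pairwise_append]
    refine ⟨?_, ⟨?_, hV.2, ?_⟩, ?_⟩
    · rw [sortedTop, List.pairwise_map]
      refine h.isBurge.pairwise_sort.imp_of_mem ?_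
      intro e e' he he' hlt hle
      rw [(List.perm_insertionSort _ L).mem_iff] at he he'
      obtain ⟨y, hy, z, hz, rfl, -⟩ := h.pair e he
      obtain ⟨y', hy', z', hz', rfl, -⟩ := h.pair e' he'
      rw [cellAt_lab hz, cellAt_lab hz'] at hle
      by_cases hne : z = z'
      · subst hne
        have := h.fst_inj he he'
        simp only at hlt
        omega
      · have := h.closer_order hz hz' hy hy' he he' hle hne
        simp only at hlt
        omega
    · rw [List.pairwise_map]
      refine h.isBurge.pairwise.imp_of_mem ?_
      intro e e' he he' hlt hle
      obtain ⟨y, hy, z, hz, rfl, -⟩ := h.pair e he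
      obtain ⟨y', hy', z', hz', rfl, h2, h3, h4, h5, h6⟩ := h.pair e' he'
      rw [cellAt_lab hy, cellAt_lab hy'] at hle
      by_cases hne : y = y'
      · subst hne
        have := h.snd_inj he he'
        simp only at hlt
        omega
      · obtain ⟨j, hj1, hj2⟩ := h.order y hy y' hy' hle hne (by omega) (lab_le hy') _ he
        have := h.snd_inj he' hj2
        simp only at hlt
        omega
    · intro a ha b hb hle
      obtain ⟨y, hy, z, hz, h1, rfl⟩ := hop a ha
      obtain ⟨q, hq, rfl⟩ := (hV.1 b).1 hb
      rw [cellAt_lab hy, cellAt_lab (hmul hq)] at hle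
      have := h.mem_unmatched (lab_le hy) hle ((hmu q).1 hq)
      exact this.2.2.2 _ h1
    · intro a ha b hb hle
      obtain ⟨y, hy, z, hz, h1, rfl⟩ := hcl a ha
      obtain ⟨-, -, h3, -, h5⟩ := h.pair' hy hz h1
      rw [cellAt_lab hz] at hle
      rcases List.mem_append.1 hb with hb | hb
      · obtain ⟨y', hy', z', hz', h1', rfl⟩ := hop b hb
        rw [cellAt_lab hy'] at hle
        have := entry_le_of_le T hle hy'
        have := h.pair' hy' hz' h1'
        omega
      · obtain ⟨q, hq, rfl⟩ := (hV.1 b).1 hb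
        rw [cellAt_lab (hmul hq)] at hle
        have := entry_le_of_le T hle (hmul hq)
        have := ((hmu q).1 hq).2.2.1
        omega

/-- The picture in which the bumping sequence is replaced by the rows of the even tableau. -/
theorem IsPicture.rows (hL : IsBurge L) {V : List ℕ}
    (h : IsPicture lam lam (bumpingSequence L ++ V)) :
    IsPicture lam lam ((colRead (burgeRows L)).reverse ++ V) := by
  have := (knuth_rowBump hL.nodup).reverse
  rw [List.reverse_reverse] at this
  exact h.knuth (this.append_right V)

theorem IsPicture.of_rows (hL : IsBurge L) {V : List ℕ}
    (h : IsPicture lam lam ((colRead (burgeRows L)).reverse ++ V)) :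
    IsPicture lam lam (bumpingSequence L ++ V) := by
  have := (knuth_rowBump hL.nodup).reverse
  rw [List.reverse_reverse] at this
  exact h.knuth (this.append_right V).symm

end

section

/-! ### Fillings of skew diagrams -/

variable {lam mu : YoungDiagram} {L : List (ℕ × ℕ)}

/-- The labels of the cells of `λ / μ`. -/
def skewLabels (lam mu : YoungDiagram) : List ℕ :=
  ((cells lam).filter fun p => p ∉ mu).map (lab lam)

theorem mem_skewLabels {a : ℕ} :
    a ∈ skewLabels lam mu ↔ ∃ p ∈ lam, p ∉ mu ∧ lab lam p = a := by
  simp only [skewLabels, List.mem_map, List.mem_filter, mem_cells, decide_eq_true_eq, and_assoc]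

theorem skewLabels_pairwise (lam mu : YoungDiagram) :
    (skewLabels lam mu).Pairwise (· < ·) := by
  rw [skewLabels, List.pairwise_map]
  refine ((cells_pairwise lam).filter _).imp_of_mem ?_
  intro p q hp hq h
  exact (lab_lt_iff (mem_cells.1 (List.mem_of_mem_filter hp))
    (mem_cells.1 (List.mem_of_mem_filter hq))).2 h

theorem skewWord_eq (S : ℕ → ℕ → ℕ) : skewWord lam mu S =
    (skewLabels lam mu).map fun a => S (cellAt lam a).1 (cellAt lam a).2 := by
  have h1 : skewWord lam mu S = ((cells lam).filter fun p => p ∉ mu).map fun p => S p.1 p.2 := by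
    rw [skewWord, cells, List.filter_flatMap, List.map_flatMap]
    congr 1
    funext j
    rw [List.filter_map, List.map_map]
    congr 1
    apply List.filter_congr
    intro i _
    simp only [Function.comp, YoungDiagram.mem_iff_lt_colLen, not_lt]
  rw [h1, skewLabels, List.map_map]
  apply List.map_congr_left
  intro p hp
  simp [cellAt_lab (mem_cells.1 (List.mem_of_mem_filter hp))]

/-- Initial subwords are thus given by bounds on the labels. Positivity lets the bound 0 describe
the empty subword. -/
theorem exists_take_eq_filter {l : List ℕ} (hl : l.Pairwise (· < ·)) (hpos : ∀ a ∈ l, 0 < a)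
    (m : ℕ) : ∃ b, l.take m = l.filter (· ≤ b) := by
  induction l generalizing m with
  | nil => exact ⟨0, by simp⟩
  | cons a l ih =>
    cases m with
    | zero =>
      refine ⟨0, ?_⟩
      rw [List.take_zero, eq_comm, List.filter_eq_nil_iff]
      intro b hb
      have := hpos b hb
      simp only [decide_eq_true_eq]
      omega
    | succ m =>
      rw [List.pairwise_cons] at hl
      obtain ⟨b, hb⟩ := ih hl.2 (fun c hc => hpos c (List.mem_cons_of_mem _ hc)) m
      rcases le_total a b with hab | hab
      · exact ⟨b, by rw [List.take_succ_cons, hb, List.filter_cons_of_pos (by simpa using hab)]⟩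
      · refine ⟨a, ?_⟩
        rw [List.take_succ_cons, hb, List.filter_cons_of_pos (by simp)]
        congr 1
        apply List.filter_congr
        intro c hc
        have := hl.1 c hc
        simp only [decide_eq_decide]
        omega

theorem filter_le_prefix {l : List ℕ} (hl : l.Pairwise (· < ·)) (b : ℕ) :
    l.filter (· ≤ b) <+: l := by
  induction l with
  | nil => simp
  | cons a l ih =>
    rw [List.pairwise_cons] at hl
    by_cases hab : a ≤ b
    · rw [List.filter_cons_of_pos (by simpa using hab)]
      exact List.prefix_cons_inj a |>.2 (ih hl.2)
    · have : (a :: l).filter (· ≤ b) = [] := by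
        rw [List.filter_eq_nil_iff]
        intro c hc
        rcases List.mem_cons.1 hc with rfl | hc
        · simpa using hab
        · have := hl.1 c hc
          simp only [decide_eq_true_eq]
          omega
      rw [this]
      exact List.nil_prefix

theorem isDominantWord_map {l : List ℕ} (hl : l.Pairwise (· < ·)) (hpos : ∀ a ∈ l, 0 < a)
    (g : ℕ → ℕ) : IsDominantWord (l.map g) ↔ ∀ b i, 1 ≤ i →
      (l.filter (· ≤ b)).countP (fun a => g a = i + 1) ≤
        (l.filter (· ≤ b)).countP fun a => g a = i := by
  have hcount : ∀ (l : List ℕ) (i : ℕ), (l.map g).count i = l.countP fun a => g a = i := by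
    intro l i
    rw [List.count, List.countP_map]
    apply List.countP_congr
    intro a _
    simp
  constructor
  · intro h b i hi
    rw [← hcount, ← hcount]
    exact h _ ((filter_le_prefix hl b).map g) i hi
  · intro h u hu i hi
    rw [List.prefix_iff_eq_take] at hu
    rw [hu, ← List.map_take, hcount, hcount]
    obtain ⟨b, hb⟩ := exists_take_eq_filter hl hpos u.length
    rw [hb]
    exact h b i hi

/-- The filling of `λ / μ` by the indices of the rows of the even tableau. -/
def fill (lam mu : YoungDiagram) (L : List (ℕ × ℕ)) (i j : ℕ) : ℕ :=
  if (i, j) ∈ lam ∧ (i, j) ∉ mu then colIdx (burgeRows L) (lab lam (i, j)) + 1 else 0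

theorem fill_cellAt {a : ℕ} (ha : a ∈ skewLabels lam mu) :
    fill lam mu L (cellAt lam a).1 (cellAt lam a).2 = colIdx (burgeRows L) a + 1 := by
  obtain ⟨p, h1, h2, rfl⟩ := mem_skewLabels.1 ha
  rw [cellAt_lab h1, fill, if_pos ⟨h1, h2⟩]

theorem mem_labels_iff (hmu : mu ≤ lam) {V : List ℕ} (hV : IsPicture lam mu V)
    (h : IsPicture lam lam (bumpingSequence L ++ V)) (a : ℕ) :
    a ∈ labels L ↔ a ∈ skewLabels lam mu := by
  have h1 := h.1 a
  rw [List.mem_append, (bumpingSequence_perm L).mem_iff, hV.1] at h1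
  rw [mem_skewLabels]
  have hn := List.nodup_append.1 h.nodup
  constructor
  · intro ha
    obtain ⟨p, hp, rfl⟩ := h1.1 (Or.inl ha)
    refine ⟨p, hp, fun hpm => ?_, rfl⟩
    exact hn.2.2 _ ((bumpingSequence_perm L).mem_iff.2 ha) _ ((hV.1 _).2 ⟨p, hpm, rfl⟩) rfl
  · rintro ⟨p, hp, hpm, rfl⟩
    rcases h1.2 ⟨p, hp, rfl⟩ with h2 | ⟨q, hq, h3⟩
    · exact h2
    · rw [lab_inj (hmu hq) hp h3] at hq
      exact absurd hq hpm

theorem rows_perm (hL : IsBurge L) (hlab : ∀ a, a ∈ labels L ↔ a ∈ skewLabels lam mu) :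
    (burgeRows L).flatten.Perm (skewLabels lam mu) :=
  (List.perm_ext_iff_of_nodup hL.std.2.2 (nodup_of_lt (skewLabels_pairwise lam mu))).2 fun a => by
    rw [mem_burgeRows, hlab]

theorem countP_filter_le {t : List (List ℕ)} (ht : t.flatten.Nodup) {l : List ℕ}
    (h : t.flatten.Perm l) (b s : ℕ) :
    (l.filter (· ≤ b)).countP (fun a => colIdx t a = s) = (t.getD s []).countP (· ≤ b) := by
  rw [← (h.filter _).countP_eq, List.countP_eq_length_filter, List.countP_eq_length_filter,
    List.filter_filter]
  have hs : (t.getD s []).Nodup := by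
    by_cases hs : s < t.length
    · rw [List.getD_eq_getElem _ _ hs]
      exact ht.sublist (List.sublist_flatten_of_mem (List.getElem_mem hs))
    · rw [List.getD_eq_default _ _ (by omega)]
      exact List.nodup_nil
  refine List.Perm.length_eq ((List.perm_ext_iff_of_nodup (ht.filter _) (hs.filter _)).2 ?_)
  intro a
  simp only [List.mem_filter, mem_getD_iff ht, Bool.and_eq_true, decide_eq_true_eq]
  tauto

theorem Std.dom_getD {t : List (List ℕ)} (h : Std t) (s : ℕ) :
    Dom (t.getD s []) (t.getD (s + 1) []) := by
  by_cases hs : s + 1 < t.length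
  · rw [List.getD_eq_getElem _ _ hs, List.getD_eq_getElem _ _ (by omega)]
    exact List.pairwise_iff_getElem.1 h.2.1 s (s + 1) (by omega) hs (by omega)
  · rw [List.getD_eq_default _ _ (show t.length ≤ s + 1 by omega)]
    exact dom_nil _

/-- The letters `s + 1` in the initial subword with labels up to `b` are the entries `≤ b` of row
`s` of the even tableau. So the lattice condition is exactly the domination of each row over the
next one. -/
theorem isDominantWord_fill (hL : IsBurge L)
    (hlab : ∀ a, a ∈ labels L ↔ a ∈ skewLabels lam mu) :
    IsDominantWord (skewWord lam mu (fill lam mu L)) := by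
  have hpos : ∀ a ∈ skewLabels lam mu, 0 < a := by
    intro a ha
    obtain ⟨p, -, -, rfl⟩ := mem_skewLabels.1 ha
    exact lab_pos
  rw [skewWord_eq, isDominantWord_map (skewLabels_pairwise lam mu) hpos]
  intro b i hi
  obtain ⟨s, rfl⟩ : ∃ s, i = s + 1 := ⟨i - 1, by omega⟩
  have hc : ∀ s, ((skewLabels lam mu).filter (· ≤ b)).countP
      (fun a => fill lam mu L (cellAt lam a).1 (cellAt lam a).2 = s + 1) =
      ((burgeRows L).getD s []).countP (· ≤ b) := by
    intro s
    rw [← countP_filter_le hL.std.2.2 (rows_perm hL hlab)]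
    apply List.countP_congr
    intro a ha
    rw [fill_cellAt (List.mem_of_mem_filter ha)]
    simp
  rw [hc, hc]
  exact hL.std.dom_getD s b

theorem count_fill (hL : IsBurge L) (hlab : ∀ a, a ∈ labels L ↔ a ∈ skewLabels lam mu) (s : ℕ) :
    (skewWord lam mu (fill lam mu L)).count (s + 1) = len (burgeRows L) s := by
  rw [skewWord_eq, List.count, List.countP_map, len_eq_countP hL.std.2.2,
    (rows_perm hL hlab).countP_eq]
  apply List.countP_congr
  intro a ha
  simp [fill_cellAt ha]

/-- The row indices of comparable cells of `λ / μ` in the even tableau. -/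
theorem colIdx_order (hL : IsBurge L) {V : List ℕ}
    (h : IsPicture lam lam ((colRead (burgeRows L)).reverse ++ V)) {p q : ℕ × ℕ} (hp : p ∈ lam)
    (hq : q ∈ lam) (hpL : lab lam p ∈ labels L) (hqL : lab lam q ∈ labels L) (hle : p ≤ q)
    (hne : p ≠ q) :
    colIdx (burgeRows L) (lab lam p) < colIdx (burgeRows L) (lab lam q) ∨
      colIdx (burgeRows L) (lab lam p) = colIdx (burgeRows L) (lab lam q) ∧
        lab lam q < lab lam p := by
  have h1 := (List.pairwise_append.1 h.2).1
  have h2 : (colRead (burgeRows L)).reverse.Pairwise fun a b =>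
      colIdx (burgeRows L) b < colIdx (burgeRows L) a ∨
        colIdx (burgeRows L) b = colIdx (burgeRows L) a ∧ a < b := by
    rw [List.pairwise_reverse]
    exact (colRead_pairwise hL.std).imp fun h => by omega
  have hmem : ∀ a, a ∈ labels L → a ∈ (colRead (burgeRows L)).reverse := by
    intro a ha
    rw [List.mem_reverse, mem_colRead, mem_burgeRows]
    exact ha
  -- In a picture the south-eastern cell `q` comes first. The row reading word lists the rows from
  -- the last to the first, each from left to right, so `q` is in a later row, or in the same row
  -- with a smaller label.
  have h3 := idxOf_lt_of_pairwise h1 (hmem _ hpL) (hmem _ hqL) (fun e => hne (lab_inj hp hq e))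
    (by rw [cellAt_lab hp, cellAt_lab hq]; exact fun h => h hle)
  exact rel_of_idxOf_lt h2 (hmem _ hpL) h3

theorem exists_diagram (f : ℕ → ℕ) (hf : ∀ i j, i ≤ j → f j ≤ f i) (N : ℕ) (hN : f N = 0) :
    ∃ eta : YoungDiagram, ∀ j, eta.colLen j = f j := by
  have hmem : ∀ p : ℕ × ℕ, p ∈ (Finset.range (f 0) ×ˢ Finset.range N).filter (fun p => p.1 < f p.2) ↔
      p.1 < f p.2 := by
    intro p
    simp only [Finset.mem_filter, Finset.mem_product, Finset.mem_range, and_iff_right_iff_imp]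
    intro h
    refine ⟨h.trans_le (hf 0 _ (Nat.zero_le _)), ?_⟩
    by_contra hlt
    have := hf N p.2 (by omega)
    omega
  refine ⟨⟨(Finset.range (f 0) ×ˢ Finset.range N).filter (fun p => p.1 < f p.2), ?_⟩, ?_⟩
  · intro p q hqp hp
    rw [Finset.mem_coe, hmem] at hp ⊢
    have h1 := (Prod.le_def.1 hqp).1
    have h2 := hf _ _ (Prod.le_def.1 hqp).2
    omega
  · intro j
    refine eq_of_forall_lt_iff fun i => ?_
    rw [← YoungDiagram.mem_iff_lt_colLen, ← YoungDiagram.mem_cells]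
    exact hmem (i, j)

theorem rowLen_of_hasShape {t : List (List ℕ)} (ht : Reg t) {eta : YoungDiagram}
    (h : HasShape t eta) (i : ℕ) : (row t i).length = eta.rowLen i := by
  refine eq_of_forall_lt_iff fun j => ?_
  rw [← YoungDiagram.mem_iff_lt_rowLen, YoungDiagram.mem_iff_lt_colLen, ← h j]
  have h2 := ht.getElem?_row i j
  constructor
  · intro hi
    rw [List.getElem?_eq_getElem hi] at h2
    exact (List.getElem?_eq_some_iff.1 h2.symm).1
  · intro hj
    rw [List.getElem?_eq_getElem hj] at h2
    exact (List.getElem?_eq_some_iff.1 h2).1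

theorem Std.reg {t : List (List ℕ)} (h : Std t) : Reg t := ⟨h.isStandard.1, h.isStandard.2.1⟩

theorem IsBurge.exists_evenShape (hL : IsBurge L) :
    ∃ eta : YoungDiagram, IsEvenShape eta ∧ HasShape (bumpAll (bumpingSequence L) []) eta ∧
      (∀ s, eta.rowLen s = len (burgeRows L) s) := by
  obtain ⟨eta, heta⟩ := exists_diagram (len (bumpAll (bumpingSequence L) []))
    (fun i j hij => (std_bumpAll hL.nodup).len_le hij)
    (bumpAll (bumpingSequence L) []).length (by simp [len])
  have hs : HasShape (bumpAll (bumpingSequence L) []) eta := fun j => (heta j).symm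
  refine ⟨eta, fun j => by rw [heta]; exact hL.even_len j, hs, fun s => ?_⟩
  rw [← rowLen_of_hasShape (std_bumpAll hL.nodup).reg hs, row_bumpAll hL.nodup]
  rfl

end

section

/-! ### The filling of a dominant tableau -/

variable {lam mu : YoungDiagram} {n : ℕ} {T : SemistandardYoungTableau lam} {L : List (ℕ × ℕ)}

theorem lt_numRows {t : List (List ℕ)} (ht : Reg t) {i a : ℕ} (ha : a ∈ row t i) :
    i < numRows t := by
  cases t with
  | nil => simp at ha
  | cons d t =>
    by_contra hlt
    rw [(ht.row_eq_nil (by simpa [numRows] using hlt)).1] at ha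
    simp at ha

theorem weakly_increasing_row (hL : IsBurge L)
    (hlab : ∀ a, a ∈ labels L ↔ a ∈ skewLabels lam mu)
    (h : IsPicture lam lam ((colRead (burgeRows L)).reverse ++ pictureWord lam mu)) {i j k : ℕ}
    (hjk : j < k) (hj : (i, j) ∉ mu) (hk : (i, k) ∈ lam) :
    colIdx (burgeRows L) (lab lam (i, j)) ≤ colIdx (burgeRows L) (lab lam (i, k)) := by
  have hj' : (i, j) ∈ lam := lam.up_left_mem le_rfl hjk.le hk
  have hk' : (i, k) ∉ mu := fun h => hj (mu.up_left_mem le_rfl hjk.le h)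
  have := colIdx_order hL h hj' hk ((hlab _).2 (mem_skewLabels.2 ⟨_, hj', hj, rfl⟩))
    ((hlab _).2 (mem_skewLabels.2 ⟨_, hk, hk', rfl⟩)) (Prod.mk_le_mk.2 ⟨le_rfl, hjk.le⟩)
    (by simp; omega)
  omega

/-- Both lists are weakly increasing, so it is enough that they have the same values with
multiplicities. These come from the labels of row `i` of λ/μ, since the final Q-symbol puts each
label into the row of its cell. The right side increases by the picture property. -/
theorem fillingRow_eq (hL : IsBurge L) (hlab : ∀ a, a ∈ labels L ↔ a ∈ skewLabels lam mu)
    (h : IsPicture lam lam ((colRead (burgeRows L)).reverse ++ pictureWord lam mu))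
    {w : List ℕ} (hw : twoLineArray n w = L) (hQ : IsTab lam {p | p ∈ lam} (finalQ n w)) (i : ℕ) :
    fillingRow n w i = (List.range (lam.rowLen i - mu.rowLen i)).map fun d =>
      colIdx (burgeRows L) (lab lam (i, mu.rowLen i + d)) + 1 := by
  have hE : evenTableau n w = bumpAll (bumpingSequence L) [] := by rw [evenTableau, hw]
  have hsE := std_bumpAll hL.nodup
  have hrow : ∀ k x, x ∈ row (bumpAll (bumpingSequence L) []) k ↔
      x ∈ labels L ∧ colIdx (burgeRows L) x = k := by
    intro k x
    rw [row_bumpAll hL.nodup, ← mem_burgeRows]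
    exact mem_getD_iff hL.std.2.2
  set F := (List.range (numRows (evenTableau n w))).flatMap fun k =>
    (row (evenTableau n w) k).filter fun x => x ∈ row (finalQ n w) i with hF
  have hfF : fillingRow n w i = F.map fun x => colIdx (burgeRows L) x + 1 := by
    rw [fillingRow, hF, List.map_flatMap]
    congr 1
    funext k
    apply List.map_congr_left
    intro x hx
    rw [hE, List.mem_filter, hrow] at hx
    rw [hx.1.2]
  have hFn : F.Nodup := by
    rw [hF, hE, List.Nodup, List.pairwise_flatMap]
    refine ⟨fun k _ => (nodup_of_lt (hsE.pairwise_row k)).filter _, ?_⟩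
    refine List.nodup_range.imp ?_
    intro k k' hk x hx y hy hxy
    subst hxy
    rw [List.mem_filter, hrow] at hx hy
    exact hk (hx.1.2.symm.trans hy.1.2)
  have hmemF : ∀ x, x ∈ F ↔ x ∈ labels L ∧ ∃ c, (i, c) ∈ lam ∧ lab lam (i, c) = x := by
    intro x
    rw [hF, hE, List.mem_flatMap]
    simp only [List.mem_range, List.mem_filter, decide_eq_true_eq]
    constructor
    · rintro ⟨k, h1, h2, h3⟩
      exact ⟨((hrow k x).1 h2).1, ((hQ.2 i).2 x).1 h3⟩
    · rintro ⟨h1, h2⟩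
      have h3 := (hrow _ x).2 ⟨h1, rfl⟩
      exact ⟨_, lt_numRows hsE.reg h3, h3, ((hQ.2 i).2 x).2 h2⟩
  have hcell : ∀ d, d < lam.rowLen i - mu.rowLen i → (i, mu.rowLen i + d) ∈ lam ∧
      (i, mu.rowLen i + d) ∉ mu := by
    intro d hd
    rw [YoungDiagram.mem_iff_lt_rowLen, YoungDiagram.mem_iff_lt_rowLen]
    omega
  have hperm : F.Perm ((List.range (lam.rowLen i - mu.rowLen i)).map fun d =>
      lab lam (i, mu.rowLen i + d)) := by
    refine (List.perm_ext_iff_of_nodup hFn ?_).2 ?_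
    · refine List.Nodup.map_on ?_ List.nodup_range
      intro d hd d' hd' e
      rw [List.mem_range] at hd hd'
      have := (Prod.mk.inj (lab_inj (hcell d hd).1 (hcell d' hd').1 e)).2
      omega
    · intro x
      rw [hmemF, hlab, mem_skewLabels, List.mem_map]
      constructor
      · rintro ⟨⟨p, h1, h2, rfl⟩, c, h3, h4⟩
        obtain rfl := lab_inj h3 h1 h4
        rw [YoungDiagram.mem_iff_lt_rowLen] at h1 h2
        exact ⟨c - mu.rowLen i, List.mem_range.2 (by omega), by
          rw [show mu.rowLen i + (c - mu.rowLen i) = c by omega]⟩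
      · rintro ⟨d, hd, rfl⟩
        rw [List.mem_range] at hd
        exact ⟨⟨_, (hcell d hd).1, (hcell d hd).2, rfl⟩, _, (hcell d hd).1, rfl⟩
  refine List.Perm.eq_of_pairwise (le := (· ≤ ·)) (fun a b _ _ => le_antisymm) ?_ ?_ ?_
  · rw [fillingRow, List.pairwise_flatMap]
    constructor
    · intro k _
      rw [List.pairwise_map]
      exact List.pairwise_of_forall fun _ _ => le_rfl
    · refine List.pairwise_lt_range.imp ?_
      intro k k' hk x hx y hy
      obtain ⟨_, -, rfl⟩ := List.mem_map.1 hx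
      obtain ⟨_, -, rfl⟩ := List.mem_map.1 hy
      omega
  · rw [List.pairwise_map]
    refine List.pairwise_lt_range.imp_of_mem ?_
    intro d d' hd hd' hlt
    rw [List.mem_range] at hd hd'
    have := weakly_increasing_row hL hlab h (show mu.rowLen i + d < mu.rowLen i + d' by omega)
      (hcell d hd).2 (hcell d' hd').1
    omega
  · rw [hfF]
    refine (hperm.map _).trans (List.Perm.of_eq ?_)
    rw [List.map_map]
    rfl

theorem phi_eq_fill (hL : IsBurge L)
    (hlab : ∀ a, a ∈ labels L ↔ a ∈ skewLabels lam mu)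
    (h : IsPicture lam lam ((colRead (burgeRows L)).reverse ++ pictureWord lam mu))
    (hw : twoLineArray n (word T) = L) (hQ : IsTab lam {p | p ∈ lam} (finalQ n (word T))) :
    phi n mu T = fill lam mu L := by
  funext i j
  have e1 : (i, j) ∈ lam ↔ j < lam.rowLen i := YoungDiagram.mem_iff_lt_rowLen
  have e2 : (i, j) ∈ mu ↔ j < mu.rowLen i := YoungDiagram.mem_iff_lt_rowLen
  rw [phi, fill, fillingRow_eq hL hlab h hw hQ]
  by_cases h1 : j < mu.rowLen i
  · rw [if_pos h1, if_neg (by rw [e2]; exact fun h => h.2 h1)]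
  · rw [if_neg h1]
    by_cases h2 : j < lam.rowLen i
    · rw [if_pos ⟨e1.2 h2, fun h => h1 (e2.1 h)⟩, List.getD_eq_getElem _ _ (by simp; omega)]
      simp [show mu.rowLen i + (j - mu.rowLen i) = j by omega]
    · rw [if_neg (by rw [e1]; exact fun h => h2 h.1), List.getD_eq_default _ _ (by simp; omega)]

/-- The tableaux that are attached to a dominant tableau. -/
structure IsDominantPicture (n : ℕ) (mu : YoungDiagram) (T : SemistandardYoungTableau lam) : Prop
    where
  le : mu ≤ lam
  matching : IsMatching n T (cells lam).length (twoLineArray n (word T))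
  partial_tab : IsTab lam {p | p ∈ mu} (partialQ n (word T))
  final_tab : IsTab lam {p | p ∈ lam} (finalQ n (word T))
  picture : IsPicture lam lam (bumpingSequence (twoLineArray n (word T)) ++ pictureWord lam mu)

theorem isDominantPicture (hT : T ∈ domres n lam mu) : IsDominantPicture n mu T := by
  have hs := isState_upDown hT _ le_rfl
  rw [← length_word T, List.take_length] at hs
  have hw : ∀ i, (row (partialQ n (word T)) i).length = mu.rowLen i := by
    intro i
    have h1 := hs.weight_eq i
    rw [List.take_length, hT.2.2.2 i] at h1
    exact_mod_cast h1
  rw [length_word] at hs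
  have hmem := mem_iff_mem_unmatched hs.matching hs.tab hw
  have hle : mu ≤ lam := fun p hp => ((hmem p).1 hp).1
  have hP : IsTab lam {p | p ∈ mu} (partialQ n (word T)) := hs.tab.congr fun p => (hmem p).symm
  have hpic := hs.matching.isPicture hmem (isPicture_pictureWord hle)
  refine ⟨hle, hs.matching, hP, ?_, hpic⟩
  -- The partial Q-symbol equals the tableau bumped from a picture of μ, so the final Q-symbol is
  -- bumped from the single word that was shown to be a picture of λ.
  rw [finalQ, hP.ext ((isPicture_pictureWord hle).isTab hle), ← bumpAll_append]
  exact hpic.isTab le_rfl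

theorem IsDominantPicture.mem_labels (h : IsDominantPicture n mu T) (a : ℕ) :
    a ∈ labels (twoLineArray n (word T)) ↔ a ∈ skewLabels lam mu :=
  mem_labels_iff h.le (isPicture_pictureWord h.le) h.picture a

theorem IsDominantPicture.phi_eq (h : IsDominantPicture n mu T) :
    phi n mu T = fill lam mu (twoLineArray n (word T)) :=
  phi_eq_fill h.matching.isBurge h.mem_labels (h.picture.rows h.matching.isBurge) rfl h.final_tab

/-! ### The bound for the rows of odd index -/

/-- Each further array column acts on the old labels by one insertion, under which an entry stays or
moves to the next row. -/
theorem colIdx_mono {L' : List (ℕ × ℕ)} (h : IsBurge (L ++ L')) {a : ℕ} (ha : a ∈ labels L) :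
    colIdx (burgeRows L) a ≤ colIdx (burgeRows (L ++ L')) a := by
  induction L' using List.reverseRecOn with
  | nil => simp
  | append_singleton L' e ih =>
    rw [← List.append_assoc] at h ⊢
    have hB := h.of_prefix
    have ha' : a ∈ labels (L ++ L') := by
      rw [SymplecticBranching.mem_labels] at ha ⊢
      obtain ⟨e, he, h1⟩ := ha
      exact ⟨e, List.mem_append_left _ he, h1⟩
    refine (ih hB).trans ?_
    obtain ⟨h1, -, -⟩ := h.burgeRows_concat h.lt_of_concat
    rw [h1 a (List.mem_cons_of_mem _ ha')]
    have hn := (labels_concat _ e).nodup_iff.1 h.2.1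
    rw [List.nodup_cons, List.nodup_cons] at hn
    rcases colIdx_columnInsert hB.std.2.2 (x := e.2) (by rw [mem_burgeRows]; exact hn.2.1)
      (mem_burgeRows.2 ha') with h2 | h2
    · exact h2.ge
    · omega

/-- Since `i' < i`, the letter `j + 1` precedes `j` in the sorted upper line. Knuth equivalence
keeps this order in the row reading word, where a larger entry can precede a smaller one only from a
lower row. -/
theorem colIdx_lt_of_consecutive (h : IsBurge L) {j i i' : ℕ} (h1 : (j, i) ∈ L)
    (h2 : (j + 1, i') ∈ L) (hi : i' < i) :
    colIdx (burgeRows L) j < colIdx (burgeRows L) (j + 1) := by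
  have hj : j ∈ sortedTop L := mem_sortedTop.2 ⟨_, h1, rfl⟩
  have hj1 : j + 1 ∈ sortedTop L := mem_sortedTop.2 ⟨_, h2, rfl⟩
  have h3 : (bumpingSequence L).Pairwise fun p q => ¬ (p = j ∧ q = j + 1) := by
    rw [bumpingSequence_eq, List.pairwise_append]
    have hn := List.nodup_append.1 h.nodup
    refine ⟨?_, ?_, ?_⟩
    · rw [sortedTop, List.pairwise_map]
      refine h.pairwise_sort.imp_of_mem ?_
      rintro e e' he he' hlt ⟨e1, e2⟩
      rw [(List.perm_insertionSort _ L).mem_iff] at he he'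
      have k1 := h.eq_of_label he h1 (Or.inl e1) (Or.inl rfl)
      have k2 := h.eq_of_label he' h2 (Or.inl e2) (Or.inl rfl)
      rw [k1, k2] at hlt
      simp only at hlt
      omega
    · refine List.Pairwise.imp_of_mem ?_ hn.2.1
      rintro p q hp hq - ⟨rfl, -⟩
      exact hn.2.2 _ hj _ hp rfl
    · rintro p hp q hq ⟨-, rfl⟩
      exact hn.2.2 _ hj1 _ hq rfl
  have h5 := (knuth_rowBump h.nodup)
  have h6 : (colRead (burgeRows L)).reverse.Pairwise fun p q => ¬ (p = j ∧ q = j + 1) := by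
    have := h5.reverse
    rw [List.reverse_reverse] at this
    exact (this.pairwise_succ j).1 h3
  rw [List.pairwise_reverse] at h6
  have hm : ∀ a, a ∈ labels L → a ∈ colRead (burgeRows L) := fun a ha => by
    rw [mem_colRead, mem_burgeRows]; exact ha
  have hmj := hm j (SymplecticBranching.mem_labels.2 ⟨_, h1, Or.inl rfl⟩)
  have hmj1 := hm (j + 1) (SymplecticBranching.mem_labels.2 ⟨_, h2, Or.inl rfl⟩)
  have h7 := idxOf_lt_of_pairwise h6 hmj1 hmj (by omega) (by simp)
  have h8 := rel_of_idxOf_lt (colRead_pairwise h.std) hmj1 h7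
  omega

/-- The first-column cells from row `n` on are barred because columns increase strictly. For two
consecutive ones the partners decrease, so the later label lies strictly below the earlier one,
which has index at least `2 * d + 1`. A newly added upper entry has odd index, so the bound jumps to
`2 * d + 3`. -/
theorem IsMatching.le_colIdx_insert (h : IsMatching n T (cells lam).length L)
    (hT : ∀ i j, (i, j) ∈ lam → 1 ≤ T i j) (d : ℕ) (hd : (n + d, 0) ∈ lam)
    {L1 L2 : List (ℕ × ℕ)} {a : ℕ} (hL : L = L1 ++ (lab lam (n + d, 0), a) :: L2) :
    2 * d + 1 ≤
      colIdx (burgeRows (L1 ++ [(lab lam (n + d, 0), a)])) (lab lam (n + d, 0)) := by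
  have hB : ∀ {L1 L2 : List (ℕ × ℕ)} {e}, L = L1 ++ e :: L2 → IsBurge (L1 ++ [e]) := by
    intro L1 L2 e hL
    have := h.isBurge
    rw [hL, show L1 ++ e :: L2 = L1 ++ [e] ++ L2 by simp] at this
    exact this.of_prefix
  induction d generalizing L1 L2 a with
  | zero =>
    obtain ⟨-, -, h3⟩ := (hB hL).burgeRows_concat (hB hL).lt_of_concat
    simp only at h3
    omega
  | succ d ih =>
    have hd' : (n + d, 0) ∈ lam := lam.up_left_mem (by omega) le_rfl hd
    have h1 := le_entry_of_col T hT hd'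
    obtain ⟨y', hy', hm'⟩ := h.barred _ hd' (lab_le hd') (by simp only; omega)
    have hlab : lab lam (n + (d + 1), 0) = lab lam (n + d, 0) + 1 := lab_succ hd
    obtain ⟨y, hy, z, hz, e, -⟩ := h.pair (lab lam (n + (d + 1), 0), a) (by simp [hL])
    obtain ⟨e1, rfl⟩ := Prod.mk.inj e
    have hm : (lab lam (n + (d + 1), 0), lab lam y) ∈ L := by simp [hL]
    have hlt := h.closer_order hd' hd hy' hy hm' hm (Prod.mk_le_mk.2 ⟨by omega, le_rfl⟩)
      (by simp)
    have hin : (lab lam (n + d, 0), lab lam y') ∈ L1 := by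
      have hs := h.isBurge.pairwise
      rw [hL] at hm' hs
      rcases List.mem_append.1 hm' with h2 | h2
      · exact h2
      · exfalso
        rw [List.pairwise_append, List.pairwise_cons] at hs
        rcases List.mem_cons.1 h2 with h3 | h3
        · have := (Prod.mk.inj h3).1
          omega
        · have := hs.2.1.1 _ h3
          simp only at this
          omega
    obtain ⟨M1, M2, rfl⟩ := List.append_of_mem hin
    have hL' : L = M1 ++ (lab lam (n + d, 0), lab lam y') ::
        (M2 ++ (lab lam (n + (d + 1), 0), lab lam y) :: L2) := by rw [hL]; simp
    have h4 := ih hd' hL'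
    have hBL := hB hL
    obtain ⟨-, h5, h6⟩ := hBL.burgeRows_concat hBL.lt_of_concat
    have hB' := hBL
    rw [show M1 ++ (lab lam (n + d, 0), lab lam y') :: M2 ++ [(lab lam (n + (d + 1), 0), lab lam y)] =
      M1 ++ [(lab lam (n + d, 0), lab lam y')] ++
        (M2 ++ [(lab lam (n + (d + 1), 0), lab lam y)]) by simp] at hB'
    have h7 := colIdx_mono hB' (a := lab lam (n + d, 0))
      (SymplecticBranching.mem_labels.2 ⟨(lab lam (n + d, 0), lab lam y'), by simp, Or.inl rfl⟩)
    rw [show M1 ++ [(lab lam (n + d, 0), lab lam y')] ++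
        (M2 ++ [(lab lam (n + (d + 1), 0), lab lam y)]) =
      M1 ++ (lab lam (n + d, 0), lab lam y') :: M2 ++ [(lab lam (n + (d + 1), 0), lab lam y)]
        by simp] at h7
    rw [hlab] at h6 h7 hBL h5 ⊢
    have h8 := colIdx_lt_of_consecutive hBL (j := lab lam (n + d, 0)) (i := lab lam y')
      (i' := lab lam y) (by simp) (by simp) hlt
    obtain ⟨m, hm⟩ := h5
    simp only at h6 hm
    omega

theorem IsMatching.le_colIdx (h : IsMatching n T (cells lam).length L)
    (hT : ∀ i j, (i, j) ∈ lam → 1 ≤ T i j) (d : ℕ) (hd : (n + d, 0) ∈ lam) :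
    2 * d + 1 ≤ colIdx (burgeRows L) (lab lam (n + d, 0)) := by
  have h1 := le_entry_of_col T hT hd
  obtain ⟨y, hy, hm⟩ := h.barred _ hd (lab_le hd) (by simp only; omega)
  obtain ⟨L1, L2, hL⟩ := List.append_of_mem hm
  refine (h.le_colIdx_insert hT d hd hL).trans ?_
  have hB := h.isBurge
  rw [hL, show L1 ++ (lab lam (n + d, 0), lab lam y) :: L2 =
    L1 ++ [(lab lam (n + d, 0), lab lam y)] ++ L2 by simp] at hB ⊢
  exact colIdx_mono hB
    (SymplecticBranching.mem_labels.2 ⟨(lab lam (n + d, 0), lab lam y), by simp, Or.inl rfl⟩)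

end

section

/-! ### The filling of a dominant tableau is a Littlewood–Richardson–Sundaram tableau -/

variable {lam mu : YoungDiagram} {n : ℕ} {T : SemistandardYoungTableau lam} {L : List (ℕ × ℕ)}

/-- The number of rows of the tableau of a part of a picture. -/
theorem IsPicture.rowIdx_lt {u V : List ℕ} (h : IsPicture lam lam (u ++ V)) {a : ℕ} (ha : a ∈ u) :
    rowIdx (bumpAll u []) a < lam.colLen 0 := by
  have hn := h.nodup
  have hu : u.Nodup := (List.nodup_append.1 hn).1
  have hsu := std_bumpAll hu
  have h1 : rowIdx (bumpAll u []) a < numRows (bumpAll u []) :=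
    lt_numRows hsu.reg ((mem_row_iff hsu).2 ⟨mem_bumpAll.2 ha, rfl⟩)
  refine h1.trans_le ?_
  have h2 : HasDec 1 u (numRows (bumpAll u [])) := by
    rw [hasDec_bumpAll hu]
    have h3 : numRows (bumpAll u []) = len (bumpAll u []) 0 := by
      cases bumpAll u [] <;> simp [numRows, len]
    rw [h3, len_eq_countP hsu.2.2]
    refine le_of_eq (List.countP_congr fun a _ => ?_)
    simp
  -- The number of rows is the length of a decreasing subsequence of `u`, which is also one of the
  -- whole picture; the colour 1 excludes the letters of `V`. In the tableau of the picture such a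
  -- subsequence meets each row of λ at most once.
  have h3 : HasDec 1 (u ++ V) (numRows (bumpAll u [])) := by
    obtain ⟨f, h4, h5⟩ := h2
    refine ⟨fun a => if a ∈ u then f a else 1, ?_, ?_⟩
    · have hV : ∀ b ∈ V, b ∉ u := fun b hb hbu => (List.nodup_append.1 hn).2.2 b hbu b hb rfl
      rw [List.pairwise_append]
      refine ⟨h4.imp_of_mem ?_, (List.nodup_append.1 hn).2.1.imp_of_mem ?_, ?_⟩
      · intro a b ha hb
        simp only [ha, hb, if_true]
        exact id
      · intro a b ha hb _
        simp [hV a ha]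
      · intro a ha b hb
        simp only [ha, hV b hb, if_true, if_false]
        omega
    · rw [List.countP_append]
      refine h5.trans ((le_of_eq (List.countP_congr fun a ha => ?_)).trans (Nat.le_add_right _ _))
      simp [ha]
  have hst := std_bumpAll hn
  have ht := h.isTab le_rfl
  have h4 := ((knuth_colRead_bumpAll hn).hasDec hn).1 h3
  rw [← List.filter_true (colRead _)] at h4
  refine h4.le_of_rowIdx hst ?_
  intro a ha _
  rw [mem_bumpAll, h.1] at ha
  obtain ⟨p, hp, rfl⟩ := ha
  rw [(ht.position hst le_rfl hp).2.1]
  exact (YoungDiagram.mem_iff_lt_colLen.1 hp).trans_le (lam.colLen_anti _ _ (Nat.zero_le _))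

theorem isSemistandardSkew_fill (hmul : mu ≤ lam) (hL : IsBurge L)
    (hlab : ∀ a, a ∈ labels L ↔ a ∈ skewLabels lam mu)
    (h : IsPicture lam lam (bumpingSequence L ++ pictureWord lam mu))
    (hlam : lam.colLen 0 ≤ 2 * n - 1) : IsSemistandardSkew n lam mu (fill lam mu L) := by
  have hrows := h.rows hL
  refine ⟨hmul, ?_, ?_, ?_, ?_⟩
  · intro i j h1 h2
    have ha : lab lam (i, j) ∈ bumpingSequence L :=
      (bumpingSequence_perm L).mem_iff.2 ((hlab _).2 (mem_skewLabels.2 ⟨_, h1, h2, rfl⟩))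
    have h3 := h.rowIdx_lt ha
    rw [rowIdx_bumpAll hL.nodup ha] at h3
    rw [fill, if_pos ⟨h1, h2⟩]
    change _ ∧ colIdx (rowBump _) _ + 1 ≤ _
    omega
  · intro i j h1
    rw [fill, if_neg h1]
  · intro i j k hjk hj hk
    have hj' : (i, j) ∈ lam := lam.up_left_mem le_rfl hjk.le hk
    have hk' : (i, k) ∉ mu := fun h => hj (mu.up_left_mem le_rfl hjk.le h)
    rw [fill, fill, if_pos ⟨hj', hj⟩, if_pos ⟨hk, hk'⟩]
    have := weakly_increasing_row hL hlab hrows hjk hj hk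
    omega
  · intro i k j hik hi hk
    have hi' : (i, j) ∈ lam := lam.up_left_mem hik.le le_rfl hk
    have hk' : (k, j) ∉ mu := fun h => hi (mu.up_left_mem hik.le le_rfl h)
    rw [fill, fill, if_pos ⟨hi', hi⟩, if_pos ⟨hk, hk'⟩]
    have h1 := colIdx_order hL hrows hi' hk ((hlab _).2 (mem_skewLabels.2 ⟨_, hi', hi, rfl⟩))
      ((hlab _).2 (mem_skewLabels.2 ⟨_, hk, hk', rfl⟩)) (Prod.mk_le_mk.2 ⟨hik.le, le_rfl⟩)
      (by simp; omega)
    have h2 := (lab_lt_iff hi' hk).2 (Or.inr ⟨rfl, hik⟩)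
    omega

/-- Below row `n` the first column lies outside μ, as μ has at most `n` rows. Its cell in the row of
the given one already carries a value greater than `2 * i + 1`, and rows increase weakly. -/
theorem fill_odd (h : IsMatching n T (cells lam).length L)
    (hT : ∀ i j, (i, j) ∈ lam → 1 ≤ T i j) (hmu : mu.colLen 0 ≤ n)
    (hlab : ∀ a, a ∈ labels L ↔ a ∈ skewLabels lam mu)
    (hrows : IsPicture lam lam ((colRead (burgeRows L)).reverse ++ pictureWord lam mu))
    {i r c : ℕ} (hi : fill lam mu L r c = 2 * i + 1) : r + 1 ≤ n + i := by
  have hrc : (r, c) ∈ lam ∧ (r, c) ∉ mu := by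
    by_contra hne
    rw [fill, if_neg hne] at hi
    omega
  rw [fill, if_pos hrc] at hi
  by_contra hlt
  obtain ⟨d, rfl⟩ : ∃ d, r = n + d := ⟨r - n, by omega⟩
  have h0 : (n + d, 0) ∈ lam := lam.up_left_mem le_rfl (Nat.zero_le c) hrc.1
  have h0' : (n + d, 0) ∉ mu := by
    rw [YoungDiagram.mem_iff_lt_colLen]
    omega
  have h1 := h.le_colIdx hT d h0
  have h2 : colIdx (burgeRows L) (lab lam (n + d, 0)) ≤ colIdx (burgeRows L) (lab lam (n + d, c)) := by
    rcases Nat.eq_zero_or_pos c with rfl | hc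
    · exact le_rfl
    · exact weakly_increasing_row h.isBurge hlab hrows hc h0' hrc.1
  omega

theorem exists_phi_mem_LRS (hT : T ∈ domres n lam mu) (hlam : lam.colLen 0 ≤ 2 * n - 1)
    (hmu : mu.colLen 0 ≤ n) : ∃ eta : YoungDiagram, IsEvenShape eta ∧
      HasShape (evenTableau n (word T)) eta ∧ phi n mu T ∈ LRS n lam mu eta := by
  have h := isDominantPicture hT
  have hL := h.matching.isBurge
  obtain ⟨eta, h1, h2, h3⟩ := hL.exists_evenShape
  refine ⟨eta, h1, h2, ?_⟩
  rw [h.phi_eq]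
  refine ⟨isSemistandardSkew_fill h.le hL h.mem_labels h.picture hlam,
    isDominantWord_fill hL h.mem_labels, fun i => ?_, fun i _ r c hi => ?_⟩
  · rw [h3, count_fill hL h.mem_labels]
  · exact fill_odd h.matching (fun i j hij => (hT.1 i j hij).1) hmu h.mem_labels
      (h.picture.rows hL) hi

/-- The partial `Q`-symbols of the initial subwords. -/
theorem isStandard_partialQ (hT : T ∈ domres n lam mu) (k : ℕ) :
    IsStandard (partialQ n ((word T).take k)) ∧
      ∀ i, ((row (partialQ n ((word T).take k)) i).length : ℤ) = weight n ((word T).take k) i := by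
  wlog hk : k ≤ (cells lam).length generalizing k
  · have := this (cells lam).length le_rfl
    rw [← length_word T, List.take_length] at this
    rwa [List.take_of_length_le (by rw [length_word]; omega)]
  have h := isState_upDown hT k hk
  exact ⟨h.tab.isStandard (fun p hp => hp.1) h.matching.upClosed, h.weight_eq⟩

/-! ### Injectivity -/

theorem colIdx_eq_of_fill_eq {L L' : List (ℕ × ℕ)} (hL : IsBurge L) (hL' : IsBurge L')
    (hlab : ∀ a, a ∈ labels L ↔ a ∈ skewLabels lam mu)
    (hlab' : ∀ a, a ∈ labels L' ↔ a ∈ skewLabels lam mu)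
    (h : fill lam mu L = fill lam mu L') : L = L' := by
  refine burgeRows_injective hL hL' (hL.std.ext hL'.std ?_ ?_)
  · intro a
    rw [mem_burgeRows, mem_burgeRows, hlab, hlab']
  · intro a ha
    rw [mem_burgeRows, hlab, mem_skewLabels] at ha
    obtain ⟨⟨i, j⟩, h1, h2, rfl⟩ := ha
    have := congrFun (congrFun h i) j
    rw [fill, fill, if_pos ⟨h1, h2⟩, if_pos ⟨h1, h2⟩] at this
    omega

theorem IsMatching.ext {T' : SemistandardYoungTableau lam}
    (h : IsMatching n T (cells lam).length L) (h' : IsMatching n T' (cells lam).length L) :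
    T = T' := by
  have key : ∀ {T T' : SemistandardYoungTableau lam}, IsMatching n T (cells lam).length L →
      IsMatching n T' (cells lam).length L → ∀ p ∈ lam, n < T p.1 p.2 →
        T p.1 p.2 = T' p.1 p.2 := by
    intro T T' h h' p hp hpn
    obtain ⟨y, hy, h1⟩ := h.barred p hp (lab_le hp) hpn
    rw [(h.pair' hy hp h1).2.2.2.2, (h'.pair' hy hp h1).2.2.2.2]
  refine SemistandardYoungTableau.ext fun i j => ?_
  by_cases hp : (i, j) ∈ lam
  · by_cases h1 : n < T i j
    · exact key h h' _ hp h1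
    · by_cases h2 : n < T' i j
      · exact (key h' h _ hp h2).symm
      · rw [h.unbarred (i, j) hp (lab_le hp) (by simp only; omega),
          h'.unbarred (i, j) hp (lab_le hp) (by simp only; omega)]
  · rw [T.zeros hp, T'.zeros hp]

theorem injOn_phi : Set.InjOn (phi n mu) (domres n lam mu) := by
  intro T hT T' hT' he
  have h := isDominantPicture hT
  have h' := isDominantPicture hT'
  rw [h.phi_eq, h'.phi_eq] at he
  have hL := colIdx_eq_of_fill_eq h.matching.isBurge h'.matching.isBurge h.mem_labels h'.mem_labels he
  have hm := h'.matching
  rw [← hL] at hm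
  exact h.matching.ext hm

end

section

/-! ### The two-line array of a Littlewood–Richardson–Sundaram tableau -/

variable {lam mu : YoungDiagram} {n : ℕ} {L : List (ℕ × ℕ)}

/-- Row `s` of the tableau to be constructed consists of the labels of the cells with value `s + 1`.
The lattice condition makes it standard, evenness of the weight pairs its rows, and then it comes
from an array. -/
theorem exists_fill_eq {eta : YoungDiagram} (heta : IsEvenShape eta) {S : ℕ → ℕ → ℕ}
    (hS : S ∈ LRS n lam mu eta) : ∃ L, IsBurge L ∧
      (∀ a, a ∈ labels L ↔ a ∈ skewLabels lam mu) ∧ fill lam mu L = S := by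
  obtain ⟨⟨hle, hpos, hzero, -⟩, hdom, hcount, -⟩ := hS
  set g : ℕ → ℕ := fun a => S (cellAt lam a).1 (cellAt lam a).2 with hg
  have hsl := skewLabels_pairwise lam mu
  have hlpos : ∀ a ∈ skewLabels lam mu, 0 < a := by
    intro a ha
    obtain ⟨p, -, -, rfl⟩ := mem_skewLabels.1 ha
    exact lab_pos
  rw [skewWord_eq, isDominantWord_map hsl hlpos] at hdom
  set f : ℕ → List ℕ := fun s => (skewLabels lam mu).filter fun a => g a = s + 1 with hf
  have hlen : ∀ s, (f s).length = eta.rowLen s := by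
    intro s
    rw [← hcount, skewWord_eq, List.count, List.countP_map, List.countP_eq_length_filter, hf]
    congr 1
  have hne : ∀ s, s < eta.colLen 0 ↔ f s ≠ [] := by
    intro s
    rw [← List.length_pos_iff, hlen, ← YoungDiagram.mem_iff_lt_colLen,
      YoungDiagram.mem_iff_lt_rowLen]
  have hval : ∀ a ∈ skewLabels lam mu, a ∈ f (g a - 1) ∧ 1 ≤ g a := by
    intro a ha
    obtain ⟨p, h1, h2, rfl⟩ := mem_skewLabels.1 ha
    have h3 := (hpos p.1 p.2 h1 h2).1
    have h4 : g (lab lam p) = S p.1 p.2 := by rw [hg]; simp only [cellAt_lab h1]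
    refine ⟨List.mem_filter.2 ⟨ha, ?_⟩, by omega⟩
    simp only [decide_eq_true_eq]
    omega
  set t : List (List ℕ) := (List.range (eta.colLen 0)).map f with ht
  have hgetD : ∀ s, t.getD s [] = f s := by
    intro s
    by_cases hs : s < eta.colLen 0
    · rw [List.getD_eq_getElem _ _ (by simpa [ht] using hs)]
      simp [ht]
    · rw [List.getD_eq_default _ _ (by simpa [ht] using hs)]
      by_contra h
      exact hs ((hne s).2 (Ne.symm h))
  have hmemt : ∀ a, a ∈ t.flatten ↔ a ∈ skewLabels lam mu := by
    intro a
    rw [ht, List.mem_flatten]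
    constructor
    · rintro ⟨l, hl, ha⟩
      obtain ⟨s, -, rfl⟩ := List.mem_map.1 hl
      exact List.mem_of_mem_filter ha
    · intro ha
      have h1 := (hval a ha).1
      exact ⟨_, List.mem_map_of_mem (List.mem_range.2 ((hne _).2 (List.ne_nil_of_mem h1))), h1⟩
  have hstd : Std t := by
    refine ⟨?_, ?_, ?_⟩
    · intro l hl
      obtain ⟨s, hs, rfl⟩ := List.mem_map.1 hl
      exact ⟨(hne s).1 (List.mem_range.1 hs), hsl.filter _⟩
    · rw [ht, List.pairwise_map]
      refine List.pairwise_lt_range.imp ?_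
      intro s s' hlt
      induction hlt with
      | refl =>
        intro b
        have := hdom b (s + 1) (by omega)
        simpa only [hf, List.countP_filter, Bool.and_comm, hg] using this
      | step _ ih =>
        rename_i m _
        refine ih.trans fun b => ?_
        have := hdom b (m + 1) (by omega)
        simpa only [hf, List.countP_filter, Bool.and_comm, hg] using this
    · rw [ht, ← List.flatMap_def, List.Nodup, List.pairwise_flatMap]
      refine ⟨fun s _ => (nodup_of_lt hsl).filter _, List.nodup_range.imp ?_⟩
      intro s s' hss a ha b hb hab
      subst hab
      have h1 := (List.mem_filter.1 ha).2
      have h2 := (List.mem_filter.1 hb).2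
      simp only [decide_eq_true_eq] at h1 h2
      omega
  have hpair : IsPaired t := by
    intro s
    rw [len, len, hgetD, hgetD, hlen, hlen]
    refine eq_of_forall_lt_iff fun j => ?_
    rw [← YoungDiagram.mem_iff_lt_rowLen, ← YoungDiagram.mem_iff_lt_rowLen,
      YoungDiagram.mem_iff_lt_colLen, YoungDiagram.mem_iff_lt_colLen]
    obtain ⟨m, hm⟩ := heta j
    omega
  obtain ⟨L, hL, hLt⟩ := exists_burgeRows hstd hpair
  have hlab : ∀ a, a ∈ labels L ↔ a ∈ skewLabels lam mu := fun a => by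
    rw [← mem_burgeRows, hLt, hmemt]
  refine ⟨L, hL, hlab, ?_⟩
  funext i j
  by_cases hij : (i, j) ∈ lam ∧ (i, j) ∉ mu
  · have ha : lab lam (i, j) ∈ skewLabels lam mu := mem_skewLabels.2 ⟨_, hij.1, hij.2, rfl⟩
    have h1 := hval _ ha
    rw [← hgetD, mem_getD_iff hstd.2.2] at h1
    have h2 : g (lab lam (i, j)) = S i j := by rw [hg]; simp only [cellAt_lab hij.1]
    rw [fill, if_pos hij, hLt, h1.1.2, ← h2]
    omega
  · rw [fill, if_neg hij, hzero i j hij]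

theorem isPicture_of_isSemistandardSkew (hL : IsBurge L)
    (hlab : ∀ a, a ∈ labels L ↔ a ∈ skewLabels lam mu)
    (hS : IsSemistandardSkew n lam mu (fill lam mu L)) :
    IsPicture lam lam (bumpingSequence L ++ pictureWord lam mu) := by
  obtain ⟨hle, -, -, hrow, hcol⟩ := hS
  have hmu := isPicture_pictureWord hle
  refine IsPicture.of_rows hL ⟨fun a => ?_, ?_⟩
  · rw [List.mem_append, List.mem_reverse, mem_colRead, mem_burgeRows, hlab, mem_skewLabels, hmu.1]
    constructor
    · rintro (⟨p, h1, -, h2⟩ | ⟨p, h1, h2⟩)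
      · exact ⟨p, h1, h2⟩
      · exact ⟨p, hle h1, h2⟩
    · rintro ⟨p, h1, h2⟩
      by_cases hp : p ∈ mu
      · exact Or.inr ⟨p, hp, h2⟩
      · exact Or.inl ⟨p, h1, hp, h2⟩
  · have hmem : ∀ a ∈ (colRead (burgeRows L)).reverse, ∃ p ∈ lam, p ∉ mu ∧ lab lam p = a := by
      intro a ha
      rwa [List.mem_reverse, mem_colRead, mem_burgeRows, hlab, mem_skewLabels] at ha
    rw [List.pairwise_append]
    refine ⟨?_, hmu.2, ?_⟩
    · rw [List.pairwise_reverse]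
      refine (colRead_pairwise hL.std).imp_of_mem ?_
      intro b a hb ha hab hle'
      obtain ⟨⟨i, j⟩, h1, h2, rfl⟩ := hmem a (List.mem_reverse.2 ha)
      obtain ⟨⟨i', j'⟩, h1', h2', rfl⟩ := hmem b (List.mem_reverse.2 hb)
      -- Two comparable cells are joined through the corner `(i, j')`. Weak increase along the row
      -- and strict increase down the column leave only equal values in a common row, where the
      -- labels decrease.
      rw [cellAt_lab h1, cellAt_lab h1', Prod.mk_le_mk] at hle'
      have hm : (i, j') ∈ lam := lam.up_left_mem hle'.1 le_rfl h1'
      have hm' : (i, j') ∉ mu := fun h => h2 (mu.up_left_mem le_rfl hle'.2 h)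
      have e1 : fill lam mu L i j ≤ fill lam mu L i j' := by
        rcases Nat.lt_or_eq_of_le hle'.2 with h | h
        · exact hrow _ _ _ h h2 hm
        · rw [h]
      have e2 : i < i' → fill lam mu L i j' < fill lam mu L i' j' := fun h => hcol _ _ _ h hm' h1'
      have e3 : i = i' → fill lam mu L i j' = fill lam mu L i' j' := fun h => by rw [h]
      have f1 : fill lam mu L i j = colIdx (burgeRows L) (lab lam (i, j)) + 1 := by
        rw [fill, if_pos ⟨h1, h2⟩]
      have f2 : fill lam mu L i' j' = colIdx (burgeRows L) (lab lam (i', j')) + 1 := by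
        rw [fill, if_pos ⟨h1', h2'⟩]
      rcases hab with h | ⟨h, h', -⟩
      · omega
      · have := readBefore_of_lt h1 h1' h'
        simp only [ReadBefore] at this
        omega
    · intro a ha b hb hle'
      obtain ⟨p, h1, h2, rfl⟩ := hmem a ha
      obtain ⟨q, h1', rfl⟩ := (hmu.1 b).1 hb
      rw [cellAt_lab h1, cellAt_lab (hle h1')] at hle'
      exact h2 (mu.isLowerSet hle' h1')

end

/-! ### Comparable cells in the picture of a two-line array -/

/-- The two-line array consists of the labels of the cells of `λ / μ`, and the cells of `λ` in the
order of its bumping sequence form a picture. -/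
structure IsSkewArray (lam mu : YoungDiagram) (L : List (ℕ × ℕ)) : Prop where
  isBurge : IsBurge L
  le : mu ≤ lam
  picture : IsPicture lam lam (bumpingSequence L ++ pictureWord lam mu)

/-- The cells of `λ` whose labels do not belong to the upper line of the array. -/
def nonclosers (lam : YoungDiagram) (L : List (ℕ × ℕ)) : Set (ℕ × ℕ) :=
  {p | p ∈ lam ∧ ∀ i, (lab lam p, i) ∉ L}

namespace IsSkewArray

variable {lam mu : YoungDiagram} {L : List (ℕ × ℕ)}

theorem mem_labels (h : IsSkewArray lam mu L) (a : ℕ) : a ∈ labels L ↔ a ∈ skewLabels lam mu :=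
  mem_labels_iff h.le (isPicture_pictureWord h.le) h.picture a

theorem pair (h : IsSkewArray lam mu L) {e : ℕ × ℕ} (he : e ∈ L) :
    ∃ y ∈ lam, ∃ z ∈ lam, e = (lab lam z, lab lam y) ∧ lab lam y < lab lam z := by
  obtain ⟨z, hz, -, h1⟩ :=
    mem_skewLabels.1 ((h.mem_labels _).1 (SymplecticBranching.mem_labels.2 ⟨e, he, Or.inl rfl⟩))
  obtain ⟨y, hy, -, h2⟩ :=
    mem_skewLabels.1 ((h.mem_labels _).1 (SymplecticBranching.mem_labels.2 ⟨e, he, Or.inr rfl⟩))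
  refine ⟨y, hy, z, hz, by rw [h1, h2], ?_⟩
  rw [h1, h2]
  exact h.isBurge.2.2 e he

theorem trichotomy (h : IsSkewArray lam mu L) {p : ℕ × ℕ} (hp : p ∈ lam) :
    p ∈ mu ∨ (∃ i, (lab lam p, i) ∈ L) ∨ ∃ j, (j, lab lam p) ∈ L := by
  by_cases hpm : p ∈ mu
  · exact Or.inl hpm
  · right
    obtain ⟨⟨j, i⟩, he, h1 | h1⟩ :=
      SymplecticBranching.mem_labels.1 ((h.mem_labels _).2 (mem_skewLabels.2 ⟨p, hp, hpm, rfl⟩))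
    · exact Or.inl ⟨i, by rwa [← h1]⟩
    · exact Or.inr ⟨j, by rwa [← h1]⟩

theorem parts (h : IsSkewArray lam mu L) :
    (sortedTop L).Pairwise (fun a b => ¬ cellAt lam a ≤ cellAt lam b) ∧
      (L.map Prod.snd).Pairwise (fun a b => ¬ cellAt lam a ≤ cellAt lam b) ∧
      (∀ e ∈ L, ∀ q ∈ mu, ¬ cellAt lam e.2 ≤ q) ∧
      (∀ e ∈ L, ∀ e' ∈ L, ¬ cellAt lam e.1 ≤ cellAt lam e'.2) ∧
      ∀ e ∈ L, ∀ q ∈ mu, ¬ cellAt lam e.1 ≤ q := by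
  have h1 := h.picture.2
  have hV := (isPicture_pictureWord h.le).1
  rw [bumpingSequence_eq, List.append_assoc, List.pairwise_append, List.pairwise_append] at h1
  refine ⟨h1.1, h1.2.1.1, fun e he q hq => ?_, fun e he e' he' => ?_, fun e he q hq => ?_⟩
  · have := h1.2.1.2.2 e.2 (List.mem_map_of_mem he) _ ((hV _).2 ⟨q, hq, rfl⟩)
    rwa [cellAt_lab (h.le hq)] at this
  · exact h1.2.2 e.1 (mem_sortedTop.2 ⟨e, he, rfl⟩) _
      (List.mem_append_left _ (List.mem_map_of_mem he'))
  · have := h1.2.2 e.1 (mem_sortedTop.2 ⟨e, he, rfl⟩) _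
      (List.mem_append_right _ ((hV _).2 ⟨q, hq, rfl⟩))
    rwa [cellAt_lab (h.le hq)] at this

theorem opener_order (h : IsSkewArray lam mu L) {p q : ℕ × ℕ} (hp : p ∈ lam) (hq : q ∈ lam)
    (hle : p ≤ q) (hne : p ≠ q) {j j' : ℕ} (h1 : (j, lab lam p) ∈ L) (h2 : (j', lab lam q) ∈ L) :
    j' < j := by
  have h3 := List.pairwise_map.1 h.parts.2.1
  have h4 := idxOf_lt_of_pairwise h3 h1 h2
    (fun e => hne (lab_inj hp hq (Prod.mk.inj e).2))
    (by rw [cellAt_lab hp, cellAt_lab hq]; exact fun h => h hle)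
  exact rel_of_idxOf_lt h.isBurge.pairwise h1 h4

theorem closer_order (h : IsSkewArray lam mu L) {z z' : ℕ × ℕ} (hz : z ∈ lam) (hz' : z' ∈ lam)
    (hle : z ≤ z') (hne : z ≠ z') {i i' : ℕ} (h1 : (lab lam z, i) ∈ L)
    (h2 : (lab lam z', i') ∈ L) : i' < i := by
  have h3 := List.pairwise_map.1 h.parts.1
  have hm : ∀ e ∈ L, e ∈ L.insertionSort fun p q => p.2 ≤ q.2 := fun e he =>
    (List.perm_insertionSort _ L).mem_iff.2 he
  have h4 := idxOf_lt_of_pairwise h3 (hm _ h1) (hm _ h2)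
    (fun e => hne (lab_inj hz hz' (Prod.mk.inj e).1))
    (by rw [cellAt_lab hz, cellAt_lab hz']; exact fun h => h hle)
  exact rel_of_idxOf_lt h.isBurge.pairwise_sort (hm _ h1) h4

theorem exists_opener (h : IsSkewArray lam mu L) {p q : ℕ × ℕ} (hp : p ∈ lam) (hle : p ≤ q)
    (hq : q ∈ nonclosers lam L) {j : ℕ} (h1 : (j, lab lam p) ∈ L) : ∃ j', (j', lab lam q) ∈ L := by
  rcases h.trichotomy hq.1 with h2 | ⟨i, h2⟩ | h2
  · have := h.parts.2.2.1 _ h1 q h2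
    rw [cellAt_lab hp] at this
    exact absurd hle this
  · exact absurd h2 (hq.2 i)
  · exact h2

theorem mem_nonclosers_of_le (h : IsSkewArray lam mu L) {p q : ℕ × ℕ} (hle : p ≤ q)
    (hq : q ∈ nonclosers lam L) : p ∈ nonclosers lam L := by
  have hp := lam.isLowerSet hle hq.1
  refine ⟨hp, fun i hi => ?_⟩
  rcases h.trichotomy hq.1 with h2 | ⟨i, h2⟩ | ⟨j, h2⟩
  · have := h.parts.2.2.2.2 _ hi q h2
    rw [cellAt_lab hp] at this
    exact this hle
  · exact hq.2 i h2
  · have := h.parts.2.2.2.1 _ hi _ h2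
    rw [cellAt_lab hp, cellAt_lab hq.1] at this
    exact this hle

theorem opener_mem_nonclosers (h : IsSkewArray lam mu L) {p : ℕ × ℕ} (hp : p ∈ lam) {j : ℕ}
    (hj : (j, lab lam p) ∈ L) : p ∈ nonclosers lam L :=
  ⟨hp, fun i hi => by
    have := h.parts.2.2.2.1 _ hi _ hj
    exact this le_rfl⟩

theorem mem_nonclosers_of_mem (h : IsSkewArray lam mu L) {p : ℕ × ℕ} (hp : p ∈ mu) :
    p ∈ nonclosers lam L :=
  ⟨h.le hp, fun i hi => by
    have := h.parts.2.2.2.2 _ hi p hp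
    rw [cellAt_lab (h.le hp)] at this
    exact this le_rfl⟩

theorem notMem_of_opener (h : IsSkewArray lam mu L) {p : ℕ × ℕ} (hp : p ∈ lam) {j : ℕ}
    (hj : (j, lab lam p) ∈ L) : p ∉ mu := fun hm => by
  have := h.parts.2.2.1 _ hj p hm
  rw [cellAt_lab hp] at this
  exact this le_rfl

end IsSkewArray

/-! ### The rows of the nonclosers -/

theorem IsBurge.exists_concat {L : List (ℕ × ℕ)} (h : IsBurge L) {a : ℕ} (ha : a ∈ labels L)
    (hmax : ∀ b ∈ labels L, b ≤ a) : ∃ L' i, L = L' ++ [(a, i)] := by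
  rcases List.eq_nil_or_concat' L with rfl | ⟨L', e, rfl⟩
  · simp [labels] at ha
  · refine ⟨L', e.2, ?_⟩
    have h1 := hmax e.1 (mem_labels.2 ⟨e, by simp, Or.inl rfl⟩)
    have h2 := h.2.2 e (by simp)
    rcases mem_labels_concat.1 ha with h3 | h3 | h3
    · rw [h3]
    · omega
    · have := h.lt_of_concat a h3
      omega

/-- The largest label must be the last upper entry. Once that array column is removed, the label
before it in the first column is a bound for the rest, so the induction continues as soon as the
bounds on row indices are inherited. -/
theorem exists_pair_of_le_colIdx {lam : YoungDiagram} {n : ℕ} (d : ℕ) (hd : (n + d, 0) ∈ lam)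
    {L : List (ℕ × ℕ)} (hL : IsBurge L) (hmax : ∀ b ∈ labels L, b ≤ lab lam (n + d, 0))
    (hcol : ∀ m ≤ d, lab lam (n + m, 0) ∈ labels L ∧
      2 * m + 1 ≤ colIdx (burgeRows L) (lab lam (n + m, 0))) :
    ∀ m ≤ d, ∃ i, (lab lam (n + m, 0), i) ∈ L := by
  induction d generalizing L with
  | zero =>
    intro m hm
    obtain rfl : m = 0 := by omega
    obtain ⟨L', i, rfl⟩ := hL.exists_concat (hcol 0 le_rfl).1 hmax
    exact ⟨i, by simp⟩
  | succ d ih =>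
    obtain ⟨L', i, rfl⟩ := hL.exists_concat (hcol (d + 1) le_rfl).1 hmax
    have hL' := hL.of_prefix
    have hd' : (n + d, 0) ∈ lam := lam.up_left_mem (by omega) le_rfl hd
    have hlab : lab lam (n + (d + 1), 0) = lab lam (n + d, 0) + 1 := lab_succ hd
    have hlabm : ∀ m ≤ d, lab lam (n + d, 0) = lab lam (n + m, 0) + (d - m) := by
      intro m hm
      clear * - hm hd'
      induction d with
      | zero => simp [show m = 0 by omega]
      | succ d ih =>
        rcases Nat.lt_or_eq_of_le hm with h | h
        · have h1 : lab lam (n + (d + 1), 0) = lab lam (n + d, 0) + 1 := lab_succ hd'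
          rw [h1, ih (lam.up_left_mem (by omega) le_rfl hd') (by omega)]
          omega
        · subst h
          simp
    obtain ⟨h1, -, h3⟩ := hL.burgeRows_concat hL.lt_of_concat
    have hn := (labels_concat _ _).nodup_iff.1 hL.2.1
    rw [List.nodup_cons, List.nodup_cons] at hn
    have hi : i ∉ (burgeRows L').flatten := by rw [mem_burgeRows]; exact hn.2.1
    have hlt : ∀ b ∈ labels L', b ≤ lab lam (n + d, 0) := by
      intro b hb
      have := hL.lt_of_concat b hb
      simp only at this
      omega
    have key : ∀ m ≤ d, lab lam (n + m, 0) ∈ labels L' ∧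
        2 * m + 1 ≤ colIdx (burgeRows L') (lab lam (n + m, 0)) := by
      intro m hm
      obtain ⟨g1, g2⟩ := hcol m (by omega)
      have hm' := hlabm m hm
      have hmem : lab lam (n + m, 0) ∈ labels L' := by
        rcases mem_labels_concat.1 g1 with g | g | g
        · simp only at g
          omega
        -- A freshly inserted lower entry lies in row 0, so it cannot satisfy the bound.
        · rw [h1 _ (by rw [g]; simp), g, colIdx_columnInsert_self hi] at g2
          omega
        · exact g
      refine ⟨hmem, ?_⟩
      rw [h1 _ (List.mem_cons_of_mem _ hmem)] at g2
      -- If the insertion moved this label down from row `2 * m`, the labels bumped after it would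
      -- have to increase strictly until the route ends, in row `2 * d + 2` or later. Only the `d -
      -- m` larger labels are left for that, which is too few.
      rcases colIdx_columnInsert hL'.std.2.2 hi (mem_burgeRows.2 hmem) with g | ⟨-, -, e, g4, g5⟩
      · simp only at g2
        omega
      · have h5 := hlt e (mem_burgeRows.1 g4)
        have h6 := (hcol (d + 1) le_rfl).2
        simp only at h3
        omega
    intro m hm
    rcases Nat.lt_or_eq_of_le hm with h | h
    · obtain ⟨i', hi'⟩ := ih hd' hL' hlt key m (by omega)
      exact ⟨i', List.mem_append_left _ hi'⟩
    · subst h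
      exact ⟨i, by simp⟩

section

/-! ### The tableau of a Littlewood–Richardson–Sundaram tableau -/

variable {lam mu eta : YoungDiagram} {n : ℕ} {L : List (ℕ × ℕ)}

theorem le_colIdx_of_mem_LRS (hlab : ∀ a, a ∈ labels L ↔ a ∈ skewLabels lam mu)
    (hS : fill lam mu L ∈ LRS n lam mu eta) (hmu : mu.colLen 0 ≤ n) (d : ℕ)
    (hd : (n + d, 0) ∈ lam) : lab lam (n + d, 0) ∈ labels L ∧
      2 * d + 1 ≤ colIdx (burgeRows L) (lab lam (n + d, 0)) := by
  have hm : ∀ d, (n + d, 0) ∉ mu := fun d => by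
    rw [YoungDiagram.mem_iff_lt_colLen]
    omega
  refine ⟨(hlab _).2 (mem_skewLabels.2 ⟨_, hd, hm d, rfl⟩), ?_⟩
  have hf : ∀ d, (n + d, 0) ∈ lam →
      fill lam mu L (n + d) 0 = colIdx (burgeRows L) (lab lam (n + d, 0)) + 1 := fun d hd => by
    rw [fill, if_pos ⟨hd, hm d⟩]
  obtain ⟨⟨-, -, -, -, hcol⟩, -, hcount, hodd⟩ := hS
  -- The Sundaram condition is stated only for `i ≤ ℓ(η) / 2`. A value that occurs in the filling is
  -- at most `ℓ(η)`, so the restriction is automatic.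
  have hodd' : ∀ d, (n + d, 0) ∈ lam → ∀ i ≤ d, fill lam mu L (n + d) 0 ≠ 2 * i + 1 := by
    intro d hd i hi he
    have h1 : 0 < (skewWord lam mu (fill lam mu L)).count (2 * i + 1) := by
      rw [List.count_pos_iff, skewWord_eq, List.mem_map]
      refine ⟨lab lam (n + d, 0), mem_skewLabels.2 ⟨_, hd, hm d, rfl⟩, ?_⟩
      rw [cellAt_lab hd, he]
    rw [hcount, ← YoungDiagram.mem_iff_lt_rowLen, YoungDiagram.mem_iff_lt_colLen] at h1
    have := hodd i (by omega) _ _ he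
    omega
  suffices h : 2 * d + 2 ≤ fill lam mu L (n + d) 0 by
    rw [hf d hd] at h
    omega
  induction d with
  | zero =>
    have h1 := hodd' 0 hd 0 le_rfl
    rw [hf 0 hd] at h1 ⊢
    omega
  | succ d ih =>
    have h1 := ih (lam.up_left_mem (by omega) le_rfl hd)
    have h2 := hcol (n + d) (n + (d + 1)) 0 (by omega) (hm d) hd
    have h3 := hodd' (d + 1) hd (d + 1) le_rfl
    omega

namespace IsSkewArray

/-- A noncloser in row `n` or below would make `(n, 0)` a noncloser too. But the bottom cell of the
first column has the largest label of all, so the preceding lemmas make every cell of this column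
from row `n` on a closer. -/
theorem row_lt (h : IsSkewArray lam mu L) (hS : fill lam mu L ∈ LRS n lam mu eta)
    (hmu : mu.colLen 0 ≤ n) {p : ℕ × ℕ} (hp : p ∈ nonclosers lam L) : p.1 < n := by
  by_contra hlt
  obtain ⟨d, hd⟩ : ∃ d, p.1 = n + d := ⟨p.1 - n, by omega⟩
  have h0 : (n, 0) ∈ nonclosers lam L :=
    h.mem_nonclosers_of_le (Prod.le_def.2 ⟨by simp only; omega, Nat.zero_le _⟩) hp
  have hpos : n < lam.colLen 0 := YoungDiagram.mem_iff_lt_colLen.1 h0.1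
  have hlast : (n + (lam.colLen 0 - 1 - n), 0) ∈ lam := by
    rw [YoungDiagram.mem_iff_lt_colLen]
    omega
  have hmax : ∀ b ∈ labels L, b ≤ lab lam (n + (lam.colLen 0 - 1 - n), 0) := by
    intro b hb
    obtain ⟨q, hq, -, rfl⟩ := mem_skewLabels.1 ((h.mem_labels b).1 hb)
    rw [← not_lt, lab_lt_iff hlast hq, ReadBefore]
    have := (YoungDiagram.mem_iff_lt_colLen.1 hq).trans_le (lam.colLen_anti _ _ (Nat.zero_le _))
    simp only
    omega
  obtain ⟨i, hi⟩ := exists_pair_of_le_colIdx _ hlast h.isBurge hmax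
    (fun m hm => le_colIdx_of_mem_LRS h.mem_labels hS hmu m
      (lam.up_left_mem (by omega) le_rfl hlast)) 0 (Nat.zero_le _)
  exact h0.2 i hi

end IsSkewArray

open Classical in
/-- The entries of the tableau of a two-line array. -/
noncomputable def arrayEntry (n : ℕ) (lam : YoungDiagram) (L : List (ℕ × ℕ)) (r k : ℕ) : ℕ :=
  if (r, k) ∈ lam then
    if h : ∃ i, (lab lam (r, k), i) ∈ L then 2 * n - (cellAt lam h.choose).1 else r + 1
  else 0

theorem arrayEntry_of_mem {p : ℕ × ℕ} (hp : p ∈ nonclosers lam L) :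
    arrayEntry n lam L p.1 p.2 = p.1 + 1 := by
  rw [arrayEntry, if_pos hp.1, dif_neg]
  rintro ⟨i, hi⟩
  exact hp.2 i hi

theorem IsBurge.arrayEntry_eq (hL : IsBurge L) {z y : ℕ × ℕ} (hz : z ∈ lam) (hy : y ∈ lam)
    (h : (lab lam z, lab lam y) ∈ L) : arrayEntry n lam L z.1 z.2 = 2 * n - y.1 := by
  have h' : ∃ i, (lab lam (z.1, z.2), i) ∈ L := ⟨_, h⟩
  rw [arrayEntry, if_pos hz, dif_pos h']
  have h1 := (Prod.mk.inj (hL.eq_of_label h'.choose_spec h (Or.inl rfl) (Or.inl rfl))).2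
  rw [h1, cellAt_lab hy]

namespace IsSkewArray

theorem cases (h : IsSkewArray lam mu L) {z : ℕ × ℕ} (hz : z ∈ lam) :
    z ∈ nonclosers lam L ∨ ∃ y ∈ nonclosers lam L, (lab lam z, lab lam y) ∈ L := by
  by_cases hn : ∃ i, (lab lam z, i) ∈ L
  · obtain ⟨i, hi⟩ := hn
    obtain ⟨y, hy, z', hz', e, -⟩ := h.pair hi
    obtain ⟨-, rfl⟩ := Prod.mk.inj e
    exact Or.inr ⟨y, h.opener_mem_nonclosers hy hi, hi⟩
  · exact Or.inl ⟨hz, fun i hi => hn ⟨i, hi⟩⟩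

/-- For two closers in a column the lower one has the opener that is read earlier. If that opener
were not in a strictly higher row, it would be south-east of the other opener and hence be closed
earlier, against the reading order within the column. -/
theorem arrayEntry_col (h : IsSkewArray lam mu L) (hrow : ∀ p ∈ nonclosers lam L, p.1 < n)
    {i₁ i₂ j : ℕ} (hi : i₁ < i₂) (hc : (i₂, j) ∈ lam) :
    arrayEntry n lam L i₁ j < arrayEntry n lam L i₂ j := by
  have hc' : (i₁, j) ∈ lam := lam.up_left_mem hi.le le_rfl hc
  have hle : (i₁, j) ≤ (i₂, j) := Prod.mk_le_mk.2 ⟨hi.le, le_rfl⟩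
  rcases h.cases hc with h2 | ⟨⟨b', c'⟩, hy', h2⟩
  · have e1 := arrayEntry_of_mem (n := n) (h.mem_nonclosers_of_le hle h2)
    have e2 := arrayEntry_of_mem (n := n) h2
    simp only at e1 e2
    omega
  · have e2 := h.isBurge.arrayEntry_eq (n := n) hc hy'.1 h2
    have hb' := hrow _ hy'
    rcases h.cases hc' with h1 | ⟨⟨b, c⟩, hy, h1⟩
    · have e1 := arrayEntry_of_mem (n := n) h1
      have := hrow _ h1
      simp only at *
      omega
    · have e1 := h.isBurge.arrayEntry_eq (n := n) hc' hy.1 h1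
      have hb := hrow _ hy
      simp only at e1 e2 hb hb'
      rw [e1, e2]
      by_contra hlt
      have h3 := readBefore_of_lt hy'.1 hy.1
        (h.closer_order hc' hc hle (by simp; omega) h1 h2)
      simp only [ReadBefore] at h3
      have h4 := h.opener_order hy.1 hy'.1 (Prod.mk_le_mk.2 ⟨by omega, by omega⟩)
        (by simp; omega) h1 h2
      rw [lab_lt_iff hc hc', ReadBefore] at h4
      simp only at h4
      omega

theorem arrayEntry_row (h : IsSkewArray lam mu L) (hrow : ∀ p ∈ nonclosers lam L, p.1 < n)
    {r k : ℕ} (hc : (r, k + 1) ∈ lam) :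
    arrayEntry n lam L r k ≤ arrayEntry n lam L r (k + 1) := by
  induction r using Nat.strong_induction_on with
  | _ r ih =>
    have hc' : (r, k) ∈ lam := lam.up_left_mem le_rfl (Nat.le_succ k) hc
    have hle : (r, k) ≤ (r, k + 1) := Prod.mk_le_mk.2 ⟨le_rfl, Nat.le_succ k⟩
    rcases h.cases hc with h2 | ⟨⟨b, c⟩, hy, h2⟩
    · have e1 := arrayEntry_of_mem (n := n) (h.mem_nonclosers_of_le hle h2)
      have e2 := arrayEntry_of_mem (n := n) h2
      simp only at e1 e2
      omega
    · have e2 := h.isBurge.arrayEntry_eq (n := n) hc hy.1 h2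
      have hb := hrow _ hy
      rcases h.cases hc' with h1 | ⟨⟨b', c'⟩, hy', h1⟩
      · have e1 := arrayEntry_of_mem (n := n) h1
        have := hrow _ h1
        simp only at *
        omega
      · have e1 := h.isBurge.arrayEntry_eq (n := n) hc' hy'.1 h1
        have hb' := hrow _ hy'
        simp only at e1 e2 hb hb'
        rw [e1, e2]
        -- If the entries decreased, the opener of `(r, k + 1)` would be south-east of that of `(r,
        -- k)`. The intermediate cell `(b, c')` would be closed between the two, either in column `k
        -- + 1` below row `r`, contradicting the order of closers, or in column `k` above row `r`,
        -- contradicting the induction hypothesis and strictness in column `k + 1`.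
        by_contra hlt
        have hbb : b' < b := by omega
        have h3 := readBefore_of_lt hy.1 hy'.1
          (h.closer_order hc' hc hle (by simp) h1 h2)
        simp only [ReadBefore] at h3
        have hcc : c' < c := by omega
        have hle1 : (b, c') ≤ (b, c) := Prod.mk_le_mk.2 ⟨le_rfl, hcc.le⟩
        have hle2 : (b', c') ≤ (b, c') := Prod.mk_le_mk.2 ⟨hbb.le, le_rfl⟩
        have hm := h.mem_nonclosers_of_le hle1 hy
        obtain ⟨j, hj⟩ := h.exists_opener hy'.1 hle2 hm h1
        have hj1 := h.opener_order hy'.1 hm.1 hle2 (by simp; omega) h1 hj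
        have hj2 := h.opener_order hm.1 hy.1 hle1 (by simp; omega) hj h2
        obtain ⟨y'', hy'', ⟨r'', k''⟩, hz'', e, -⟩ := h.pair hj
        obtain ⟨rfl, -⟩ := Prod.mk.inj e
        have g1 := readBefore_of_lt hz'' hc' hj1
        have g2 := readBefore_of_lt hc hz'' hj2
        simp only [ReadBefore] at g1 g2
        rcases Nat.lt_or_ge k k'' with hk | hk
        · obtain rfl : k'' = k + 1 := by omega
          have g3 := h.closer_order hc hz'' (Prod.mk_le_mk.2 ⟨by omega, le_rfl⟩) (by simp; omega)
            h2 hj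
          rw [lab_lt_iff hm.1 hy.1, ReadBefore] at g3
          simp only at g3
          omega
        · obtain rfl : k'' = k := by omega
          have hr : r'' < r := by omega
          have hz1 : (r'', k'' + 1) ∈ lam := lam.up_left_mem hr.le le_rfl hc
          have g3 := ih r'' hr hz1
          have g4 := h.arrayEntry_col hrow hr hc
          have e3 := h.isBurge.arrayEntry_eq (n := n) hz'' hm.1 hj
          simp only at e3
          omega

/-- The tableau of a two-line array. -/
noncomputable def tableau (h : IsSkewArray lam mu L) (hrow : ∀ p ∈ nonclosers lam L, p.1 < n) :
    SemistandardYoungTableau lam where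
  entry := arrayEntry n lam L
  row_weak' := by
    intro i j1 j2 hj hc
    induction hj with
    | refl => exact h.arrayEntry_row hrow hc
    | step _ ih =>
      exact (ih (lam.up_left_mem le_rfl (Nat.le_succ _) hc)).trans (h.arrayEntry_row hrow hc)
  col_strict' := h.arrayEntry_col hrow
  zeros' := by
    intro i j hij
    rw [arrayEntry, if_neg hij]

theorem tableau_apply (h : IsSkewArray lam mu L) (hrow : ∀ p ∈ nonclosers lam L, p.1 < n)
    (i j : ℕ) : h.tableau hrow i j = arrayEntry n lam L i j := rfl

theorem tableau_le_iff (h : IsSkewArray lam mu L) (hrow : ∀ p ∈ nonclosers lam L, p.1 < n)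
    {p : ℕ × ℕ} (hp : p ∈ lam) : h.tableau hrow p.1 p.2 ≤ n ↔ p ∈ nonclosers lam L := by
  rw [tableau_apply]
  rcases h.cases hp with h1 | ⟨y, hy, h1⟩
  · have := hrow _ h1
    rw [arrayEntry_of_mem h1]
    simp only [h1, iff_true]
    omega
  · rw [h.isBurge.arrayEntry_eq hp hy.1 h1]
    have := hrow _ hy
    constructor
    · intro
      omega
    · intro h2
      exact absurd h1 (h2.2 _)

/-- The array matches the barred cells of its tableau with unbarred cells. -/
theorem isMatching (h : IsSkewArray lam mu L) (hrow : ∀ p ∈ nonclosers lam L, p.1 < n) :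
    IsMatching n (h.tableau hrow) (cells lam).length L := by
  refine ⟨h.isBurge.1, ?_, (List.nodup_append.1 h.isBurge.2.1).2.1, ?_, ?_, ?_⟩
  · intro e he
    obtain ⟨y, hy, z, hz, rfl, hlt⟩ := h.pair he
    have hy' := h.opener_mem_nonclosers hy he
    refine ⟨y, hy, z, hz, rfl, hlt, lab_le hz, hrow _ hy', ?_, ?_⟩
    · rw [tableau_apply, arrayEntry_of_mem hy']
    · rw [tableau_apply, h.isBurge.arrayEntry_eq hz hy he]
  · intro z hz _ hzn
    rcases h.cases hz with h1 | ⟨y, hy, h1⟩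
    · rw [← h.tableau_le_iff hrow hz] at h1
      omega
    · exact ⟨y, hy.1, h1⟩
  · intro p hp _ hpn
    rw [tableau_apply, arrayEntry_of_mem ((h.tableau_le_iff hrow hp).1 hpn)]
  · intro p hp q hq hle hne hqn _ j hj
    obtain ⟨j', hj'⟩ := h.exists_opener hp hle ((h.tableau_le_iff hrow hq).1 hqn) hj
    exact ⟨j', h.opener_order hp hq hle hne hj hj', hj'⟩

theorem unmatched_eq (h : IsSkewArray lam mu L) (hrow : ∀ p ∈ nonclosers lam L, p.1 < n)
    (p : ℕ × ℕ) : p ∈ unmatched n (h.tableau hrow) (cells lam).length L ↔ p ∈ mu := by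
  constructor
  · rintro ⟨h1, h2, h3, h4⟩
    rcases h.trichotomy h1 with g | ⟨i, g⟩ | ⟨j, g⟩
    · exact g
    · exact absurd g (((h.tableau_le_iff hrow h1).1 h3).2 i)
    · exact absurd g (h4 j)
  · intro hp
    refine ⟨h.le hp, lab_le (h.le hp), (h.tableau_le_iff hrow (h.le hp)).2
      (h.mem_nonclosers_of_mem hp), fun j hj => h.notMem_of_opener (h.le hp) hj hp⟩

end IsSkewArray

end

section

/-! ### Tableaux with a matching are dominant -/

variable {lam mu eta : YoungDiagram} {n : ℕ} {T : SemistandardYoungTableau lam} {L : List (ℕ × ℕ)}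

theorem IsMatching.filter (h : IsMatching n T (cells lam).length L) (x : ℕ) :
    IsMatching n T x (L.filter fun e => e.1 ≤ x) := by
  have hmem : ∀ e, e ∈ L.filter (fun e => e.1 ≤ x) ↔ e ∈ L ∧ e.1 ≤ x := fun e => by
    rw [List.mem_filter, decide_eq_true_eq]
  refine ⟨?_, ?_, h.nodup.sublist (List.filter_sublist.map _), ?_, ?_, ?_⟩
  · exact h.sorted.sublist (List.filter_sublist.map _)
  · intro e he
    obtain ⟨h1, h2⟩ := (hmem e).1 he
    obtain ⟨y, hy, z, hz, rfl, h3, -, h4⟩ := h.pair e h1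
    exact ⟨y, hy, z, hz, rfl, h3, h2, h4⟩
  · intro z hz hzx hzn
    obtain ⟨y, hy, h1⟩ := h.barred z hz (lab_le hz) hzn
    exact ⟨y, hy, (hmem _).2 ⟨h1, hzx⟩⟩
  · exact fun p hp _ => h.unbarred p hp (lab_le hp)
  · intro p hp q hq hle hne hqn _ j hj
    obtain ⟨h1, h2⟩ := (hmem _).1 hj
    obtain ⟨j', h3, h4⟩ := h.order p hp q hq hle hne hqn (lab_le hq) j h1
    simp only at h2
    exact ⟨j', h3, (hmem _).2 ⟨h4, h3.le.trans h2⟩⟩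

theorem finite_row_unmatched (x i : ℕ) : {k | (i, k) ∈ unmatched n T x L}.Finite :=
  (Set.finite_Iio (lam.rowLen i)).subset fun _ hk => YoungDiagram.mem_iff_lt_rowLen.1 hk.1

/-- An unbarred letter adds an unmatched cell to its row and a barred letter removes one from the
row of its opener. So the coordinates of the weight count unmatched cells, and dominance follows
from closure under moving up. -/
theorem IsMatching.weight_take (h : IsMatching n T (cells lam).length L) {x : ℕ}
    (hx : x ≤ (cells lam).length) {i : ℕ} (hi : i < n) : weight n ((word T).take x) i =
      {k | (i, k) ∈ unmatched n T x (L.filter fun e => e.1 ≤ x)}.ncard := by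
  induction x with
  | zero =>
    have h0 : ∀ p, ¬ lab lam p ≤ 0 := fun p => by have := lab_pos (lam := lam) (p := p); omega
    simp [weight, unmatched, h0]
  | succ x ih =>
    obtain ⟨hzx, hz⟩ := lab_cellAt (lam := lam) (a := x + 1) (by omega) hx
    set z := cellAt lam (x + 1)
    have hcase : ∀ p ∈ lam, lab lam p ≤ x + 1 → lab lam p ≤ x ∨ p = z := by
      intro p hp hpx
      rcases Nat.lt_or_eq_of_le hpx with h1 | h1
      · exact Or.inl (by omega)
      · exact Or.inr (lab_inj hp hz (h1.trans hzx.symm))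
    rw [take_word_succ T hz hzx, weight_concat _ _ hi, ih (by omega)]
    by_cases hzn : T z.1 z.2 ≤ n
    · have hzr := h.unbarred z hz (lab_le hz) hzn
      have hj : ∀ a, (x + 1, a) ∉ L := by
        intro a ha
        obtain ⟨y, hy, z', hz', e, -, -, h4, -, h5⟩ := h.pair _ ha
        have := lab_inj hz' hz (((Prod.mk.inj e).1).symm.trans hzx.symm)
        subst this
        omega
      have hmem : ∀ p, p ∈ unmatched n T (x + 1) (L.filter fun e => e.1 ≤ x + 1) ↔
          p = z ∨ p ∈ unmatched n T x (L.filter fun e => e.1 ≤ x) := by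
        intro p
        simp only [unmatched, Set.mem_ofPred_eq, List.mem_filter, decide_eq_true_eq, not_and]
        constructor
        · rintro ⟨h1, h2, h3, h4⟩
          rcases hcase p h1 h2 with h5 | h5
          · refine Or.inr ⟨h1, h5, h3, fun j hj hjx => h4 j hj (by omega)⟩
          · exact Or.inl h5
        · rintro (rfl | ⟨h1, h2, h3, h4⟩)
          · refine ⟨hz, hzx.le, hzn, fun j hj hjx => ?_⟩
            have := h.isBurge.2.2 _ hj
            simp only at this
            omega
          · refine ⟨h1, by omega, h3, fun j hj' hjx => h4 j hj' ?_⟩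
            by_contra hne
            rw [show j = x + 1 by omega] at hj'
            exact hj _ hj'
      rw [if_neg (c := T z.1 z.2 = 2 * n - i) (by omega), hzr, sub_zero]
      by_cases hiz : i = z.1
      · rw [if_pos (by omega)]
        have : {k | (i, k) ∈ unmatched n T (x + 1) (L.filter fun e => e.1 ≤ x + 1)} =
            insert z.2 {k | (i, k) ∈ unmatched n T x (L.filter fun e => e.1 ≤ x)} := by
          ext k
          simp only [Set.mem_ofPred_eq, Set.mem_insert_iff, hmem]
          rw [Prod.ext_iff]
          simp [hiz]
        rw [this, Set.ncard_insert_of_notMem _ (finite_row_unmatched _ _)]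
        · push_cast
          ring
        · rintro ⟨-, h1, -⟩
          rw [hiz] at h1
          change lab lam z ≤ x at h1
          omega
      · rw [if_neg (by omega), add_zero]
        congr 2
        ext k
        simp only [Set.mem_ofPred_eq, hmem]
        rw [or_iff_right]
        rintro h1
        exact hiz (by rw [← h1])
    · obtain ⟨y, hy, hm⟩ := h.barred z hz (lab_le hz) (by omega)
      obtain ⟨g1, -, g3, g4, g5⟩ := h.pair' hy hz hm
      rw [hzx] at hm
      have hmem : ∀ p, p ∈ unmatched n T (x + 1) (L.filter fun e => e.1 ≤ x + 1) ↔
          p ≠ y ∧ p ∈ unmatched n T x (L.filter fun e => e.1 ≤ x) := by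
        intro p
        simp only [unmatched, Set.mem_ofPred_eq, List.mem_filter, decide_eq_true_eq, not_and]
        constructor
        · rintro ⟨h1, h2, h3, h4⟩
          refine ⟨?_, h1, ?_, h3, fun j hj hjx => h4 j hj (by omega)⟩
          · rintro rfl
            exact h4 _ hm le_rfl
          · rcases hcase p h1 h2 with h5 | rfl
            · exact h5
            · exact absurd h3 hzn
        · rintro ⟨h0, h1, h2, h3, h4⟩
          refine ⟨h1, by omega, h3, fun j hj hjx => ?_⟩
          rcases Nat.lt_or_eq_of_le hjx with h5 | rfl
          · exact h4 j hj (by omega)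
          · exact h0 (lab_inj h1 hy (h.fst_inj hj hm))
      rw [if_neg (by omega), add_zero, g5]
      by_cases hiy : i = y.1
      · rw [if_pos (by omega)]
        have : {k | (i, k) ∈ unmatched n T (x + 1) (L.filter fun e => e.1 ≤ x + 1)} =
            {k | (i, k) ∈ unmatched n T x (L.filter fun e => e.1 ≤ x)} \ {y.2} := by
          ext k
          simp only [Set.mem_ofPred_eq, Set.mem_sdiff, Set.mem_singleton_iff, hmem]
          rw [Ne, Prod.ext_iff]
          simp only [hiy, true_and]
          tauto
        have hyU : y.2 ∈ {k | (i, k) ∈ unmatched n T x (L.filter fun e => e.1 ≤ x)} := by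
          simp only [hiy, unmatched, Set.mem_ofPred_eq, List.mem_filter, decide_eq_true_eq, not_and]
          refine ⟨hy, by change lab lam y ≤ x; omega, by rw [g4]; omega, fun j hj hjx => ?_⟩
          have := h.snd_inj hj hm
          omega
        have h1 := Set.ncard_sdiff_singleton_add_one hyU (finite_row_unmatched _ _)
        rw [this, ← h1]
        push_cast
        ring
      · rw [if_neg (by omega), sub_zero]
        congr 2
        ext k
        simp only [Set.mem_ofPred_eq, hmem]
        rw [and_iff_right]
        rintro h1
        exact hiy (by rw [← h1])

theorem IsMatching.hasDominance (h : IsMatching n T (cells lam).length L) :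
    HasDominance n (word T) := by
  intro u hu
  have hlen := hu.length_le
  rw [List.prefix_iff_eq_take] at hu
  rw [length_word] at hlen
  rw [hu]
  refine ⟨fun i hi => ?_, fun i hi => ?_⟩
  · rw [h.weight_take hlen hi, h.weight_take hlen (by omega)]
    exact_mod_cast Set.ncard_le_ncard (fun k hk => (h.filter _).upClosed i k hk)
      (finite_row_unmatched _ _)
  · rw [h.weight_take hlen hi]
    exact Nat.cast_nonneg _

/-- Without an earlier unbarred letter the coordinate would become negative at the barred one. -/
theorem HasDominance.hasCancellation {w : List ℕ} (h : HasDominance n w) :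
    HasCancellation n w := by
  rintro i hi hin u v rfl
  have h1 := (h (u ++ [2 * n + 1 - i]) ⟨v, by simp⟩).2 (i - 1) (by omega)
  rw [weight_concat _ _ (by omega), if_neg (by omega), if_pos (by omega), weight,
    if_pos (by omega), show i - 1 + 1 = i by omega] at h1
  rw [← List.count_pos_iff]
  omega

theorem IsMatching.weight_word (h : IsMatching n T (cells lam).length L)
    (hmu : ∀ p, p ∈ unmatched n T (cells lam).length L ↔ p ∈ mu) (hn : mu.colLen 0 ≤ n) (i : ℕ) :
    weight n (word T) i = mu.rowLen i := by
  by_cases hi : i < n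
  · have h1 := h.weight_take le_rfl hi
    have h2 : L.filter (fun e => e.1 ≤ (cells lam).length) = L := by
      rw [List.filter_eq_self]
      intro e he
      obtain ⟨y, hy, z, hz, rfl, -⟩ := h.pair e he
      simpa using lab_le hz
    have h3 : {k | (i, k) ∈ mu} = Set.Iio (mu.rowLen i) := by
      ext k
      exact YoungDiagram.mem_iff_lt_rowLen
    rw [← length_word T, List.take_length, length_word, h2] at h1
    simp only [hmu] at h1
    rw [h1, h3, Set.ncard_eq_toFinset_card']
    simp
  · rw [weight_of_le _ (by omega)]
    have : (i, 0) ∉ mu := by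
      rw [YoungDiagram.mem_iff_lt_colLen]
      omega
    rw [YoungDiagram.mem_iff_lt_rowLen] at this
    omega

/-- The matching of the barred cells of a tableau is unique. -/
theorem IsMatching.unique {L' : List (ℕ × ℕ)} (h : IsMatching n T (cells lam).length L)
    (h' : IsMatching n T (cells lam).length L') : L = L' := by
  have step : ∀ {L L' : List (ℕ × ℕ)}, IsMatching n T (cells lam).length L →
      IsMatching n T (cells lam).length L' → ∀ j,
      (∀ j' < j, ∀ i, (j', i) ∈ L ↔ (j', i) ∈ L') → ∀ i, (j, i) ∈ L → (j, i) ∈ L' := by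
    intro L L' h h' j ih i hi
    obtain ⟨y, hy, z, hz, e, g1, -, g3, g4, g5⟩ := h.pair _ hi
    obtain ⟨rfl, rfl⟩ := Prod.mk.inj e
    obtain ⟨y', hy', hm⟩ := h'.barred z hz (lab_le hz) (by omega)
    obtain ⟨-, -, k3, k4, k5⟩ := h'.pair' hy' hz hm
    obtain ⟨b, c⟩ := y
    obtain ⟨b', c'⟩ := y'
    simp only at *
    obtain rfl : b' = b := by omega
    -- The letter fixes the row of the opener. If the two openers differed, the order condition
    -- would say that the one further to the right had been closed at an earlier step, where both
    -- matchings agree, and it would be closed twice.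
    rcases lt_trichotomy c c' with hc | rfl | hc
    · obtain ⟨j', hj', hj2⟩ := h.order _ hy _ hy' (Prod.mk_le_mk.2 ⟨le_rfl, hc.le⟩)
        (by simp; omega) (by simp only; omega) (lab_le hy') _ hi
      have := h'.snd_inj ((ih j' hj' _).1 hj2) hm
      omega
    · exact hm
    · obtain ⟨j', hj', hj2⟩ := h'.order _ hy' _ hy (Prod.mk_le_mk.2 ⟨le_rfl, hc.le⟩)
        (by simp; omega) (by simp only; omega) (lab_le hy) _ hm
      have := h.snd_inj ((ih j' hj' _).2 hj2) hi
      omega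
  have key : ∀ j i, (j, i) ∈ L ↔ (j, i) ∈ L' := by
    intro j
    induction j using Nat.strong_induction_on with
    | _ j ih =>
      intro i
      exact ⟨step h h' j ih i, step h' h j (fun j' hj' i => (ih j' hj' i).symm) i⟩
  have hp := h.isBurge.pairwise
  have hp' := h'.isBurge.pairwise
  refine List.Perm.eq_of_pairwise (le := fun e e' => e.1 < e'.1)
    (fun a b _ _ h1 h2 => absurd h1 (by omega)) hp hp' ?_
  refine (List.perm_ext_iff_of_nodup (hp.imp fun h e => ?_) (hp'.imp fun h e => ?_)).2
    fun e => key e.1 e.2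
  · rw [e] at h
    exact lt_irrefl _ h
  · rw [e] at h
    exact lt_irrefl _ h

theorem IsSkewArray.tableau_mem (h : IsSkewArray lam mu L)
    (hrow : ∀ p ∈ nonclosers lam L, p.1 < n) (hmu : mu.colLen 0 ≤ n) :
    h.tableau hrow ∈ domres n lam mu := by
  have hM := h.isMatching hrow
  refine ⟨fun i j hij => ?_, hM.hasDominance.hasCancellation, hM.hasDominance,
    hM.weight_word (h.unmatched_eq hrow) hmu⟩
  by_cases hn : h.tableau hrow i j ≤ n
  · have := hM.unbarred (i, j) hij (lab_le hij) hn
    simp only at this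
    omega
  · obtain ⟨y, hy, hm⟩ := hM.barred (i, j) hij (lab_le hij) (by simp only; omega)
    have := (hM.pair' hy hij hm).2.2.2.2
    simp only at this
    omega

theorem exists_phi_eq (hmu : mu.colLen 0 ≤ n) (heta : IsEvenShape eta) {S : ℕ → ℕ → ℕ}
    (hS : S ∈ LRS n lam mu eta) : ∃ T ∈ domres n lam mu, phi n mu T = S := by
  obtain ⟨L, hL, hlab, rfl⟩ := exists_fill_eq heta hS
  have h : IsSkewArray lam mu L :=
    ⟨hL, hS.1.1, isPicture_of_isSemistandardSkew hL hlab hS.1⟩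
  have hrow : ∀ p ∈ nonclosers lam L, p.1 < n := fun p hp => h.row_lt hS hmu hp
  have hT := h.tableau_mem hrow hmu
  have hD := isDominantPicture hT
  refine ⟨_, hT, ?_⟩
  -- The up-down process applied to the constructed tableau returns the original array, because its
  -- matching is unique.
  rw [hD.phi_eq, hD.matching.unique (h.isMatching hrow)]

end

end SymplecticBranching

theorem mainTheorem2 (n : ℕ) (hn : 1 ≤ n) (lam mu : YoungDiagram)
    (hlam : lam.colLen 0 ≤ 2 * n - 1) (hmu : mu.colLen 0 ≤ n) :
    (∀ T ∈ domres n lam mu,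
      (∀ k, IsStandard (partialQ n ((word T).take k)) ∧
        ∀ i, ((row (partialQ n ((word T).take k)) i).length : ℤ) =
          weight n ((word T).take k) i) ∧
      HasShape (partialQ n (word T)) mu ∧
      (IsStandard (finalQ n (word T)) ∧ HasShape (finalQ n (word T)) lam) ∧
      IsStandard (evenTableau n (word T)) ∧
      ∃ eta : YoungDiagram, IsEvenShape eta ∧ HasShape (evenTableau n (word T)) eta ∧
        phi n mu T ∈ LRS n lam mu eta) ∧
    (∀ T ∈ domres n lam mu, ∀ T' ∈ domres n lam mu,
      partialQ n (word T) = partialQ n (word T') ∧ finalQ n (word T) = finalQ n (word T')) ∧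
    Set.BijOn (phi n mu) (domres n lam mu)
      (⋃ eta ∈ {eta : YoungDiagram | IsEvenShape eta}, LRS n lam mu eta) := by
  refine ⟨fun T hT => ?_, fun T hT T' hT' => ?_, ?_, injOn_phi, ?_⟩
  · have h := isDominantPicture hT
    exact ⟨isStandard_partialQ hT, h.partial_tab.hasShape h.le,
      ⟨h.final_tab.isStandard (fun _ hp => hp) (upClosed_diagram lam), h.final_tab.hasShape le_rfl⟩,
      (std_bumpAll h.matching.isBurge.nodup).isStandard, exists_phi_mem_LRS hT hlam hmu⟩
  · have h := isDominantPicture hT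
    have h' := isDominantPicture hT'
    exact ⟨h.partial_tab.ext h'.partial_tab, h.final_tab.ext h'.final_tab⟩
  · intro T hT
    obtain ⟨eta, h1, -, h2⟩ := exists_phi_mem_LRS hT hlam hmu
    exact Set.mem_iUnion₂.2 ⟨eta, h1, h2⟩
  · intro S hS
    obtain ⟨eta, h1, h2⟩ := Set.mem_iUnion₂.1 hS
    obtain ⟨T, hT, h3⟩ := exists_phi_eq hmu h1 h2
    exact ⟨T, hT, h3⟩
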